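/- Theorem 7.1. Throughout, $\mathbf k$ is a field of characteristic zero, and operators act from the right (a composition is read from left to right). Setting. Let $B$ be a $\mathbf k$-vector space with a multiplication $\mathbf m:B\otimes B\to B$ (a bilinear product, not necessarily associative or unital) and a linear map $\tau:B\otimes B\to B\otimes B$. On $B^{\otimes n}$ put $\tau_i=\mathrm{id}^{\otimes(i-1)}\otimes\tau\otimes\mathrm{id}^{\otimes(n-i-1)}$, $1\le i<n$. Suppose that $B$ is a braided algebra with involutive braiding, i.e. $\tau_1\tau_2\tau_1=\tau_2\tau_1\tau_2$ on $B^{\otimes 3}$, $\tau^2=\mathrm{id}$, and $$(\mathbf m\otimes\mathrm{id})\tau=\tau_2\tau_1(\mathrm{id}\otimes\mathbf m),\qquad(\mathrm{id}\otimes\mathbf m)\tau=\tau_1\tau_2(\mathbf m\otimes\mathrm{id}).$$ Notation. For $m\le l$ put $[m;l]=\tau_{l-1}\tau_{l-2}\cdots\tau_m$ (so $[m;m]=1$), and $\nu_r^{l,n}=[l;r+1][l+1;r+2]\cdots[l+n-r-1;n]$ (so $\nu_n^{l,n}=1$). Let $\mathrm{Sh}_n^r$ be the set of $\pi\in S_n$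 with $\pi(1)<\dots<\pi(r)$ and $\pi(r+1)<\dots<\pi(n)$; for such $\pi$ put $[\pi]=[1;\pi(1)][2;\pi(2)]\cdots[r;\pi(r)]$. For $\pi\in S_n$ let $\bar\pi$ be the image of $\pi$ under the homomorphism from $S_n$ to the monoid generated by $\tau_1,\dots,\tau_{n-1}$ with $(i,i+1)\mapsto\tau_i$. The index $(t)$ in $f_{(t)}$ means that every $\tau_i$ in $f$ is replaced by $\tau_{t+i}$. Let $R_n(u_1,\dots,u_n)=(\cdots((u_1u_2)u_3)\cdots)u_n$ for $n\geq 1$. Operations. For $m,n\ge1$ define $P_{m,n}:B^{\otimes(m+n+1)}\to B$ by induction on $m+n$: $$P_{m,n}=(R_m\otimes R_n\otimes\mathrm{id})(\cdot,\cdot,\cdot)-\sum_{\substack{0\le r<m,\ 0\le s<n\\ r+s>0}}\ \sum_{\pi\in\mathrm{Sh}_m^r}\sum_{\sigma\in\mathrm{Sh}_n^s}[\pi][\sigma]_{(m)}\nu_m^{r+1,m+s}\,\bigl((R_rR_s)\cdot P_{m-r,n-s}\bigr),$$ where $(x,y,z)=(xy)z-x(yz)$, and $(R_rR_s)\cdot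 P_{m-r,n-s}$ denotes the product $\bigl(R_r(\cdot)R_s(\cdot)\bigr)P_{m-r,n-s}(\cdot)$ of the values on the first $r$, the next $s$ and the remaining arguments, an empty factor $R_0$ being omitted. Let $[\cdot,\cdot]_\tau=\mathbf m-\tau\mathbf m$, and put $$S_{0,2}=-[\cdot,\cdot]_\tau,\qquad S_{m,2}=-P_{m,1}+\tau_{m+1}P_{m,1}\quad(m\ge1),$$ $$\Phi_{m,n}=\frac1{m!}\frac1{n!}\sum_{\pi\in S_m,\ \sigma\in S_n}\bar\pi\,\bar\sigma_{(m)}P_{m,n-1}\quad(m\ge1,\ n\ge2).$$ Conclusion. $B$ is a Sabinin $\tau$-algebra with respect to the operations $S_{m,2}:B^{\otimes(m+2)}\to B$ ($m\ge0$) and $\Phi_{m,n}:B^{\otimes(m+n)}\to B$ ($m\ge1$, $n\ge2$). That is, each of these operations is a braided operation: if $M$ denotes it and $p$ its arity, then $$(M\otimes\mathrm{id})\tau=\tau_p\tau_{p-1}\cdots\tau_1(\mathrm{id}\otimes M),\qquad(\mathrm{id}\otimes M)\tau=\tau_1\tau_2\cdots\tau_p(M\otimes\mathrm{id}),$$ and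 the following identities hold: (7.2) for all $m\ge0$: $\ S_{m,2}+\tau_{m+1}S_{m,2}=0$; (7.3) for all $0\le r\le m$: $$S_{m+2,2}-\tau_{r+1}S_{m+2,2}+\sum_{k=0}^{r}\sum_{\pi\in\mathrm{Sh}_r^k}[\pi]\bigl(\mathrm{id}^{\otimes k}\otimes S_{r-k,2}\otimes\mathrm{id}^{\otimes(m-r+2)}\bigr)S_{m-r+k+1,2}=0;$$ (7.4) for all $m\ge0$: $$(1+\tau_{m+1}\tau_{m+2}+\tau_{m+2}\tau_{m+1})\Bigl(S_{m+1,2}+\sum_{k=0}^{m}\sum_{\pi\in\mathrm{Sh}_m^k}[\pi]\bigl(\mathrm{id}^{\otimes k}\otimes S_{m-k,2}\otimes\mathrm{id}\bigr)S_{k,2}\Bigr)=0;$$ (7.5) for all $m\ge1$, $n\ge2$ and all $1\le r<m+n$ with $r\ne m$: $\ \Phi_{m,n}-\tau_r\Phi_{m,n}=0$. -/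

import Mathlib

open scoped TensorProduct

namespace BraidedSabinin

noncomputable section

section Braidings

variable {k : Type*} [Field k]

/-- `τ₁ = τ ⊗ id` on `V ⊗ V ⊗ V`. -/
def tau12 {V : Type*} [AddCommGroup V] [Module k V] (τ : V ⊗[k] V →ₗ[k] V ⊗[k] V) :
    (V ⊗[k] V) ⊗[k] V →ₗ[k] (V ⊗[k] V) ⊗[k] V :=
  τ.rTensor V

/-- `τ₂ = id ⊗ τ` on `V ⊗ V ⊗ V`. -/
def tau23 {V : Type*} [AddCommGroup V] [Module k V] (τ : V ⊗[k] V →ₗ[k] V ⊗[k] V) :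
    (V ⊗[k] V) ⊗[k] V →ₗ[k] (V ⊗[k] V) ⊗[k] V :=
  (TensorProduct.assoc k V V V).symm.toLinearMap ∘ₗ τ.lTensor V ∘ₗ
    (TensorProduct.assoc k V V V).toLinearMap

/-- The braid relation `τ₁ τ₂ τ₁ = τ₂ τ₁ τ₂`: the pair `(V, τ)` is a braided space. -/
def IsBraiding {V : Type*} [AddCommGroup V] [Module k V]
    (τ : V ⊗[k] V →ₗ[k] V ⊗[k] V) : Prop :=
  tau12 τ ∘ₗ tau23 τ ∘ₗ tau12 τ = tau23 τ ∘ₗ tau12 τ ∘ₗ tau23 τ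

/-- The braiding is involutive: `τ² = id`. -/
def IsInvolutive {V : Type*} [AddCommGroup V] [Module k V]
    (τ : V ⊗[k] V →ₗ[k] V ⊗[k] V) : Prop :=
  τ ∘ₗ τ = LinearMap.id

/-- A braided (not necessarily associative or unital) algebra: a braided space with a
multiplication `m` such that, operators acting from left to right,
`(m ⊗ id) τ = τ₂ τ₁ (id ⊗ m)` and `(id ⊗ m) τ = τ₁ τ₂ (m ⊗ id)`. -/
structure IsBraidedAlgebra {B : Type*} [NonUnitalNonAssocRing B] [Module k B]
    [IsScalarTower k B B] [SMulCommClass k B B] (τ : B ⊗[k] B →ₗ[k] B ⊗[k] B) : Prop where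
  braiding : IsBraiding τ
  mul_left : τ ∘ₗ (LinearMap.mul' k B).rTensor B =
    (LinearMap.mul' k B).lTensor B ∘ₗ (TensorProduct.assoc k B B B).toLinearMap ∘ₗ
      tau12 τ ∘ₗ tau23 τ
  mul_right : τ ∘ₗ (LinearMap.mul' k B).lTensor B ∘ₗ (TensorProduct.assoc k B B B).toLinearMap =
    (LinearMap.mul' k B).rTensor B ∘ₗ tau23 τ ∘ₗ tau12 τ

end Braidings

section TensorPowers

variable {k : Type*} [Field k] {V : Type*} [AddCommGroup V] [Module k V]

/-- The identification of `V^{⊗1}` with `V`. -/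
def oneEquiv (k : Type*) [Field k] (V : Type*) [AddCommGroup V] [Module k V] :
    (⨂[k]^1 V) ≃ₗ[k] V :=
  PiTensorProduct.subsingletonEquiv (0 : Fin 1)

/-- The identification of `V^{⊗2}` with `V ⊗ V`. -/
def twoEquiv (k : Type*) [Field k] (V : Type*) [AddCommGroup V] [Module k V] :
    (⨂[k]^2 V) ≃ₗ[k] V ⊗[k] V :=
  (TensorPower.mulEquiv (R := k) (M := V) (n := 1) (m := 1)).symm ≪≫ₗ
    TensorProduct.congr (oneEquiv k V) (oneEquiv k V)

/-- The identification of `V^{⊗(n+1)}` with `V^{⊗n} ⊗ V`. -/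
def splitLast (k : Type*) [Field k] (V : Type*) [AddCommGroup V] [Module k V] (n : ℕ) :
    (⨂[k]^(n + 1) V) ≃ₗ[k] (⨂[k]^n V) ⊗[k] V :=
  (TensorPower.mulEquiv (R := k) (M := V) (n := n) (m := 1)).symm ≪≫ₗ
    TensorProduct.congr (LinearEquiv.refl k _) (oneEquiv k V)

/-- The identification of `V^{⊗(n+1)}` with `V ⊗ V^{⊗n}`. -/
def splitFirst (k : Type*) [Field k] (V : Type*) [AddCommGroup V] [Module k V] (n : ℕ) :
    (⨂[k]^(n + 1) V) ≃ₗ[k] V ⊗[k] (⨂[k]^n V) :=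
  TensorPower.cast k V (Nat.add_comm n 1) ≪≫ₗ
    (TensorPower.mulEquiv (R := k) (M := V) (n := 1) (m := n)).symm ≪≫ₗ
      TensorProduct.congr (oneEquiv k V) (LinearEquiv.refl k _)

/-- The tensor product `f ⊗ g` of linear maps between tensor powers. -/
def tmap {a b c d : ℕ} (f : (⨂[k]^a V) →ₗ[k] (⨂[k]^b V)) (g : (⨂[k]^c V) →ₗ[k] (⨂[k]^d V)) :
    (⨂[k]^(a + c) V) →ₗ[k] (⨂[k]^(b + d) V) :=
  (TensorPower.mulEquiv (R := k) (M := V) (n := b) (m := d)).toLinearMap ∘ₗ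
    TensorProduct.map f g ∘ₗ
      (TensorPower.mulEquiv (R := k) (M := V) (n := a) (m := c)).symm.toLinearMap

/-- The map `id^{⊗p} ⊗ f ⊗ id^{⊗q}` on `V^{⊗N}`, where `N = p + a + q`. -/
def inMiddle {a b N M : ℕ} (p q : ℕ) (f : (⨂[k]^a V) →ₗ[k] (⨂[k]^b V))
    (hN : N = p + a + q) (hM : p + b + q = M) : (⨂[k]^N V) →ₗ[k] (⨂[k]^M V) :=
  (TensorPower.cast k V hM).toLinearMap ∘ₗ
    tmap (tmap (LinearMap.id (M := ⨂[k]^p V)) f) (LinearMap.id (M := ⨂[k]^q V)) ∘ₗ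
      (TensorPower.cast k V hN).toLinearMap

/-- The map `id^{⊗p} ⊗ F ⊗ id^{⊗q}` for an `a`-ary multilinear operation `F`. -/
def opInMiddle {a N M : ℕ} (p q : ℕ) (F : (⨂[k]^a V) →ₗ[k] V)
    (hN : N = p + a + q) (hM : p + 1 + q = M) : (⨂[k]^N V) →ₗ[k] (⨂[k]^M V) :=
  inMiddle p q ((oneEquiv k V).symm.toLinearMap ∘ₗ F) hN hM

/-- `τ_i = id^{⊗(i-1)} ⊗ τ ⊗ id^{⊗(n-i-1)}` on `V^{⊗n}` for `1 ≤ i < n`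
(the identity for other `i`, which never occur below). -/
def tauAt (τ : V ⊗[k] V →ₗ[k] V ⊗[k] V) (n i : ℕ) : (⨂[k]^n V) →ₗ[k] (⨂[k]^n V) :=
  if h : 1 ≤ i ∧ i < n then
    inMiddle (i - 1) (n - i - 1)
      ((twoEquiv k V).symm.toLinearMap ∘ₗ τ ∘ₗ (twoEquiv k V).toLinearMap)
      (by omega) (by omega)
  else LinearMap.id

/-- The local action on `V^{⊗n}` of a word `s_{i₁} s_{i₂} ⋯` of the braid monoid, a word being the
list of its indices. It is a right action: the leftmost letter acts first. -/
def act (τ : V ⊗[k] V →ₗ[k] V ⊗[k] V) (n : ℕ) : List ℕ → ((⨂[k]^n V) →ₗ[k] (⨂[k]^n V))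
  | [] => LinearMap.id
  | i :: w => act τ n w ∘ₗ tauAt τ n i

end TensorPowers

section BraidWords

/-- `[m;l] = s_{l-1} s_{l-2} ⋯ s_m` for `m ≤ l` (the empty word for `m = l`). -/
def seg (m l : ℕ) : List ℕ := (List.range' m (l - m)).reverse

/-- `s_m s_{m+1} ⋯ s_{l-1}` for `m ≤ l`. -/
def segRev (m l : ℕ) : List ℕ := List.range' m (l - m)

/-- `ν_r^{l,n} = [l;r+1] [l+1;r+2] ⋯ [l+n-r-1;n]`. -/
def nu (r l n : ℕ) : List ℕ := (List.range (n - r)).flatMap fun j => seg (l + j) (r + 1 + j)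

/-- The word `f_{(t)}` obtained from `f` by shifting all indices by `t`. -/
def shift (t : ℕ) (w : List ℕ) : List ℕ := w.map (t + ·)

/-- The set `Sh_n^r` of `r`-shuffles: permutations increasing on the first `r` places and on
the last `n - r` places. -/
def shuffles (n r : ℕ) : Finset (Equiv.Perm (Fin n)) :=
  Finset.univ.filter fun π => ∀ i j : Fin n, i < j → ((j : ℕ) < r ∨ r ≤ (i : ℕ)) → π i < π j

/-- `[π] = [1;π(1)] [2;π(2)] ⋯ [r;π(r)]` for an `r`-shuffle `π`. The elements of `Fin n` start
from `0`, hence the `+ 1`. -/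
def shuffleWord {n : ℕ} (r : ℕ) (π : Equiv.Perm (Fin n)) : List ℕ :=
  ((List.finRange n).filter fun i : Fin n => (i : ℕ) < r).flatMap fun i : Fin n =>
    seg ((i : ℕ) + 1) ((π i : ℕ) + 1)

/-- The transposition `t_i = (i, i+1)` of `S_n`, for `1 ≤ i < n`. -/
def adjTransposition (n i : ℕ) : Equiv.Perm (Fin n) :=
  if h : 1 ≤ i ∧ i < n then Equiv.swap ⟨i - 1, by omega⟩ ⟨i, h.2⟩ else 1

theorem exists_permWord (n : ℕ) (π : Equiv.Perm (Fin n)) :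
    ∃ w : List ℕ, (∀ i ∈ w, 1 ≤ i ∧ i < n) ∧ (w.map (adjTransposition n)).prod = π := by
  rcases n with _ | n
  · exact ⟨[], by simp, Subsingleton.elim _ _⟩
  · have h : π ∈ Submonoid.closure
        (Set.range fun i : Fin n => Equiv.swap i.castSucc i.succ) := by
      rw [Equiv.Perm.mclosure_swap_castSucc_succ]; trivial
    induction h using Submonoid.closure_induction with
    | mem x hx =>
      obtain ⟨i, rfl⟩ := hx
      refine ⟨[(i : ℕ) + 1], ?_, ?_⟩
      · intro j hj
        rw [List.mem_singleton] at hj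
        have := i.2
        omega
      · have hi : 1 ≤ (i : ℕ) + 1 ∧ (i : ℕ) + 1 < n + 1 := ⟨by omega, by have := i.2; omega⟩
        simp only [List.map_cons, List.map_nil, List.prod_cons, List.prod_nil, mul_one,
          adjTransposition, dif_pos hi]
        rfl
    | one => exact ⟨[], by simp, by simp⟩
    | mul x y _ _ hx hy =>
      obtain ⟨v, hv, rfl⟩ := hx
      obtain ⟨w, hw, rfl⟩ := hy
      refine ⟨v ++ w, ?_, by simp⟩
      intro i hi
      rcases List.mem_append.1 hi with h | h
      · exact hv i h
      · exact hw i h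

/-- A word in the `t_i` representing `π ∈ S_n`. For an involutive braiding, its local action is the
image of `π` under the homomorphism from `S_n` to the monoid generated by the `τ_i` that sends
`t_i` to `τ_i`, whatever the word, since the `τ_i` satisfy the defining relations of `S_n`. -/
def permWord {n : ℕ} (π : Equiv.Perm (Fin n)) : List ℕ :=
  Classical.choose (exists_permWord n π)

theorem permWord_mem {n : ℕ} (π : Equiv.Perm (Fin n)) : ∀ i ∈ permWord π, 1 ≤ i ∧ i < n :=
  (Classical.choose_spec (exists_permWord n π)).1

theorem permWord_prod {n : ℕ} (π : Equiv.Perm (Fin n)) :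
    ((permWord π).map (adjTransposition n)).prod = π :=
  (Classical.choose_spec (exists_permWord n π)).2

end BraidWords

section SabininAlgebras

variable {k : Type*} [Field k] {A : Type*} [AddCommGroup A] [Module k A]

/-- An `m`-ary multilinear operation `F` is braided if, operators acting from left to right,
`(F ⊗ id) τ = τ_m τ_{m-1} ⋯ τ_1 (id ⊗ F)` and `(id ⊗ F) τ = τ_1 τ_2 ⋯ τ_m (F ⊗ id)`
on `A^{⊗(m+1)}`. -/
def IsBraidedOperation (τ : A ⊗[k] A →ₗ[k] A ⊗[k] A) (m : ℕ) (F : (⨂[k]^m A) →ₗ[k] A) : Prop :=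
  τ ∘ₗ F.rTensor A ∘ₗ (splitLast k A m).toLinearMap =
      F.lTensor A ∘ₗ (splitFirst k A m).toLinearMap ∘ₗ act τ (m + 1) (seg 1 (m + 1)) ∧
    τ ∘ₗ F.lTensor A ∘ₗ (splitFirst k A m).toLinearMap =
      F.rTensor A ∘ₗ (splitLast k A m).toLinearMap ∘ₗ act τ (m + 1) (segRev 1 (m + 1))

/-- The vector space `A` with the braiding `τ` and the multilinear operations
`S m = S_{m,2}` (`m ≥ 0`) and `Φ m n = Φ_{m,n}` (`m ≥ 1`, `n ≥ 2`) is a Sabinin `τ`-algebra.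
The values of `Φ m n` for other `m`, `n` play no role. -/
structure IsSabininAlgebra (τ : A ⊗[k] A →ₗ[k] A ⊗[k] A)
    (S : (m : ℕ) → ((⨂[k]^(m + 2) A) →ₗ[k] A))
    (Φ : (m n : ℕ) → ((⨂[k]^(m + n) A) →ₗ[k] A)) : Prop where
  braiding : IsBraiding τ
  involutive : IsInvolutive τ
  braided_S : ∀ m, IsBraidedOperation τ (m + 2) (S m)
  braided_Φ : ∀ m n, 1 ≤ m → 2 ≤ n → IsBraidedOperation τ (m + n) (Φ m n)
  /-- `S_{m,2} + τ_{m+1} S_{m,2} = 0`. -/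
  skew : ∀ m, S m + S m ∘ₗ tauAt τ (m + 2) (m + 1) = 0
  /-- `S_{m+2,2} - τ_{r+1} S_{m+2,2} + ∑_{k=0}^{r} ∑_{π ∈ Sh_r^k}
  [π] (id^{⊗k} ⊗ S_{r-k,2} ⊗ id^{⊗(m-r+2)}) S_{m-r+k+1,2} = 0` for `0 ≤ r ≤ m`. -/
  exchange : ∀ (m r : ℕ) (_hr : r ≤ m),
    S (m + 2) - S (m + 2) ∘ₗ tauAt τ (m + 2 + 2) (r + 1) +
      ∑ j : Fin (r + 1), ∑ π ∈ shuffles r j,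
        S (m - r + (j : ℕ) + 1) ∘ₗ
          opInMiddle (j : ℕ) (m - r + 2) (S (r - (j : ℕ))) (by omega) (by omega) ∘ₗ
            act τ (m + 2 + 2) (shuffleWord (j : ℕ) π) = 0
  /-- `(1 + τ_{m+1} τ_{m+2} + τ_{m+2} τ_{m+1}) (S_{m+1,2} + ∑_{k=0}^{m} ∑_{π ∈ Sh_m^k}
  [π] (id^{⊗k} ⊗ S_{m-k,2} ⊗ id) S_{k,2}) = 0`. -/
  cyclic : ∀ m,
    (S (m + 1) +
      ∑ j : Fin (m + 1), ∑ π ∈ shuffles m j,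
        S (j : ℕ) ∘ₗ
          opInMiddle (j : ℕ) 1 (S (m - (j : ℕ))) (by omega) (by omega) ∘ₗ
            act τ (m + 1 + 2) (shuffleWord (j : ℕ) π)) ∘ₗ
      (LinearMap.id + act τ (m + 1 + 2) [m + 1, m + 2] + act τ (m + 1 + 2) [m + 2, m + 1]) = 0
  /-- `Φ_{m,n} - τ_r Φ_{m,n} = 0` for `1 ≤ r < m + n`, `r ≠ m`. -/
  symm : ∀ m n, 1 ≤ m → 2 ≤ n → ∀ r, 1 ≤ r → r < m + n → r ≠ m →
    Φ m n - Φ m n ∘ₗ tauAt τ (m + n) r = 0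

end SabininAlgebras

section Operations

variable {k : Type*} [Field k] {B : Type*} [NonUnitalNonAssocRing B] [Module k B]
  [IsScalarTower k B B] [SMulCommClass k B B]

/-- The product `(F ⊗ G) m` of an `a`-ary operation `F` and a `b`-ary operation `G`, an
`N`-ary operation for `N = a + b`. -/
def opMul {a b N : ℕ} (hN : N = a + b) (F : (⨂[k]^a B) →ₗ[k] B) (G : (⨂[k]^b B) →ₗ[k] B) :
    (⨂[k]^N B) →ₗ[k] B :=
  LinearMap.mul' k B ∘ₗ TensorProduct.map F G ∘ₗ
    (TensorPower.mulEquiv (R := k) (M := B) (n := a) (m := b)).symm.toLinearMap ∘ₗ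
      (TensorPower.cast k B hN).toLinearMap

/-- The identity of `B` as a unary operation. -/
def idOp (k : Type*) [Field k] (B : Type*) [NonUnitalNonAssocRing B] [Module k B] :
    (⨂[k]^1 B) →ₗ[k] B :=
  (oneEquiv k B).toLinearMap

/-- The product `R_n(u₁, …, uₙ) = (⋯((u₁ u₂) u₃)⋯) uₙ`, for `n ≥ 1`. The empty product `R_0`
is omitted wherever it occurs as a factor; `R_0 := 0` is a dummy value. -/
def rightNormed (k : Type*) [Field k] (B : Type*) [NonUnitalNonAssocRing B] [Module k B]
    [IsScalarTower k B B] [SMulCommClass k B B] : (n : ℕ) → ((⨂[k]^n B) →ₗ[k] B)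
  | 0 => 0
  | 1 => idOp k B
  | n + 2 => opMul (a := n + 1) (b := 1) rfl (rightNormed k B (n + 1)) (idOp k B)

/-- `(R_r ⊗ R_s) m`, an empty factor being omitted. -/
def prefactor (k : Type*) [Field k] (B : Type*) [NonUnitalNonAssocRing B] [Module k B]
    [IsScalarTower k B B] [SMulCommClass k B B] : (r s : ℕ) → ((⨂[k]^(r + s) B) →ₗ[k] B)
  | 0, s => rightNormed k B s ∘ₗ (TensorPower.cast k B (Nat.zero_add s)).toLinearMap
  | r + 1, 0 => rightNormed k B (r + 1)
  | r + 1, s + 1 => opMul rfl (rightNormed k B (r + 1)) (rightNormed k B (s + 1))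

/-- `(R_m ⊗ R_n ⊗ id) P_{1,1}`, where `P_{1,1}(x, y, z) = (x y) z - x (y z)` is the associator. -/
def assocOp (k : Type*) [Field k] (B : Type*) [NonUnitalNonAssocRing B] [Module k B]
    [IsScalarTower k B B] [SMulCommClass k B B] (m n : ℕ) : (⨂[k]^(m + n + 1) B) →ₗ[k] B :=
  opMul rfl (opMul rfl (rightNormed k B m) (rightNormed k B n)) (idOp k B) -
    opMul (Nat.add_assoc m n 1) (rightNormed k B m) (opMul rfl (rightNormed k B n) (idOp k B))

/-- The braided Shestakov-Umirbaev operations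
`P_{m,n} = (R_m ⊗ R_n ⊗ id) P_{1,1} - ∑_{r+s>0} ∑_{π ∈ Sh_m^r} ∑_{σ ∈ Sh_n^s}
[π] [σ]_{(m)} ν_m^{r+1,m+s} (R_r ⊗ R_s ⊗ P_{m-r,n-s}) m₁ m`, where `0 ≤ r < m` and `0 ≤ s < n`.
They are used for `m, n ≥ 1` only. -/
def opP (τ : B ⊗[k] B →ₗ[k] B ⊗[k] B) (m n : ℕ) : (⨂[k]^(m + n + 1) B) →ₗ[k] B :=
  assocOp k B m n -
    ∑ r : Fin m, ∑ s : Fin n,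
      if h : 0 < (r : ℕ) + (s : ℕ) then
        ∑ π ∈ shuffles m r, ∑ σ ∈ shuffles n s,
          opMul (by omega) (prefactor k B r s) (opP τ (m - (r : ℕ)) (n - (s : ℕ))) ∘ₗ
            act τ (m + n + 1)
              (shuffleWord (r : ℕ) π ++ shift m (shuffleWord (s : ℕ) σ) ++
                nu m ((r : ℕ) + 1) (m + (s : ℕ)))
      else 0
termination_by m + n
decreasing_by
  have := r.2
  have := s.2
  omega

/-- The braided commutator `[x, y]_τ = (x ⊗ y) m - (x ⊗ y) τ m`. -/
def braidedCommutator (τ : B ⊗[k] B →ₗ[k] B ⊗[k] B) : B ⊗[k] B →ₗ[k] B :=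
  LinearMap.mul' k B - LinearMap.mul' k B ∘ₗ τ

/-- `S_{0,2} = -[·,·]_τ`, and `S_{m,2} = -P_{m,1} + τ_{m+1} P_{m,1}` for `m ≥ 1`. -/
def opS (τ : B ⊗[k] B →ₗ[k] B ⊗[k] B) : (m : ℕ) → ((⨂[k]^(m + 2) B) →ₗ[k] B)
  | 0 => -(braidedCommutator τ ∘ₗ (twoEquiv k B).toLinearMap)
  | m + 1 => -opP τ (m + 1) 1 + opP τ (m + 1) 1 ∘ₗ tauAt τ (m + 1 + 2) (m + 1 + 1)

/-- `Φ_{m,n} = (1 / m!) (1 / n!) ∑_{π ∈ S_m} ∑_{σ ∈ S_n} π̄ σ̄_{(m)} P_{m,n-1}`, for `m ≥ 1`,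
`n ≥ 2`; the value at `n = 0` is a dummy. -/
def opPhi (τ : B ⊗[k] B →ₗ[k] B ⊗[k] B) (m : ℕ) : (n : ℕ) → ((⨂[k]^(m + n) B) →ₗ[k] B)
  | 0 => 0
  | n + 1 =>
    ((m.factorial : k)⁻¹ * ((n + 1).factorial : k)⁻¹) •
      ∑ π : Equiv.Perm (Fin m), ∑ σ : Equiv.Perm (Fin (n + 1)),
        opP τ m n ∘ₗ act τ (m + (n + 1)) (permWord π ++ shift m (permWord σ))

end Operations

end

end BraidedSabinin

/-! Evaluated at formal letters, the braided identities look like ordinary multilinear identities in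
which transposing two neighbouring arguments costs one generator. The operators live in a ring `E`
with an additive, multiplicative but non-unital shift `σ`, which models `f ↦ id ⊗ f`; in the
application `E` is the endomorphism ring of the tensor algebra. A letter is a braided operation
together with the labels of its arguments, and `Letter.eval` turns a list of letters into an
operator. Three facts make this a calculus: `Letter.eval_swap` (exchanging adjacent letters is
multiplication by a generator, also for composite letters, since their operations are braided),
`Letter.eval_app` (a braided operation applied to letters is again a letter), and
`Letter.eval_atoms` (evaluation at distinct single labels is the unit, so an identity on letters is
an identity of operators).

Sums over shuffles become sums `splitSum` over all ways to split a list into two complementary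
sublists. With the convention `P_{0,1} = m`, the recursion for `P_{n,1}` says that `(u y) z` is the
sum of `u' P(u''; y, z)` over the splittings of `u` (`sum_associatorEnd`). Antisymmetrizing in `y`,
`z` gives the single relation from which (7.3) and (7.4) follow (`bracketRelation_opS`, used as
`prodEval_relation`): `R(u, y, z, w) - R(u, z, y, w) + ∑ R(u', S(u''; y, z), w) = 0`.

For the exchange identity (`exchangeOp_eq_zero`) two such relations are played against each other,
one at an inner pair `a`, `b` and one at the last pair `y`, `z`. For the cyclic identity
(`cyclicOp_eq_zero`) the relation is expanded and summed over the cyclic permutations of three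
letters. In both cases all pure products cancel and a sum over splittings remains, whose terms are
lower instances of the identity multiplied by a prefix; induction leaves only the term with empty
prefix.

The remaining claims are formal. Skew symmetry comes from `τ² = id`. The symmetry of `Φ` holds
because it is a sum over `S_m × S_n`, once the action of a word is known to depend only on its
permutation (`wordOp_eq_of_prod_eq`). Braidedness is preserved by products, generators, sums and
scalars. Injectivity of `opEnd` transfers everything back to multilinear operations. -/

namespace BraidedSabinin

/-! ### Shift rings: operators on tensor powers, involutive braidings, braided operations -/

section ShiftRing

variable {E : Type*} [Ring E] (σ : E →ₙ+* E)

theorem pow_shift_add (a b : ℕ) (x : E) : (σ ^ (a + b)) x = (σ ^ a) ((σ ^ b) x) := by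
  rw [pow_add]; rfl

theorem pow_shift_succ (a : ℕ) (x : E) : (σ ^ (a + 1)) x = (σ ^ a) (σ x) := by
  rw [pow_succ]; rfl

theorem pow_shift_succ' (a : ℕ) (x : E) : (σ ^ (a + 1)) x = σ ((σ ^ a) x) := by
  rw [pow_succ']; rfl

theorem pow_shift_zero (x : E) : (σ ^ 0) x = x := rfl

theorem pow_shift_one (x : E) : (σ ^ 1) x = σ x := by rw [pow_one]

/-- The element `f` behaves as an operator `V^{⊗a} ⊗ id → V^{⊗b} ⊗ id` of the tensor algebra,
`σ` being the operation `f ↦ id_V ⊗ f`. -/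
def HasType (a b : ℕ) (f : E) : Prop :=
  f * (σ ^ a) 1 = f ∧ ∀ g, f * (σ ^ a) g = (σ ^ b) g * f

variable {σ}

theorem HasType.left {a b : ℕ} {f : E} (h : HasType σ a b f) : (σ ^ b) 1 * f = f := by
  rw [← h.2, h.1]

theorem HasType.comp {a b c : ℕ} {f g : E} (hf : HasType σ a b f) (hg : HasType σ b c g) :
    HasType σ a c (g * f) := by
  refine ⟨by rw [mul_assoc, hf.1], fun x => ?_⟩
  rw [mul_assoc, hf.2, ← mul_assoc, hg.2, mul_assoc]

theorem HasType.pow_shift {a b : ℕ} {f : E} (hf : HasType σ a b f) (p : ℕ) :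
    HasType σ (p + a) (p + b) ((σ ^ p) f) := by
  refine ⟨by rw [pow_shift_add, ← map_mul, hf.1], fun x => ?_⟩
  rw [pow_shift_add, pow_shift_add, ← map_mul, hf.2, map_mul]

theorem HasType.add {a b : ℕ} {f g : E} (hf : HasType σ a b f) (hg : HasType σ a b g) :
    HasType σ a b (f + g) :=
  ⟨by rw [add_mul, hf.1, hg.1], fun x => by rw [add_mul, mul_add, hf.2, hg.2]⟩

theorem HasType.neg {a b : ℕ} {f : E} (hf : HasType σ a b f) : HasType σ a b (-f) :=
  ⟨by rw [neg_mul, hf.1], fun x => by rw [neg_mul, mul_neg, hf.2]⟩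

theorem HasType.mul_unit {a b : ℕ} {f : E} (h : HasType σ a b f) (q : ℕ) :
    f * (σ ^ (a + q)) 1 = (σ ^ (b + q)) 1 * f := by
  rw [pow_shift_add, pow_shift_add, h.2]

theorem hasType_unit (n : ℕ) : HasType σ n n ((σ ^ n) 1) :=
  ⟨by rw [← map_mul, mul_one], fun x => by rw [← map_mul, ← map_mul, one_mul, mul_one]⟩

theorem HasType.extend {a b : ℕ} {f : E} (hf : HasType σ a b f) (q : ℕ) :
    HasType σ (a + q) (b + q) (f * (σ ^ (a + q)) 1) := by
  refine ⟨by rw [mul_assoc, (hasType_unit _).1], fun x => ?_⟩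
  rw [mul_assoc, ← map_mul, one_mul, hf.mul_unit, ← mul_assoc, ← map_mul, mul_one,
    pow_shift_add, hf.2, ← pow_shift_add]

theorem unit_mul_pow_shift (n : ℕ) (x : E) : (σ ^ n) 1 * (σ ^ n) x = (σ ^ n) x := by
  rw [← map_mul, one_mul]

theorem pow_shift_mul_unit (n : ℕ) (x : E) : (σ ^ n) x * (σ ^ n) 1 = (σ ^ n) x := by
  rw [← map_mul, mul_one]

/-- Since `σ` is not unital, the elements `(σ ^ n) 1` form a decreasing chain of idempotents; in the
tensor algebra they are the projections killing the degrees below `n`. Operator identities on `n`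
arguments hold only after multiplication by them. -/
theorem unit_mul_unit {m n : ℕ} (h : m ≤ n) : (σ ^ m) (1 : E) * (σ ^ n) 1 = (σ ^ n) 1 := by
  obtain ⟨q, rfl⟩ := Nat.exists_eq_add_of_le h
  rw [pow_shift_add, unit_mul_pow_shift]

theorem unit_mul_unit' {m n : ℕ} (h : m ≤ n) : (σ ^ n) (1 : E) * (σ ^ m) 1 = (σ ^ n) 1 := by
  obtain ⟨q, rfl⟩ := Nat.exists_eq_add_of_le h
  rw [pow_shift_add, pow_shift_mul_unit]

variable (σ)

/-- The element `t` is an involutive braiding of the shift ring `(E, σ)`. -/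
structure IsShiftBraiding (t : E) : Prop where
  hasType : HasType σ 2 2 t
  sq : t * t = (σ ^ 2) 1
  braid : t * σ t * t = σ t * t * σ t

/-- The generator `t_i`, acting at the places `i` and `i + 1` counted from `0`. -/
def gen (t : E) (i : ℕ) : E := (σ ^ i) t

/-- The operator moving the first letter behind the next `n` letters. -/
def moveRight (t : E) : ℕ → E
  | 0 => 1
  | n + 1 => gen σ t n * moveRight t n

/-- The operator moving the letter in place `n`, counted from `0`, to the first place. -/
def moveLeft (t : E) : ℕ → E
  | 0 => 1
  | n + 1 => t * σ (moveLeft t n)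

variable {σ} {t : E}

theorem gen_add (p i : ℕ) : gen σ t (p + i) = (σ ^ p) (gen σ t i) := pow_shift_add ..

theorem gen_zero : gen σ t 0 = t := rfl

theorem gen_succ (i : ℕ) : gen σ t (i + 1) = σ (gen σ t i) := pow_shift_succ' ..

namespace IsShiftBraiding

variable (ht : IsShiftBraiding σ t)
include ht

theorem hasType_gen (i : ℕ) : HasType σ (i + 2) (i + 2) (gen σ t i) := ht.hasType.pow_shift i

theorem gen_mul_unit {i n : ℕ} (h : i + 2 ≤ n) :
    gen σ t i * (σ ^ n) 1 = (σ ^ n) 1 * gen σ t i := by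
  obtain ⟨q, rfl⟩ := Nat.exists_eq_add_of_le h
  exact (ht.hasType_gen i).mul_unit q

theorem gen_comm {i j : ℕ} (h : i + 2 ≤ j) : gen σ t i * gen σ t j = gen σ t j * gen σ t i := by
  obtain ⟨q, rfl⟩ := Nat.exists_eq_add_of_le h
  rw [gen_add, (ht.hasType_gen i).2]

theorem gen_sq (i : ℕ) : gen σ t i * gen σ t i = (σ ^ (i + 2)) 1 := by
  rw [gen, ← map_mul, ht.sq, pow_shift_add]

theorem gen_braid (i : ℕ) :
    gen σ t i * gen σ t (i + 1) * gen σ t i = gen σ t (i + 1) * gen σ t i * gen σ t (i + 1) := by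
  have h1 : gen σ t i = (σ ^ i) t := rfl
  have h2 : gen σ t (i + 1) = (σ ^ i) (σ t) := pow_shift_succ ..
  simp only [h1, h2, ← map_mul, ht.braid]

theorem moveRight_gen_of_le {n i : ℕ} (h : n + 1 ≤ i) :
    moveRight σ t n * gen σ t i = gen σ t i * moveRight σ t n := by
  induction n with
  | zero => simp [moveRight]
  | succ n ih =>
    rw [moveRight, mul_assoc, ih (by omega), ← mul_assoc, ht.gen_comm (by omega), mul_assoc]

/-- All factors of `moveRight` but two commute with the generator; the braid relation handles those
two and lowers the index by one, as the moved letter has passed both places. -/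
theorem moveRight_gen_of_lt {n i : ℕ} (h : i + 2 ≤ n) :
    moveRight σ t n * gen σ t (i + 1) = gen σ t i * moveRight σ t n := by
  induction n with
  | zero => omega
  | succ n ih =>
    rcases Nat.lt_or_ge n (i + 2) with h' | h'
    · obtain rfl : n = i + 1 := by omega
      rw [moveRight, moveRight, mul_assoc, mul_assoc, ht.moveRight_gen_of_le (by omega)]
      simp only [← mul_assoc]
      rw [← ht.gen_braid]
    · rw [moveRight, mul_assoc, ih h', ← mul_assoc, ← ht.gen_comm h', mul_assoc]

theorem moveRight_mul_unit {n m : ℕ} (h : n + 1 ≤ m) :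
    moveRight σ t n * (σ ^ m) 1 = (σ ^ m) 1 * moveRight σ t n := by
  induction n with
  | zero => simp [moveRight]
  | succ n ih =>
    rw [moveRight, mul_assoc, ih (by omega), ← mul_assoc, ht.gen_mul_unit (by omega), mul_assoc]

omit ht in
theorem moveLeft_add (a b : ℕ) :
    moveLeft σ t (a + b) = moveLeft σ t a * (σ ^ a) (moveLeft σ t b) := by
  induction a with
  | zero => simp [moveLeft]
  | succ a ih => rw [Nat.succ_add, moveLeft, ih, moveLeft, map_mul, mul_assoc, ← pow_shift_succ']

theorem moveLeft_pow_shift (n : ℕ) (g : E) :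
    moveLeft σ t n * (σ ^ (n + 1)) g = (σ ^ (n + 1)) g * moveLeft σ t n := by
  induction n with
  | zero => simp [moveLeft]
  | succ n ih =>
    rw [moveLeft, mul_assoc, pow_shift_succ' σ (n + 1), ← map_mul, ih, map_mul,
      ← pow_shift_succ', ← mul_assoc, ← mul_assoc, show n + 1 + 1 = 2 + n by omega, pow_shift_add,
      ht.hasType.2]

/-- The case `i = 0` is the braid relation for the two leftmost factors. In general the first `i`
factors split off, and they commute with operators acting behind place `i`. -/
theorem moveLeft_gen {n i : ℕ} (h : i + 2 ≤ n) :
    moveLeft σ t n * gen σ t i = gen σ t (i + 1) * moveLeft σ t n := by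
  obtain ⟨q, rfl⟩ := Nat.exists_eq_add_of_le h
  have key : moveLeft σ t (2 + q) * t = σ t * moveLeft σ t (2 + q) := by
    have h2 : moveLeft σ t 2 = t * σ t * (σ ^ 2) 1 := by
      simp [moveLeft, mul_assoc, pow_shift_succ']
    rw [moveLeft_add, h2, mul_assoc (t * σ t), unit_mul_pow_shift, mul_assoc, ← ht.hasType.2,
      ← mul_assoc, ht.braid]
    simp only [mul_assoc]
  have hc := ht.moveLeft_pow_shift i t
  rw [add_assoc, moveLeft_add, mul_assoc, gen, ← map_mul, key, map_mul, ← mul_assoc,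
    ← pow_shift_succ, ht.moveLeft_pow_shift, mul_assoc]
  rfl

theorem mul_shift_one : t * σ 1 = t := by
  conv_lhs => rw [← ht.hasType.1, mul_assoc, ← pow_shift_one σ 1, unit_mul_unit' (by omega),
    ht.hasType.1]

theorem moveLeft_succ (n : ℕ) : moveLeft σ t (n + 1) = moveLeft σ t n * gen σ t n := by
  rw [moveLeft_add, moveLeft, moveLeft, ht.mul_shift_one]
  rfl

theorem moveLeft_mul_moveRight (n : ℕ) :
    moveLeft σ t n * moveRight σ t n * (σ ^ (n + 1)) 1 = (σ ^ (n + 1)) 1 := by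
  induction n with
  | zero => simp [moveLeft, moveRight]
  | succ n ih =>
    rw [ht.moveLeft_succ, moveRight, mul_assoc (moveLeft σ t n), ← mul_assoc (gen σ t n),
      ht.gen_sq, ← ht.moveRight_mul_unit (by omega), ← mul_assoc, mul_assoc _ _ ((σ ^ _) 1),
      unit_mul_unit (by omega), ← unit_mul_unit (show n + 1 ≤ n + 1 + 1 by omega), ← mul_assoc, ih]

/-- Reflections of the two axioms for braided operations. -/
theorem mul_shift_of_moveLeft {n : ℕ} {F : E} (hF : HasType σ (n + 1) 1 F)
    (h : t * F = σ F * moveLeft σ t (n + 1)) : t * σ F = F * moveRight σ t (n + 1) := by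
  have hs : σ F = σ F * (σ ^ (n + 2)) 1 := by rw [pow_shift_succ' σ (n + 1), ← map_mul, hF.1]
  -- The unit inserted behind `σ F` is written as `moveLeft * moveRight`; the first axiom, read
  -- backwards, then produces a factor `t * t`, which is a unit by involutivity.
  rw [hs, ← ht.moveLeft_mul_moveRight, ← mul_assoc, ← mul_assoc, ← mul_assoc,
    mul_assoc t, ← h, ← mul_assoc, ht.sq, show (2 : ℕ) = 1 + 1 from rfl, ← hF.mul_unit, mul_assoc,
    mul_assoc, ht.moveRight_mul_unit (by omega), ← mul_assoc ((σ ^ _) 1) ((σ ^ _) 1),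
    unit_mul_unit (by omega), moveRight, ← mul_assoc ((σ ^ _) 1), (ht.hasType_gen n).left]

end IsShiftBraiding

/-- The element `F` is a braided operation with `n` arguments. -/
structure IsShiftOperation (σ : E →ₙ+* E) (t : E) (n : ℕ) (F : E) : Prop where
  hasType : HasType σ n 1 F
  moveLeft : t * F = σ F * moveLeft σ t n
  moveRight : t * σ F = F * moveRight σ t n

namespace IsShiftBraiding

variable (ht : IsShiftBraiding σ t)
include ht

/-- Because the braiding is involutive, one of the two axioms for braided operations suffices when
there is at least one argument. -/
theorem isShiftOperation {n : ℕ} {F : E} (hn : 1 ≤ n) (hF : HasType σ n 1 F)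
    (h : t * F = σ F * BraidedSabinin.moveLeft σ t n) : IsShiftOperation σ t n F := by
  obtain ⟨n, rfl⟩ := Nat.exists_eq_add_of_le' hn
  exact ⟨hF, h, ht.mul_shift_of_moveLeft hF h⟩

theorem isShiftOperation_one : IsShiftOperation σ t 1 (σ 1) := by
  refine ht.isShiftOperation le_rfl (by simpa using hasType_unit (σ := σ) 1) ?_
  rw [ht.mul_shift_one, moveLeft, moveLeft, ht.mul_shift_one, ← pow_shift_one σ (σ 1),
    ← pow_shift_succ, ht.hasType.left]

theorem isShiftOperation_comp_gen {n i : ℕ} {F : E} (hF : IsShiftOperation σ t n F)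
    (h : i + 2 ≤ n) : IsShiftOperation σ t n (F * gen σ t i) := by
  refine ht.isShiftOperation (by omega) ?_ ?_
  · refine ⟨?_, fun g => ?_⟩
    · rw [mul_assoc, ht.gen_mul_unit h, ← mul_assoc, hF.hasType.1]
    · obtain ⟨q, rfl⟩ := Nat.exists_eq_add_of_le h
      rw [mul_assoc, pow_shift_add, (ht.hasType_gen i).2, ← pow_shift_add, ← mul_assoc,
        hF.hasType.2, mul_assoc]
  · rw [← mul_assoc, hF.moveLeft, mul_assoc, ht.moveLeft_gen h, map_mul, gen_succ, mul_assoc]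

omit ht in
theorem _root_.BraidedSabinin.IsShiftOperation.add {n : ℕ} {F G : E}
    (hF : IsShiftOperation σ t n F) (hG : IsShiftOperation σ t n G) :
    IsShiftOperation σ t n (F + G) :=
  ⟨hF.hasType.add hG.hasType, by rw [mul_add, map_add, add_mul, hF.moveLeft, hG.moveLeft],
    by rw [map_add, mul_add, add_mul, hF.moveRight, hG.moveRight]⟩

omit ht in
theorem _root_.BraidedSabinin.IsShiftOperation.neg {n : ℕ} {F : E}
    (hF : IsShiftOperation σ t n F) : IsShiftOperation σ t n (-F) :=
  ⟨hF.hasType.neg, by rw [mul_neg, map_neg, neg_mul, hF.moveLeft],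
    by rw [map_neg, mul_neg, neg_mul, hF.moveRight]⟩

/-- The product of braided operations is a braided operation. -/
theorem isShiftOperation_mul {m : E} (hm : HasType σ 2 1 m) (hmt : t * m = σ m * t * σ t)
    {a b : ℕ} (ha : 1 ≤ a) {F G : E} (hF : IsShiftOperation σ t a F)
    (hG : IsShiftOperation σ t b G) : IsShiftOperation σ t (a + b) (m * F * (σ ^ a) G) := by
  refine ht.isShiftOperation (by omega) ?_ ?_
  · refine ⟨?_, fun g => ?_⟩
    · rw [mul_assoc, pow_shift_add, ← map_mul, hG.hasType.1]
    · rw [mul_assoc, pow_shift_add, ← map_mul, hG.hasType.2, map_mul, mul_assoc, ← mul_assoc F,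
        hF.hasType.2, ← mul_assoc, ← mul_assoc, ← pow_shift_add, hm.2]
      simp only [mul_assoc]
  · rw [← mul_assoc, ← mul_assoc, hmt, mul_assoc (σ m * t), ← pow_shift_one σ t, ← hF.hasType.2,
      ← mul_assoc, mul_assoc (σ m), hF.moveLeft, mul_assoc _ _ ((σ ^ a) G), ← map_mul, hG.moveLeft,
      map_mul, ← mul_assoc, ← mul_assoc, mul_assoc _ _ ((σ ^ a) (σ G)), ← pow_shift_succ,
      ht.moveLeft_pow_shift, moveLeft_add, map_mul, map_mul, pow_shift_succ']
    simp only [mul_assoc]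

end IsShiftBraiding

end ShiftRing

/-! ### The calculus of generalized letters -/

section Letters

variable {E : Type*} [Ring E] (σ : E →ₙ+* E) (t : E)

/-- The operator rearranging letters with the labels `L` into the order `l`
(zero if `l` is not a rearrangement of `L`). -/
def reorder : List ℕ → List ℕ → E
  | [], l => if l = [] then 1 else 0
  | x :: L, l => if x ∈ l then moveRight σ t (l.idxOf x) * σ (reorder L (l.erase x)) else 0

variable {σ t}

theorem reorder_self (L : List ℕ) : reorder σ t L L = (σ ^ L.length) 1 := by
  induction L with
  | nil => simp [reorder]
  | cons x L ih => simp [reorder, moveRight, ih, pow_shift_succ']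

namespace IsShiftBraiding

variable (ht : IsShiftBraiding σ t)
include ht

theorem unit_mul_reorder (L l : List ℕ) : (σ ^ l.length) 1 * reorder σ t L l = reorder σ t L l := by
  induction L generalizing l with
  | nil =>
    rw [reorder]
    split_ifs with h
    · simp [h]
    · simp
  | cons x L ih =>
    rw [reorder]
    split_ifs with h
    · have h1 := List.length_erase_of_mem h
      have h2 := List.length_pos_of_mem h
      have h3 := List.idxOf_lt_length_iff.2 h
      rw [← mul_assoc, ← ht.moveRight_mul_unit (by omega), mul_assoc]
      obtain ⟨n, hn⟩ : ∃ n, l.length = n + 1 := ⟨_, (Nat.sub_add_cancel h2).symm⟩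
      rw [hn, pow_shift_succ', ← map_mul]
      have := ih (l.erase x)
      rw [h1, hn, Nat.add_sub_cancel] at this
      rw [this]
    · simp

/-- Induction on `L`, by the place of its head `x` in the target. If `x` is neither `a` nor `b`, the
generator slides through the operator moving `x`. If `x = a`, that operator gets one more factor,
which is the generator. If `x = b`, it has one factor less, and the generator cancels by
involutivity. -/
theorem reorder_swap (L p q : List ℕ) (a b : ℕ) (h : (p ++ a :: b :: q).Nodup) :
    reorder σ t L (p ++ b :: a :: q) = gen σ t p.length * reorder σ t L (p ++ a :: b :: q) := by
  induction L generalizing p q with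
  | nil => simp [reorder]
  | cons x L ih =>
    have hp : (p ++ b :: a :: q).Perm (p ++ a :: b :: q) := (List.Perm.swap a b q).append_left p
    have hab : a ≠ b := by
      rintro rfl
      simp [List.nodup_append] at h
    have hap : a ∉ p := by
      intro h'
      have := (List.nodup_append.1 h).2.2 a h' a (by simp)
      exact this rfl
    have hbp : b ∉ p := by
      intro h'
      have := (List.nodup_append.1 h).2.2 b h' b (by simp)
      exact this rfl
    simp only [reorder, hp.mem_iff]
    split_ifs with hx
    swap
    · simp
    by_cases hxp : x ∈ p
    · have h1 : (p ++ a :: b :: q).erase x = p.erase x ++ a :: b :: q := List.erase_append_left _ hxp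
      have h2 : (p ++ b :: a :: q).erase x = p.erase x ++ b :: a :: q := List.erase_append_left _ hxp
      have h3 := List.length_erase_of_mem hxp
      have h4 := List.idxOf_lt_length_iff.2 hxp
      rw [List.idxOf_append_of_mem hxp, List.idxOf_append_of_mem hxp, h1, h2,
        ih _ _ (h1 ▸ h.erase x), map_mul, ← gen_succ, h3, Nat.sub_add_cancel (by omega),
        ← mul_assoc, ht.moveRight_gen_of_le (by omega), mul_assoc]
    rw [List.idxOf_append_of_notMem hxp, List.idxOf_append_of_notMem hxp,
      List.erase_append_right _ hxp, List.erase_append_right _ hxp]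
    by_cases hxa : x = a
    · subst hxa
      have h1 : (b :: x :: q).erase x = b :: q := by
        rw [List.erase_cons_tail (by simpa using hab.symm), List.erase_cons_head]
      rw [h1, List.erase_cons_head, List.idxOf_cons_self, List.idxOf_cons_ne _ hab.symm,
        List.idxOf_cons_self]
      simp [moveRight, mul_assoc]
    by_cases hxb : x = b
    · subst hxb
      have h1 : (a :: x :: q).erase x = a :: q := by
        rw [List.erase_cons_tail (by simpa using hab), List.erase_cons_head]
      rw [h1, List.erase_cons_head, List.idxOf_cons_self, List.idxOf_cons_ne _ hab,
        List.idxOf_cons_self, add_zero, Nat.succ_eq_add_one, zero_add, moveRight]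
      rw [← mul_assoc, ← mul_assoc, ht.gen_sq, ← ht.moveRight_mul_unit (by omega), mul_assoc]
      congr 1
      rw [← ht.unit_mul_reorder L (p ++ a :: q), map_mul, ← mul_assoc, ← pow_shift_succ',
        unit_mul_unit (by simp)]
    · have hxq : x ∈ q := by simpa [hxp, hxa, hxb] using hx
      have h1 : (a :: b :: q).erase x = a :: b :: q.erase x := by
        rw [List.erase_cons_tail (by simpa using Ne.symm hxa),
          List.erase_cons_tail (by simpa using Ne.symm hxb)]
      have h2 : (b :: a :: q).erase x = b :: a :: q.erase x := by
        rw [List.erase_cons_tail (by simpa using Ne.symm hxb),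
          List.erase_cons_tail (by simpa using Ne.symm hxa)]
      rw [h1, h2, ih p (q.erase x) (by
          have := h.erase x
          rwa [List.erase_append_right _ hxp, h1] at this),
        List.idxOf_cons_ne _ (Ne.symm hxa), List.idxOf_cons_ne _ (Ne.symm hxb),
        List.idxOf_cons_ne _ (Ne.symm hxa), List.idxOf_cons_ne _ (Ne.symm hxb), map_mul,
        ← gen_succ, ← mul_assoc, ht.moveRight_gen_of_lt (by omega), mul_assoc]

theorem reorder_moveLeft (L p v q : List ℕ) (x : ℕ) (h : (p ++ v ++ x :: q).Nodup) :
    reorder σ t L (p ++ x :: v ++ q) =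
      (σ ^ p.length) (moveLeft σ t v.length) * reorder σ t L (p ++ v ++ x :: q) := by
  induction v generalizing p with
  | nil =>
    rw [← ht.unit_mul_reorder, ← ht.unit_mul_reorder L (p ++ [] ++ x :: q)]
    simp only [List.nil_append, List.cons_append, List.append_assoc, List.length_nil, moveLeft]
    rw [← mul_assoc, unit_mul_unit (by simp)]
  | cons y v ih =>
    have h1 : (p ++ [y] ++ v ++ x :: q).Nodup := by simpa using h
    have h2 : (p ++ y :: x :: (v ++ q)).Nodup := by
      refine (List.Perm.nodup_iff ?_).1 h
      simpa using ((List.perm_middle (a := x) (l₁ := v) (l₂ := q)).cons y).append_left p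
    have h3 := ih (p ++ [y]) h1
    have h4 := ht.reorder_swap L p (v ++ q) y x h2
    simp only [List.append_assoc, List.cons_append, List.nil_append, List.length_append,
      List.length_cons, List.length_nil] at h3 h4 ⊢
    rw [h4, h3, moveLeft, map_mul, ← pow_shift_succ, ← mul_assoc]
    rfl

end IsShiftBraiding

variable (σ t) in
/-- The operator interchanging a block of `a` letters with the block of `b` letters behind it. -/
def blockSwap (a : ℕ) : ℕ → E
  | 0 => 1
  | b + 1 => (σ ^ b) (moveLeft σ t a) * blockSwap a b

theorem IsShiftOperation.moveRight_mul {a : ℕ} {F : E} (hF : IsShiftOperation σ t a F) (b : ℕ) :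
    BraidedSabinin.moveRight σ t b * F = (σ ^ b) F * blockSwap σ t a b := by
  induction b with
  | zero => simp [BraidedSabinin.moveRight, blockSwap]
  | succ b ih =>
    rw [BraidedSabinin.moveRight, mul_assoc, ih, ← mul_assoc, gen, ← map_mul, hF.moveLeft, map_mul,
      blockSwap, pow_shift_succ, mul_assoc]

theorem IsShiftBraiding.reorder_blockSwap (ht : IsShiftBraiding σ t) (L p v w q : List ℕ)
    (h : (p ++ v ++ w ++ q).Nodup) :
    reorder σ t L (p ++ w ++ v ++ q) =
      (σ ^ p.length) (blockSwap σ t v.length w.length) * reorder σ t L (p ++ v ++ w ++ q) := by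
  induction w using List.reverseRecOn generalizing q with
  | nil =>
    rw [← ht.unit_mul_reorder, ← ht.unit_mul_reorder L (p ++ v ++ [] ++ q)]
    simp only [List.append_nil, List.length_nil, blockSwap]
    rw [← mul_assoc, unit_mul_unit (by simp)]
  | append_singleton w x ih =>
    have h1 : (p ++ v ++ w ++ x :: q).Nodup := by simpa using h
    have h2 : (p ++ w ++ v ++ x :: q).Nodup := by
      refine (List.Perm.nodup_iff ?_).1 h1
      simpa using ((List.perm_append_comm_assoc v w (x :: q))).append_left p
    have h3 := ih (x :: q) h1
    have h4 := ht.reorder_moveLeft L (p ++ w) v q x h2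
    simp only [List.append_assoc, List.cons_append, List.nil_append, List.length_append,
      List.length_cons, List.length_nil] at h3 h4 ⊢
    rw [h4, h3, ← mul_assoc, pow_shift_add, ← map_mul]
    rfl

variable (σ t) in
/-- A generalized letter: a braided operation together with the labels of its arguments. -/
structure Letter where
  labels : List ℕ
  labels_pos : 1 ≤ labels.length
  op : E
  isShiftOperation : IsShiftOperation σ t labels.length op

namespace Letter

/-- The labels occurring in a list of letters. -/
def listLabels (gs : List (Letter σ t)) : List ℕ := gs.flatMap labels

/-- The tensor product of the operations in a list of letters. -/
def tensor : List (Letter σ t) → E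
  | [] => 1
  | g :: gs => σ (tensor gs) * g.op

@[simp]
theorem listLabels_append (p q : List (Letter σ t)) :
    listLabels (p ++ q) = listLabels p ++ listLabels q := List.flatMap_append

@[simp]
theorem listLabels_cons (g : Letter σ t) (q : List (Letter σ t)) :
    listLabels (g :: q) = g.labels ++ listLabels q := List.flatMap_cons

@[simp]
theorem listLabels_nil : listLabels ([] : List (Letter σ t)) = [] := rfl

theorem tensor_append (p q : List (Letter σ t)) :
    tensor (p ++ q) = (σ ^ p.length) (tensor q) * tensor p := by
  induction p with
  | nil => simp [tensor]
  | cons g p ih => rw [List.cons_append, tensor, ih, map_mul, ← pow_shift_succ', tensor, mul_assoc,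
      List.length_cons]

theorem hasType_tensor (gs : List (Letter σ t)) :
    HasType σ (listLabels gs).length gs.length (tensor gs) := by
  induction gs with
  | nil => exact ⟨by simp [tensor], fun g => by simp [tensor]⟩
  | cons g gs ih =>
    have hg := g.isShiftOperation.hasType
    rw [listLabels_cons, List.length_append, List.length_cons, tensor]
    refine ⟨?_, fun x => ?_⟩
    · rw [pow_shift_add, mul_assoc, hg.2, pow_shift_one, ← mul_assoc, ← map_mul, ih.1]
    · rw [pow_shift_add, mul_assoc, hg.2, pow_shift_one, ← mul_assoc, ← map_mul, ih.2, map_mul,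
        ← pow_shift_succ', mul_assoc]

theorem moveLeft_tensor (ht : IsShiftBraiding σ t) (gs : List (Letter σ t)) (h : gs ≠ []) :
    moveLeft σ t gs.length * tensor gs = σ (tensor gs) * moveLeft σ t (listLabels gs).length := by
  induction gs with
  | nil => exact absurd rfl h
  | cons g gs ih =>
    have hg := g.isShiftOperation
    -- For an empty tail the two inner products are `1` and `σ 1`, so the induction hypothesis is
    -- not available; they become equal only behind the factor `t`.
    have key : t * σ (moveLeft σ t gs.length * tensor gs) =
        t * σ (σ (tensor gs) * moveLeft σ t (listLabels gs).length) := by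
      rcases eq_or_ne gs [] with rfl | h'
      · simp only [tensor, moveLeft, List.length_nil, listLabels_nil, mul_one]
        rw [ht.mul_shift_one, ← pow_shift_one σ (σ 1), ← pow_shift_succ, ht.hasType.1]
      · rw [ih h']
    rw [List.length_cons, moveLeft, tensor, mul_assoc, ← mul_assoc (σ _), ← map_mul, ← mul_assoc,
      key, listLabels_cons, List.length_append, IsShiftBraiding.moveLeft_add, map_mul, ← mul_assoc t,
      ← pow_shift_one σ (σ _), ← pow_shift_succ, ht.hasType.2, mul_assoc, mul_assoc,
      ← pow_shift_one σ (moveLeft _ _ _), ← hg.hasType.2, ← mul_assoc t, hg.moveLeft, map_mul,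
      pow_shift_succ', pow_shift_one]
    simp only [mul_assoc]

theorem one_le_length_listLabels {gs : List (Letter σ t)} (h : 1 ≤ gs.length) :
    1 ≤ (listLabels gs).length := by
  rcases gs with _ | ⟨g, gs⟩
  · simp at h
  · have := g.labels_pos
    rw [listLabels_cons, List.length_append]
    omega

/-- A single label as a letter. -/
def atom (ht : IsShiftBraiding σ t) (x : ℕ) : Letter σ t :=
  ⟨[x], le_rfl, σ 1, ht.isShiftOperation_one⟩

/-- The value of a braided operation at a list of letters. -/
def app (ht : IsShiftBraiding σ t) (G : E) (gs : List (Letter σ t))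
    (hgs : 1 ≤ gs.length) (hG : IsShiftOperation σ t gs.length G) : Letter σ t where
  labels := listLabels gs
  labels_pos := one_le_length_listLabels hgs
  op := G * tensor gs
  isShiftOperation := by
    refine ht.isShiftOperation (one_le_length_listLabels hgs)
      ((hasType_tensor gs).comp hG.hasType) ?_
    rw [← mul_assoc, hG.moveLeft, mul_assoc, moveLeft_tensor ht _ (List.ne_nil_of_length_pos hgs),
        map_mul, mul_assoc]

variable (L : List ℕ)

/-- The operator that sends letters with the labels `L` to the tensor product of the letters `gs`. -/
def eval (gs : List (Letter σ t)) : E :=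
  if (listLabels gs).Nodup then tensor gs * reorder σ t L (listLabels gs) else 0

theorem eval_app (ht : IsShiftBraiding σ t) (G : E) (p gs q : List (Letter σ t))
    (hgs : 1 ≤ gs.length) (hG : IsShiftOperation σ t gs.length G) :
    eval L (p ++ app ht G gs hgs hG :: q) = (σ ^ p.length) G * eval L (p ++ gs ++ q) := by
  have h : listLabels (p ++ app ht G gs hgs hG :: q) = listLabels (p ++ gs ++ q) := by simp [app]
  rw [eval, eval, h]
  split_ifs
  · rw [← mul_assoc]
    congr 1
    rw [List.append_assoc, tensor_append, tensor_append, tensor_append, tensor, app,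
      ← mul_assoc, ← mul_assoc, ← map_mul, ← mul_assoc, hG.hasType.2, pow_shift_one]
  · simp

/-- On labels the exchange of two letters is a block swap; the two axioms of braided operations pull
it through `h.op` and `g.op`, where it becomes a single generator. Since `eval` is zero on repeated
labels, no distinctness hypothesis is needed. -/
theorem eval_swap (ht : IsShiftBraiding σ t) (p q : List (Letter σ t)) (g h : Letter σ t) :
    eval L (p ++ h :: g :: q) = gen σ t p.length * eval L (p ++ g :: h :: q) := by
  have hp : (listLabels (p ++ h :: g :: q)).Perm (listLabels (p ++ g :: h :: q)) := by
    simpa using (List.perm_append_comm_assoc h.labels g.labels (listLabels q)).append_left _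
  simp only [eval, hp.nodup_iff]
  split_ifs with hn
  swap
  · simp
  have hb := ht.reorder_blockSwap L (listLabels p) g.labels h.labels (listLabels q) (by simpa using hn)
  have hg := g.isShiftOperation
  have hh := h.isShiftOperation
  simp only [listLabels_append, listLabels_cons, List.append_assoc] at hb ⊢
  rw [hb, ← mul_assoc, ← mul_assoc]
  congr 1
  rw [tensor_append, tensor_append, mul_assoc, (hasType_tensor p).2, ← mul_assoc, ← mul_assoc, gen,
    ← map_mul, ← map_mul]
  congr 2
  simp only [tensor]
  rw [map_mul, mul_assoc (σ (σ _)), ← pow_shift_one σ g.op, ← hh.hasType.2, mul_assoc, mul_assoc,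
    ← hg.moveRight_mul, ← mul_assoc h.op, ← hh.moveRight, mul_assoc t, ← mul_assoc,
    ← pow_shift_one σ (σ _), ← pow_shift_succ, ← ht.hasType.2, map_mul, pow_shift_succ' σ 1,
    pow_shift_one]
  simp only [mul_assoc]

/-- This is the way back from letters to operators: `X * eval L gs = 0` for all letters yields, at
the atoms, that `X` vanishes on as many arguments. -/
theorem eval_atoms (ht : IsShiftBraiding σ t) (hL : L.Nodup) :
    eval L (L.map (atom ht)) = (σ ^ L.length) 1 := by
  have h1 : ∀ L, listLabels (L.map (atom ht)) = L := by
    intro L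
    induction L with
    | nil => rfl
    | cons x L ih => simp [ih, atom]
  have h2 : ∀ L : List ℕ, tensor (L.map (atom ht)) * (σ ^ L.length) 1 = (σ ^ L.length) 1 := by
    intro L
    induction L with
    | nil => simp [tensor]
    | cons x L ih =>
      rw [List.map_cons, tensor, List.length_cons, atom, ← map_mul, mul_one, pow_shift_succ',
        ← map_mul, ih]
  rw [eval, h1, if_pos hL, reorder_self, h2]

theorem unit_mul_eval (gs : List (Letter σ t)) :
    (σ ^ gs.length) 1 * eval L gs = eval L gs := by
  rw [eval]
  split_ifs
  · rw [← mul_assoc, (hasType_tensor gs).left]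
  · simp

end Letter

end Letters

/-! ### Sums over splittings of a list (the unshuffle coproduct) -/

section SplitSum

variable {α M : Type*} [AddCommMonoid M]

/-- The sum of `f a b` over all ways to split the list `l` into complementary sublists `a`, `b`. -/
def splitSum : List α → (List α → List α → M) → M
  | [], f => f [] []
  | x :: l, f => splitSum l (fun a b => f (x :: a) b) + splitSum l (fun a b => f a (x :: b))

theorem splitSum_congr {l : List α} {f g : List α → List α → M}
    (h : ∀ a b, a.length + b.length = l.length → f a b = g a b) : splitSum l f = splitSum l g := by
  induction l generalizing f g with
  | nil => exact h _ _ rfl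
  | cons x l ih =>
    rw [splitSum, splitSum, ih fun a b hab => h _ _ (by simp only [List.length_cons]; omega),
      ih fun a b hab => h _ _ (by simp only [List.length_cons]; omega)]

theorem splitSum_add (l : List α) (f g : List α → List α → M) :
    splitSum l (fun a b => f a b + g a b) = splitSum l f + splitSum l g := by
  induction l generalizing f g with
  | nil => rfl
  | cons x l ih =>
    simp only [splitSum, ih]
    exact add_add_add_comm ..

theorem map_splitSum {N : Type*} [AddCommMonoid N] (φ : M →+ N) (l : List α)
    (f : List α → List α → M) : φ (splitSum l f) = splitSum l (fun a b => φ (f a b)) := by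
  induction l generalizing f with
  | nil => rfl
  | cons x l ih => simp only [splitSum, map_add, ih]

theorem splitSum_zero (l : List α) : splitSum l (fun _ _ => (0 : M)) = 0 := by
  induction l with
  | nil => rfl
  | cons x l ih => simp only [splitSum, ih, add_zero]

theorem splitSum_append (l l' : List α) (f : List α → List α → M) :
    splitSum (l ++ l') f =
      splitSum l (fun a b => splitSum l' (fun a' b' => f (a ++ a') (b ++ b'))) := by
  induction l generalizing f with
  | nil => rfl
  | cons x l ih => simp only [splitSum, List.cons_append, ih]

theorem splitSum_comm (l : List α) (f : List α → List α → M) :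
    splitSum l f = splitSum l (fun a b => f b a) := by
  induction l generalizing f with
  | nil => rfl
  | cons x l ih =>
    simp only [splitSum]
    rw [ih, ih (fun a b => f a (x :: b)), add_comm]

/-- Coassociativity: both sides run over the splittings of `l` into three sublists. -/
theorem splitSum_assoc (l : List α) (f : List α → List α → List α → M) :
    splitSum l (fun a b => splitSum a (fun c d => f c d b)) =
      splitSum l (fun a b => splitSum b (fun c d => f a c d)) := by
  induction l generalizing f with
  | nil => rfl
  | cons x l ih =>
    simp only [splitSum, splitSum_add]
    rw [ih, ih (fun c d b => f c (x :: d) b), ih (fun c d b => f c d (x :: b)), add_assoc]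

/-- Isolates the term with empty first part, which is the new identity in the inductions on the
arity. -/
theorem splitSum_eq_of_forall {l : List α} {f : List α → List α → M}
    (h : ∀ a b, a.length + b.length = l.length → a ≠ [] → f a b = 0) :
    splitSum l f = f [] l := by
  induction l generalizing f with
  | nil => rfl
  | cons x l ih =>
    rw [splitSum, ih (f := fun a b => f a (x :: b)), splitSum_congr (g := fun _ _ => 0),
      splitSum_zero, zero_add]
    · intro a b hab
      exact h _ _ (by simp only [List.length_cons]; omega) (by simp)
    · intro a b hab ha
      exact h _ _ (by simp only [List.length_cons]; omega) ha

theorem splitSum_range' (i n : ℕ) (f : List ℕ → M) :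
    splitSum (List.range' i n) (fun a _ => f a) =
      ∑ A ∈ (Finset.Ico i (i + n)).powerset, f (A.sort (· ≤ ·)) := by
  induction n generalizing i f with
  | zero => simp [splitSum]
  | succ n ih =>
    have h : Finset.Ico i (i + (n + 1)) = insert i (Finset.Ico (i + 1) (i + 1 + n)) := by
      ext x; simp; omega
    rw [List.range'_succ, splitSum, ih (i + 1) (fun a => f (i :: a)), ih, h,
      Finset.sum_powerset_insert (by simp), add_comm]
    congr 1
    refine Finset.sum_congr rfl fun A hA => ?_
    rw [Finset.sort_insert]
    · intro b hb
      have := Finset.mem_powerset.1 hA hb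
      simp at this; omega
    · intro hb
      have := Finset.mem_powerset.1 hA hb
      simp at this

end SplitSum

/-! ### Shuffles as subsets -/

section Shuffles

/-- The word moving the letters in the places `p ∈ c`, counted from `0`, to the places
`i, i + 1, …`. -/
def extractWord : ℕ → List ℕ → List ℕ
  | _, [] => []
  | i, p :: c => seg (i + 1) (p + 1) ++ extractWord (i + 1) c

theorem extractWord_map_range' (g : ℕ → ℕ) (i m : ℕ) :
    extractWord i ((List.range' i m).map g) =
      (List.range' i m).flatMap fun j => seg (j + 1) (g j + 1) := by
  induction m generalizing i with
  | zero => rfl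
  | succ m ih => rw [List.range'_succ, List.map_cons, extractWord, ih, List.flatMap_cons]

/-- A permutation of `Fin n` as a function on natural numbers. -/
def permFun {n : ℕ} (π : Equiv.Perm (Fin n)) (j : ℕ) : ℕ := if h : j < n then π ⟨j, h⟩ else 0

theorem permFun_of_lt {n : ℕ} (π : Equiv.Perm (Fin n)) {j : ℕ} (h : j < n) :
    permFun π j = π ⟨j, h⟩ := dif_pos h

theorem permFun_lt {n : ℕ} (π : Equiv.Perm (Fin n)) {j : ℕ} (h : j < n) :
    permFun π j < n := by rw [permFun_of_lt π h]; exact Fin.is_lt _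

theorem permFun_injOn {n : ℕ} (π : Equiv.Perm (Fin n)) {i j : ℕ} (hi : i < n) (hj : j < n)
    (h : permFun π i = permFun π j) : i = j := by
  rw [permFun_of_lt π hi, permFun_of_lt π hj] at h
  simpa using π.injective (Fin.ext h)

theorem map_val_filter_finRange {n r : ℕ} (h : r ≤ n) :
    ((List.finRange n).filter fun i : Fin n => (i : ℕ) < r).map Fin.val = List.range r := by
  have h1 := List.map_coe_finRange_eq_range (n := n)
  have h2 : (List.range n).filter (fun i => i < r) = List.range r := by
    obtain ⟨q, rfl⟩ := Nat.exists_eq_add_of_le h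
    rw [List.range_add, List.filter_append, List.filter_eq_self.2, List.filter_eq_nil_iff.2]
    · simp
    · simp
    · simp
  rw [← h2, ← h1, List.filter_map]
  rfl

/-- Only the values of `π` on the first `r` places enter the word, so it can be read off from the
image of these places. -/
theorem shuffleWord_eq {n r : ℕ} (h : r ≤ n) (π : Equiv.Perm (Fin n)) :
    shuffleWord r π = extractWord 0 ((List.range r).map (permFun π)) := by
  rw [List.range_eq_range', extractWord_map_range', ← List.range_eq_range',
    ← map_val_filter_finRange h, List.flatMap_map, shuffleWord]
  congr 1
  ext1 i
  rw [permFun_of_lt π i.2]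

theorem permFun_strictMono {n r : ℕ} {π : Equiv.Perm (Fin n)} (hπ : π ∈ shuffles n r) {i j : ℕ}
    (hj : j < n) (hij : i < j) (h : j < r ∨ r ≤ i) : permFun π i < permFun π j := by
  rw [permFun_of_lt π hj, permFun_of_lt π (hij.trans hj)]
  exact (Finset.mem_filter.1 hπ).2 ⟨i, hij.trans hj⟩ ⟨j, hj⟩ hij h

theorem sort_image_permFun {n r : ℕ} {π : Equiv.Perm (Fin n)} (hπ : π ∈ shuffles n r) {i m : ℕ}
    (him : i + m ≤ n) (h : i + m ≤ r ∨ r ≤ i) :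
    ((List.range' i m).map (permFun π)).toFinset.sort (· ≤ ·) = (List.range' i m).map (permFun π) := by
  have hs : ((List.range' i m).map (permFun π)).Pairwise (· < ·) := by
    rw [List.pairwise_map]
    refine (List.pairwise_lt_range' (s := i) (n := m)).imp_of_mem fun {a b} ha hb hab => ?_
    rw [List.mem_range'_1] at ha hb
    exact permFun_strictMono hπ (by omega) hab (by omega)
  exact (List.toFinset_sort (· ≤ ·) (hs.imp fun h => h.ne)).2 (hs.imp fun h => h.le)

/-- An `r`-shuffle is determined by the set of its first `r` values, and every `r`-element subset
occurs; sorting this set recovers the values in order. -/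
theorem sum_shuffles {M : Type*} [AddCommMonoid M] {n r : ℕ} (h : r ≤ n) (f : List ℕ → M) :
    ∑ π ∈ shuffles n r, f (shuffleWord r π) =
      ∑ A ∈ (Finset.range n).powersetCard r, f (extractWord 0 (A.sort (· ≤ ·))) := by
  refine Finset.sum_bij (fun π _ => ((List.range' 0 r).map (permFun π)).toFinset) ?_ ?_ ?_ ?_
  · intro π hπ
    rw [Finset.mem_powersetCard]
    constructor
    · intro x hx
      simp only [List.mem_toFinset, List.mem_map, List.mem_range'_1] at hx
      obtain ⟨j, hj, rfl⟩ := hx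
      exact Finset.mem_range.2 (permFun_lt π (by omega))
    · rw [← Finset.length_sort (· ≤ ·), sort_image_permFun hπ (by omega) (by omega)]
      simp
  · intro π hπ π' hπ' heq
    have aux : ∀ i m, i + m ≤ n → (i + m ≤ r ∨ r ≤ i) →
        ((List.range' i m).map (permFun π)).toFinset = ((List.range' i m).map (permFun π')).toFinset →
        ∀ j, i ≤ j → j < i + m → permFun π j = permFun π' j := by
      intro i m him hr he j h1 h2
      have h3 := sort_image_permFun hπ him hr
      rw [he, sort_image_permFun hπ' him hr] at h3
      exact (List.map_inj_left.1 h3 j (List.mem_range'_1.2 ⟨h1, h2⟩)).symm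
    -- The last `n - r` values fill the complement, so they too are determined by the image of the
    -- first `r` places.
    have hcompl : ∀ ρ : Equiv.Perm (Fin n), ((List.range' r (n - r)).map (permFun ρ)).toFinset =
        Finset.range n \ ((List.range' 0 r).map (permFun ρ)).toFinset := by
      intro ρ
      ext x
      simp only [List.mem_toFinset, List.mem_map, List.mem_range'_1, Finset.mem_sdiff,
        Finset.mem_range, not_exists, not_and]
      constructor
      · rintro ⟨j, hj, rfl⟩
        refine ⟨permFun_lt ρ (by omega), fun i hi he => ?_⟩
        have := permFun_injOn ρ (by omega) (by omega) he
        omega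
      · rintro ⟨hx, hne⟩
        refine ⟨ρ.symm ⟨x, hx⟩, ?_, ?_⟩
        · by_contra hc
          have hlt := (ρ.symm ⟨x, hx⟩).2
          refine hne (ρ.symm ⟨x, hx⟩ : ℕ) (by omega) ?_
          rw [permFun_of_lt ρ hlt]
          simp
        · rw [permFun_of_lt ρ (Fin.is_lt _)]
          simp
    have h1 := aux 0 r (by omega) (by omega) heq
    have h2 := aux r (n - r) (by omega) (by omega) (by rw [hcompl, hcompl, heq])
    refine Equiv.ext fun j => Fin.ext ?_
    rw [← permFun_of_lt π j.2, ← permFun_of_lt π' j.2]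
    rcases Nat.lt_or_ge j r with hj | hj
    · exact h1 j (by omega) (by omega)
    · exact h2 j hj (by omega)
  · intro A hA
    rw [Finset.mem_powersetCard] at hA
    obtain ⟨m, rfl⟩ := Nat.exists_eq_add_of_le h
    set s : Finset (Fin (r + m)) := Finset.univ.filter fun i => (i : ℕ) ∈ A with hs
    have hsA : s.map Fin.valEmbedding = A := by
      ext x
      simp only [Finset.mem_map, hs, Finset.mem_filter, Finset.mem_univ, true_and,
        Fin.valEmbedding_apply]
      exact ⟨by rintro ⟨a, ha, rfl⟩; exact ha,
        fun hx => ⟨⟨x, Finset.mem_range.1 (hA.1 hx)⟩, hx, rfl⟩⟩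
    have hc : s.card = r := by
      have := Finset.card_map Fin.valEmbedding (s := s)
      rw [hsA, hA.2] at this
      exact this.symm
    have hc' : sᶜ.card = m := by rw [Finset.card_compl, hc, Fintype.card_fin]; omega
    -- The shuffle with a prescribed image: it enumerates `s` and then its complement, both
    -- increasingly.
    set π : Equiv.Perm (Fin (r + m)) := finSumFinEquiv.symm.trans (finSumEquivOfFinset hc hc') with hπ
    have hl : ∀ i : Fin r, π (Fin.castAdd m i) = s.orderEmbOfFin hc i := by
      intro i
      rw [hπ, Equiv.trans_apply, finSumFinEquiv_symm_apply_castAdd, finSumEquivOfFinset_inl]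
    have hr : ∀ i : Fin m, π (Fin.natAdd r i) = sᶜ.orderEmbOfFin hc' i := by
      intro i
      rw [hπ, Equiv.trans_apply, finSumFinEquiv_symm_apply_natAdd, finSumEquivOfFinset_inr]
    refine ⟨π, ?_, ?_⟩
    · refine Finset.mem_filter.2 ⟨Finset.mem_univ _, fun i j hij hrr => ?_⟩
      induction i using Fin.addCases with
      | left i =>
        induction j using Fin.addCases with
        | left j =>
          rw [hl, hl, OrderEmbedding.lt_iff_lt]
          exact hij
        | right j => simp at hrr; omega
      | right i =>
        induction j using Fin.addCases with
        | left j =>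
          have := Fin.lt_def.1 hij
          rw [Fin.val_natAdd, Fin.val_castAdd] at this
          omega
        | right j =>
          rw [hr, hr, OrderEmbedding.lt_iff_lt]
          have := Fin.lt_def.1 hij
          rw [Fin.val_natAdd, Fin.val_natAdd] at this
          exact Fin.lt_def.2 (by omega)
    · rw [← hsA]
      ext x
      simp only [List.mem_toFinset, List.mem_map, List.mem_range'_1, Finset.mem_map,
        Fin.valEmbedding_apply]
      constructor
      · rintro ⟨j, hj, rfl⟩
        refine ⟨π (Fin.castAdd m ⟨j, by omega⟩), ?_, ?_⟩
        · rw [hl]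
          exact Finset.orderEmbOfFin_mem _ _ _
        · rw [permFun_of_lt π (by omega)]
          rfl
      · rintro ⟨y, hy, rfl⟩
        have : y ∈ Set.range (s.orderEmbOfFin hc) := by
          rw [Finset.range_orderEmbOfFin]; exact hy
        obtain ⟨i, rfl⟩ := this
        refine ⟨i, by omega, ?_⟩
        rw [permFun_of_lt π (by omega), ← hl]
        rfl
  · intro π hπ
    rw [sort_image_permFun hπ (by omega) (by omega), shuffleWord_eq h, List.range_eq_range']

theorem sum_sum_shuffles {M : Type*} [AddCommMonoid M] (n : ℕ) (f : ℕ → List ℕ → M) :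
    ∑ r ∈ Finset.range (n + 1), ∑ π ∈ shuffles n r, f r (shuffleWord r π) =
      splitSum (List.range' 0 n) (fun c _ => f c.length (extractWord 0 c)) := by
  rw [splitSum_range' 0 n (fun c => f c.length (extractWord 0 c)), Finset.sum_powerset]
  simp only [Nat.card_Ico, zero_add, tsub_zero]
  refine Finset.sum_congr rfl fun r hr => ?_
  rw [sum_shuffles (by simpa [Nat.lt_succ_iff] using hr) (f r), ← Finset.range_eq_Ico]
  refine Finset.sum_congr rfl fun A hA => ?_
  rw [Finset.length_sort, (Finset.mem_powersetCard.1 hA).2]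

end Shuffles

/-! ### Braid words acting on evaluated lists -/

section WordOperators

variable {E : Type*} [Ring E] (σ : E →ₙ+* E) (t : E)

/-- The operator of a braid word; the leftmost letter acts first. -/
def wordOp : List ℕ → E
  | [] => 1
  | i :: w => wordOp w * gen σ t (i - 1)

variable {σ t}

theorem wordOp_append (v w : List ℕ) : wordOp σ t (v ++ w) = wordOp σ t w * wordOp σ t v := by
  induction v with
  | nil => simp [wordOp]
  | cons i v ih => rw [List.cons_append, wordOp, ih, wordOp, mul_assoc]

theorem seg_succ {m l : ℕ} (h : m ≤ l) : seg m (l + 1) = l :: seg m l := by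
  rw [seg, seg, show l + 1 - m = l - m + 1 by omega, List.range'_concat, List.reverse_append]
  simp
  omega

theorem seg_self (m : ℕ) : seg m m = [] := by simp [seg]

variable {α : Type*} {Ψ : List α → E}
  (hΨ : ∀ p q a b, Ψ (p ++ b :: a :: q) = gen σ t p.length * Ψ (p ++ a :: b :: q))
include hΨ

theorem wordOp_seg_mul (a d q : List α) (x : α) :
    wordOp σ t (seg (a.length + 1) (a.length + d.length + 1)) * Ψ (a ++ d ++ x :: q) =
      Ψ (a ++ x :: d ++ q) := by
  induction d using List.reverseRecOn generalizing q with
  | nil => simp [seg_self, wordOp]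
  | append_singleton d y ih =>
    have h1 := hΨ (a ++ d) q y x
    have h2 := ih (y :: q)
    rw [List.length_append, List.length_singleton, ← add_assoc, seg_succ (by omega), wordOp,
      Nat.add_sub_cancel, mul_assoc]
    simp only [List.append_assoc, List.length_append, List.cons_append, List.nil_append] at *
    rw [← h1, h2]

/-- The statement is generalized for the induction on `u`: `a` holds the letters already extracted
and `d` those already passed over. The next letter either jumps over `d` to the end of `a`, which
costs one segment word, or joins `d`. -/
theorem splitSum_extractWord (G : ℕ → E) (a d u q : List α) :
    splitSum (List.range' (a.length + d.length) u.length)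
        (fun c _ => G c.length * wordOp σ t (extractWord a.length c) * Ψ (a ++ d ++ u ++ q)) =
      splitSum u (fun x y => G x.length * Ψ (a ++ x ++ d ++ y ++ q)) := by
  induction u generalizing a d G with
  | nil => simp [splitSum, extractWord, wordOp]
  | cons x u ih =>
    have h1 := ih (fun n => G (n + 1)) (a ++ [x]) d
    have h2 := ih G a (d ++ [x])
    have h3 := wordOp_seg_mul hΨ a d (u ++ q) x
    simp only [List.append_assoc, List.length_append, List.cons_append, List.nil_append,
      List.length_cons, List.length_nil, zero_add, ← add_assoc] at h1 h2 h3 ⊢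
    rw [List.range'_succ, splitSum, splitSum]
    simp only [List.cons_append, List.length_cons]
    rw [← h2]
    congr 1
    rw [add_right_comm] at h1
    rw [← h1]
    refine splitSum_congr fun c _ _ => ?_
    rw [extractWord, wordOp_append, ← h3]
    simp only [mul_assoc]

/-- Summation of a braided operation over all shuffles of an initial segment of letters. -/
theorem sum_shuffles_mul (G : ℕ → E) (u q : List α) :
    ∑ r ∈ Finset.range (u.length + 1), ∑ π ∈ shuffles u.length r,
        G r * wordOp σ t (shuffleWord r π) * Ψ (u ++ q) =
      splitSum u (fun x y => G x.length * Ψ (x ++ y ++ q)) := by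
  rw [sum_sum_shuffles u.length (fun r w => G r * wordOp σ t w * Ψ (u ++ q))]
  simpa using splitSum_extractWord hΨ G [] [] u q

end WordOperators

section SplitSumGroup

variable {α M : Type*}

theorem splitSum_swap [AddCommMonoid M] (l l' : List α)
    (f : List α → List α → List α → List α → M) :
    splitSum l (fun a b => splitSum l' (fun c d => f a b c d)) =
      splitSum l' (fun c d => splitSum l (fun a b => f a b c d)) := by
  induction l generalizing f with
  | nil => rfl
  | cons x l ih => simp only [splitSum, splitSum_add, ih]

theorem splitSum_sub [AddCommGroup M] (l : List α) (f g : List α → List α → M) :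
    splitSum l (fun a b => f a b - g a b) = splitSum l f - splitSum l g := by
  induction l generalizing f g with
  | nil => rfl
  | cons x l ih =>
    simp only [splitSum, ih]
    abel

end SplitSumGroup

/-! ### The exchange and cyclic identities from the defining relation of the brackets -/

section Identities

variable {E : Type*} [Ring E] {σ : E →ₙ+* E} {t : E}

/-- The operators differ only through the empty word, where one is `(σ ^ p) 1` and the other `1`;
the hypothesis on `X` absorbs this. -/
theorem pow_shift_wordOp_mul (p : ℕ) (w : List ℕ) {X : E} (hX : (σ ^ p) 1 * X = X) :
    (σ ^ p) (wordOp σ t w) * X = wordOp σ ((σ ^ p) t) w * X := by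
  induction w generalizing X with
  | nil => simpa [wordOp] using hX
  | cons i w ih =>
    have h : gen σ ((σ ^ p) t) (i - 1) = (σ ^ p) (gen σ t (i - 1)) := by
      rw [gen, gen, ← pow_shift_add, ← pow_shift_add, add_comm]
    rw [wordOp, wordOp, map_mul, mul_assoc, mul_assoc, h, ih]
    rw [← mul_assoc, ← map_mul, one_mul]

namespace Letter

theorem unit_mul_eval_of_le (L : List ℕ) {n : ℕ} {gs : List (Letter σ t)} (h : n ≤ gs.length) :
    (σ ^ n) 1 * eval L gs = eval L gs := by
  rw [← unit_mul_eval, ← mul_assoc, unit_mul_unit h]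

/-- Shuffles behind a prefix `p` reduce to shuffles at the start by taking `(σ ^ p.length) t` as the
braiding element, whose generators are those of `t` with shifted index. -/
theorem sum_shuffles_mul_eval (ht : IsShiftBraiding σ t) (L : List ℕ) (G : ℕ → E)
    (p u q : List (Letter σ t)) :
    (σ ^ p.length) (∑ r ∈ Finset.range (u.length + 1), ∑ π ∈ shuffles u.length r,
        G r * wordOp σ t (shuffleWord r π)) * eval L (p ++ u ++ q) =
      splitSum u (fun x y => (σ ^ p.length) (G x.length) * eval L (p ++ x ++ y ++ q)) := by
  have h := sum_shuffles_mul (σ := σ) (t := (σ ^ p.length) t) (Ψ := fun l => eval L (p ++ l))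
    (fun p' q' a b => by
      have := eval_swap L ht (p ++ p') q' a b
      simp only [List.append_assoc] at this
      rw [this, gen, gen, ← pow_shift_add, List.length_append, add_comm])
    (fun r => (σ ^ p.length) (G r)) u q
  simp only [← List.append_assoc] at h
  rw [← h, map_sum, Finset.sum_mul]
  refine Finset.sum_congr rfl fun r _ => ?_
  rw [map_sum, Finset.sum_mul]
  refine Finset.sum_congr rfl fun π _ => ?_
  rw [map_mul, mul_assoc, pow_shift_wordOp_mul _ _ (unit_mul_eval_of_le L (by simp)), mul_assoc]

end Letter

open Letter

variable (ht : IsShiftBraiding σ t) {m : E} {S : ℕ → E}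
  (hS : ∀ n, IsShiftOperation σ t (n + 2) (S n))

include hS in
theorem isShiftOperation_append (u : List (Letter σ t)) (y z : Letter σ t) :
    IsShiftOperation σ t (u ++ [y, z]).length (S u.length) := by simpa using hS u.length

/-- The letter `S(u; y, z)`. -/
def bracket (u : List (Letter σ t)) (y z : Letter σ t) : Letter σ t :=
  app ht (S u.length) (u ++ [y, z]) (by simp) (isShiftOperation_append hS u y z)

variable (L : List ℕ)

theorem eval_bracket (p q u : List (Letter σ t)) (y z : Letter σ t) :
    eval L (p ++ bracket ht hS u y z :: q) =
      (σ ^ p.length) (S u.length) * eval L (p ++ u ++ y :: z :: q) := by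
  rw [bracket, eval_app]
  simp

variable (m) in
/-- The right-normed product of a list of letters. -/
def prodEval (gs : List (Letter σ t)) : E := m ^ (gs.length - 1) * eval L gs

/-- The defining relation of the brackets `S`. -/
def BracketRelation (σ : E →ₙ+* E) (t m : E) (S : ℕ → E) : Prop :=
  ∀ n, m ^ (n + 1) - m ^ (n + 1) * gen σ t n + ∑ r ∈ Finset.range (n + 1), ∑ π ∈ shuffles n r,
    m ^ r * (σ ^ r) (S (n - r)) * wordOp σ t (shuffleWord r π) = 0

variable (hrel : BracketRelation σ t m S)
include hrel

/-- The bracket relation rewritten with letters and multiplied by the trailing letters `w`, which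
contribute the left factor `m ^ w.length`. -/
theorem prodEval_relation (u w : List (Letter σ t)) (y z : Letter σ t) :
    prodEval m L (u ++ y :: z :: w) - prodEval m L (u ++ z :: y :: w) +
      splitSum u (fun a b => prodEval m L (a ++ bracket ht hS b y z :: w)) = 0 := by
  have h1 := congrArg (fun X => m ^ w.length * (X * eval L (u ++ y :: z :: w))) (hrel u.length)
  simp only [zero_mul, mul_zero, add_mul, sub_mul, mul_add, mul_sub] at h1
  rw [mul_assoc (m ^ (_ + 1)), ← eval_swap L ht] at h1
  have h2 := sum_shuffles_mul_eval ht L (fun r => m ^ r * (σ ^ r) (S (u.length - r))) [] u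
    (y :: z :: w)
  simp only [List.length_nil, pow_shift_zero, List.nil_append] at h2
  rw [h2, ← AddMonoidHom.coe_mulLeft (m ^ w.length), map_splitSum] at h1
  rw [← h1]
  have e1 : ∀ gs : List (Letter σ t), gs.length = w.length + (u.length + 1) + 1 →
      prodEval m L gs = m ^ w.length * (m ^ (u.length + 1) * eval L gs) := by
    intro gs hgs
    rw [prodEval, hgs, Nat.add_sub_cancel, pow_add, mul_assoc]
  rw [e1 _ (by simp; omega), e1 _ (by simp; omega)]
  congr 1
  refine splitSum_congr fun a b hab => ?_
  rw [prodEval, eval_bracket, AddMonoidHom.coe_mulLeft, List.length_append, List.length_cons,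
    ← add_assoc, Nat.add_sub_cancel, add_comm a.length, pow_add, ← hab, Nat.add_sub_cancel_left]
  simp only [mul_assoc]

omit hrel

variable (σ t S) in
/-- The left hand side of the exchange identity. -/
def exchangeOp (n r : ℕ) : E :=
  S (n + 2) - S (n + 2) * gen σ t r + ∑ j ∈ Finset.range (r + 1), ∑ π ∈ shuffles r j,
    S (n - r + j + 1) * (σ ^ j) (S (r - j)) * wordOp σ t (shuffleWord j π)

theorem exchangeOp_mul_eval (p u w : List (Letter σ t)) (a b y z : Letter σ t) :
    (σ ^ p.length) (exchangeOp σ t S (u.length + w.length) u.length) *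
        eval L (p ++ u ++ a :: b :: (w ++ [y, z])) =
      eval L (p ++ [bracket ht hS (u ++ a :: b :: w) y z]) -
        eval L (p ++ [bracket ht hS (u ++ b :: a :: w) y z]) +
        splitSum u (fun c d =>
          eval L (p ++ [bracket ht hS (c ++ bracket ht hS d a b :: w) y z])) := by
  have h1 := eval_swap L ht (p ++ u) (w ++ [y, z]) a b
  have h2 := sum_shuffles_mul_eval ht L
    (fun j => S (u.length + w.length - u.length + j + 1) * (σ ^ j) (S (u.length - j))) p u
    (a :: b :: (w ++ [y, z]))
  have h3 : ∀ c d : Letter σ t, eval L (p ++ [bracket ht hS (u ++ c :: d :: w) y z]) =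
      (σ ^ p.length) (S (u.length + w.length + 2)) *
        eval L (p ++ u ++ c :: d :: (w ++ [y, z])) := by
    intro c d
    rw [eval_bracket]
    simp [← add_assoc]
  rw [exchangeOp, map_add, map_sub, add_mul, sub_mul, h2, map_mul, mul_assoc, ← gen_add,
    ← List.length_append (as := p), ← h1, h3, h3]
  congr 1
  refine splitSum_congr fun c d hcd => ?_
  have h4 := eval_bracket ht hS L (p ++ c) (w ++ [y, z]) d a b
  have h5 := eval_bracket ht hS L p [] (c ++ bracket ht hS d a b :: w) y z
  simp only [List.append_assoc, List.cons_append] at h4 h5 ⊢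
  rw [h5, h4, map_mul, mul_assoc, ← pow_shift_add, ← hcd, Nat.add_sub_cancel_left,
    Nat.add_sub_cancel_left]
  simp only [List.length_append, List.length_cons]
  rw [show w.length + c.length + 1 = c.length + (w.length + 1) by omega]

-- Write `φ c d = R(c, S(d; y, z))`. Expanding `R(…, y, z) - R(…, z, y)` at the last pair expresses
-- the relation at `a`, `b` through sums of `φ` over splittings. Sorted by where `a` and `b` go: if
-- both land in the product the terms vanish by the relation again; if they are separated they
-- cancel; if both land in the bracket they form exchange operators behind a prefix.
include ht hS hrel in
theorem exchangeOp_mul_eval_eq_zero (u w : List (Letter σ t)) (a b y z : Letter σ t)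
    (ih : ∀ n < u.length + w.length, ∀ r ≤ n, exchangeOp σ t S n r * (σ ^ (n + 4)) 1 = 0) :
    exchangeOp σ t S (u.length + w.length) u.length * eval L (u ++ a :: b :: (w ++ [y, z])) = 0 := by
  set φ : List (Letter σ t) → List (Letter σ t) → E :=
    fun c d => prodEval m L (c ++ [bracket ht hS d y z]) with hφ
  have star := prodEval_relation ht hS L hrel
  have X : ∀ c, prodEval m L (c ++ [y, z]) - prodEval m L (c ++ [z, y]) + splitSum c φ = 0 :=
    fun c => star c [] y z
  have A1 := star u (w ++ [y, z]) a b
  have A2 := star u (w ++ [z, y]) a b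
  have X1 := X (u ++ a :: b :: w)
  have X2 := X (u ++ b :: a :: w)
  have X3 := splitSum_congr (l := u) (f := _) fun c d _ => X (c ++ bracket ht hS d a b :: w)
  rw [splitSum_zero, splitSum_add, splitSum_sub] at X3
  simp only [List.append_assoc, List.cons_append] at X1 X2 X3
  -- `A1` and `A2` are the relations at `a`, `b` with the tails `y, z` and `z, y`; the combination
  -- removes every pure product.
  have main : splitSum (u ++ a :: b :: w) φ - splitSum (u ++ b :: a :: w) φ +
      splitSum u (fun c d => splitSum (c ++ bracket ht hS d a b :: w) φ) = 0 := by
    linear_combination (norm := abel) X1 - X2 + X3 - A1 + A2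
  have T1 : ∀ x x' v v', φ (x ++ a :: b :: v) (x' ++ v') - φ (x ++ b :: a :: v) (x' ++ v') +
      splitSum x (fun c d => φ (c ++ bracket ht hS d a b :: v) (x' ++ v')) = 0 := by
    intro x x' v v'
    have := star x (v ++ [bracket ht hS (x' ++ v') y z]) a b
    simpa [hφ] using this
  set T2 : List (Letter σ t) → List (Letter σ t) → List (Letter σ t) → List (Letter σ t) → E :=
    fun x x' v v' => φ (x ++ v) (x' ++ a :: b :: v') - φ (x ++ v) (x' ++ b :: a :: v') +
      splitSum x' (fun c d => φ (x ++ v) (c ++ bracket ht hS d a b :: v')) with hT2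
  have T2_eq : ∀ x x' v v', T2 x x' v v' = m ^ (x ++ v).length *
      ((σ ^ (x ++ v).length) (exchangeOp σ t S (x'.length + v'.length) x'.length) *
        eval L (x ++ v ++ x' ++ a :: b :: (v' ++ [y, z]))) := by
    intro x x' v v'
    have h : ∀ d, φ (x ++ v) d = m ^ (x ++ v).length * eval L (x ++ v ++ [bracket ht hS d y z]) := by
      intro d
      rw [hφ]
      simp only [prodEval]
      rw [List.length_append (bs := [_]), List.length_singleton, Nat.add_sub_cancel]
    rw [exchangeOp_mul_eval ht hS, hT2]
    simp only [h]
    rw [mul_add, mul_sub, ← AddMonoidHom.coe_mulLeft, map_splitSum]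
  -- A nonempty prefix `x ++ v` leaves fewer letters inside the bracket, so the induction hypothesis
  -- applies behind the prefix.
  have T2_zero : ∀ x x' v v', x.length + x'.length = u.length → v.length + v'.length = w.length →
      x ++ v ≠ [] → T2 x x' v v' = 0 := by
    intro x x' v v' hx hv hne
    have hpos := List.length_pos_of_ne_nil hne
    rw [List.length_append] at hpos
    rw [T2_eq, ← unit_mul_eval_of_le L (n := (x ++ v).length + (x'.length + v'.length + 4)),
      pow_shift_add, ← mul_assoc ((σ ^ _) _), ← map_mul, ih _ (by omega) _ (by omega)]
    · simp
    · simp; omega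
  have total : splitSum u (fun x x' => splitSum w (fun v v' => T2 x x' v v')) = 0 := by
    rw [← main]
    have h0 : splitSum u (fun x x' => splitSum w (fun v v' =>
        (φ (x ++ a :: b :: v) (x' ++ v') - φ (x ++ b :: a :: v) (x' ++ v') +
          splitSum x (fun c d => φ (c ++ bracket ht hS d a b :: v) (x' ++ v'))))) = 0 := by
      simp only [T1, splitSum_zero]
    -- In `e1` and `e2` coassociativity (and in `e1` also cocommutativity) matches the two orders of
    -- choosing the prefix part of `u` and the arguments of the inner bracket of `a`, `b`.
    have e1 : splitSum u (fun x x' => splitSum w (fun v v' =>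
        splitSum x (fun c d => φ (c ++ bracket ht hS d a b :: v) (x' ++ v')))) =
        splitSum u (fun x x' => splitSum x (fun c d => splitSum w (fun v v' =>
          φ (c ++ bracket ht hS x' a b :: v) (d ++ v')))) := by
      simp only [splitSum_swap w]
      rw [splitSum_assoc u fun c d x' => splitSum w fun v v' =>
        φ (c ++ bracket ht hS d a b :: v) (x' ++ v'),
        splitSum_assoc u fun c d x' => splitSum w fun v v' =>
        φ (c ++ bracket ht hS x' a b :: v) (d ++ v')]
      refine splitSum_congr fun c d _ => ?_
      rw [splitSum_comm]
    have e2 : splitSum u (fun x x' => splitSum w (fun v v' =>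
        splitSum x' (fun c d => φ (x ++ v) (c ++ bracket ht hS d a b :: v')))) =
        splitSum u (fun x x' => splitSum x (fun c d => splitSum w (fun v v' =>
          φ (c ++ v) (d ++ bracket ht hS x' a b :: v')))) := by
      simp only [splitSum_swap w]
      rw [splitSum_assoc u fun c d x' => splitSum w fun v v' =>
        φ (c ++ v) (d ++ bracket ht hS x' a b :: v')]
    simp only [splitSum_add, splitSum_sub] at h0
    rw [e1] at h0
    simp only [hT2, splitSum_append, splitSum, splitSum_add, splitSum_sub]
    rw [e2]
    linear_combination (norm := abel) -h0
  rw [splitSum_eq_of_forall] at total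
  · rw [splitSum_eq_of_forall, T2_eq] at total
    · simpa [pow_shift_zero] using total
    · intro v v' hv hne
      exact T2_zero _ _ _ _ (by simp) hv (by simpa using hne)
  · intro x x' hx hne
    rw [← splitSum_zero w]
    exact splitSum_congr fun v v' hv => T2_zero _ _ _ _ hx hv (by simp [hne])

omit [Ring E] in
theorem exists_eq_append_of_length {α : Type*} {n r : ℕ} (hr : r ≤ n) (l : List α)
    (hl : l.length = n + 4) : ∃ (u w : List α) (a b y z : α),
      u.length = r ∧ w.length = n - r ∧ l = u ++ a :: b :: (w ++ [y, z]) := by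
  obtain ⟨a, b, l', h1⟩ : ∃ a b l', l.drop r = a :: b :: l' := by
    have h : (l.drop r).length = n - r + 4 := by rw [List.length_drop]; omega
    match l.drop r, h with
    | a :: b :: l', _ => exact ⟨a, b, l', rfl⟩
  have h2 : l'.length = n - r + 2 := by
    have := congrArg List.length h1
    simp at this
    omega
  obtain ⟨y, z, h3⟩ : ∃ y z, l'.drop (n - r) = [y, z] := by
    have h : (l'.drop (n - r)).length = 2 := by rw [List.length_drop]; omega
    exact List.length_eq_two.1 h
  refine ⟨l.take r, l'.take (n - r), a, b, y, z, ?_, ?_, ?_⟩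
  · rw [List.length_take]; omega
  · rw [List.length_take]; omega
  · rw [← h3, List.take_append_drop, ← h1, List.take_append_drop]

-- Strong induction on `n`, testing on `n + 4` distinct atoms, grouped as `u, a, b, w, y, z` with
-- `r` atoms in `u`.
include ht hS hrel in
theorem exchangeOp_eq_zero (n r : ℕ) (hr : r ≤ n) :
    exchangeOp σ t S n r * (σ ^ (n + 4)) 1 = 0 := by
  induction n using Nat.strong_induction_on generalizing r with
  | _ n ih =>
    obtain ⟨u, w, a, b, y, z, hu, hw, h⟩ := exists_eq_append_of_length hr
      ((List.range (n + 4)).map (atom ht)) (by simp)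
    have h1 := exchangeOp_mul_eval_eq_zero ht hS (List.range (n + 4)) hrel u w a b y z
      (fun n' hn' r' hr' => ih n' (by omega) r' hr')
    rwa [← h, eval_atoms _ ht List.nodup_range, List.length_range, hu, hw,
      Nat.add_sub_cancel' hr] at h1

variable (σ t S) in
/-- The summand of the cyclic identity. -/
def cyclicTerm (n : ℕ) : E :=
  S (n + 1) + ∑ j ∈ Finset.range (n + 1), ∑ π ∈ shuffles n j,
    S j * (σ ^ j) (S (n - j)) * wordOp σ t (shuffleWord j π)

variable (σ t S) in
/-- The left hand side of the cyclic identity. -/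
def cyclicOp (n : ℕ) : E :=
  cyclicTerm σ t S n * (1 + gen σ t (n + 1) * gen σ t n + gen σ t n * gen σ t (n + 1))

theorem cyclicTerm_mul_eval (p u q : List (Letter σ t)) (a b c : Letter σ t) :
    (σ ^ p.length) (cyclicTerm σ t S u.length) * eval L (p ++ u ++ a :: b :: c :: q) =
      eval L (p ++ bracket ht hS (u ++ [a]) b c :: q) +
        splitSum u (fun x y => eval L (p ++ bracket ht hS x (bracket ht hS y a b) c :: q)) := by
  rw [cyclicTerm, map_add, add_mul, sum_shuffles_mul_eval ht L
    (fun j => S j * (σ ^ j) (S (u.length - j))), eval_bracket]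
  simp only [List.append_assoc, List.length_append, List.cons_append, List.nil_append,
    List.length_cons, List.length_nil, zero_add]
  congr 1
  refine splitSum_congr fun x y hxy => ?_
  have h := eval_bracket ht hS L (p ++ x) (c :: q) y a b
  simp only [List.append_assoc] at h
  rw [eval_bracket, List.append_assoc, h, map_mul, mul_assoc, ← pow_shift_add, ← hxy,
    Nat.add_sub_cancel_left, List.length_append]

include ht in
theorem cyclicOp_mul_eval (p u q : List (Letter σ t)) (a b c : Letter σ t) :
    (σ ^ p.length) (cyclicOp σ t S u.length) * eval L (p ++ u ++ a :: b :: c :: q) =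
      (σ ^ p.length) (cyclicTerm σ t S u.length) * eval L (p ++ u ++ a :: b :: c :: q) +
      (σ ^ p.length) (cyclicTerm σ t S u.length) * eval L (p ++ u ++ b :: c :: a :: q) +
      (σ ^ p.length) (cyclicTerm σ t S u.length) * eval L (p ++ u ++ c :: a :: b :: q) := by
  have h1 := eval_swap L ht (p ++ u) (c :: q) a b
  have h2 := eval_swap L ht (p ++ u ++ [b]) q a c
  have h3 := eval_swap L ht (p ++ u ++ [a]) q b c
  have h4 := eval_swap L ht (p ++ u) (b :: q) a c
  simp only [List.append_assoc, List.length_append, List.cons_append, List.nil_append,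
    List.length_cons, List.length_nil, zero_add, add_assoc, gen_add p.length] at h1 h2 h3 h4 ⊢
  rw [h4, h3, h2, h1, cyclicOp, map_mul, map_add, map_add, map_mul, map_mul]
  simp only [mul_add, add_mul, mul_assoc]
  rw [unit_mul_eval_of_le L (by simp), add_assoc]

-- The relation for `b`, `c` behind `u, a`, the relation for `b`, `c` with trailing `a`, and the
-- relation exchanging the letter `S(y; b, c)` with `a` combine into `key`. Summed over the cyclic
-- permutations of `a`, `b`, `c`, the products of plain letters cancel, and the brackets assemble to
-- the cyclic operator behind all possible prefixes.
include ht hS hrel in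
theorem splitSum_cyclic (u : List (Letter σ t)) (a b c : Letter σ t) :
    splitSum u (fun x y => m ^ x.length *
      ((σ ^ x.length) (cyclicOp σ t S y.length) * eval L (x ++ y ++ [a, b, c]))) = 0 := by
  have star := prodEval_relation ht hS L hrel
  set Q₁ : Letter σ t → Letter σ t → Letter σ t → E := fun a b c => splitSum u fun x y =>
    prodEval m L (x ++ [bracket ht hS (y ++ [a]) b c]) with hQ₁
  set Q₂ : Letter σ t → Letter σ t → Letter σ t → E := fun a b c => splitSum u fun x y =>
    splitSum y fun d e => prodEval m L (x ++ [bracket ht hS d (bracket ht hS e a b) c]) with hQ₂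
  have key : ∀ a b c, prodEval m L (u ++ [a, b, c]) - prodEval m L (u ++ [a, c, b]) -
      prodEval m L (u ++ [b, c, a]) + prodEval m L (u ++ [c, b, a]) + Q₁ a b c + Q₂ b c a = 0 := by
    intro a b c
    have h1 := star (u ++ [a]) [] b c
    have h2 := star u [a] b c
    have h3 := splitSum_congr (l := u) (f := _) fun x y _ => star x [] (bracket ht hS y b c) a
    rw [splitSum_zero, splitSum_add, splitSum_sub,
      splitSum_assoc u fun d e y => prodEval m L (d ++ [bracket ht hS e (bracket ht hS y b c) a])]
      at h3
    simp only [splitSum_append, splitSum, splitSum_add, List.append_assoc, List.cons_append,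
      List.nil_append, List.append_nil] at h1
    linear_combination (norm := abel) h1 - h2 + h3
  -- One summand of the cyclic identity gives `Q₁` and `Q₂` with the same order of letters, while
  -- `key` pairs `Q₁ a b c` with `Q₂ b c a`; only the cyclic sums agree.
  have term_eq : ∀ a b c, splitSum u (fun x y => m ^ x.length *
      ((σ ^ x.length) (cyclicTerm σ t S y.length) * eval L (x ++ y ++ [a, b, c]))) =
        Q₁ a b c + Q₂ a b c := by
    intro a b c
    have h : ∀ (x : List (Letter σ t)) (g : Letter σ t),
        prodEval m L (x ++ [g]) = m ^ x.length * eval L (x ++ [g]) := by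
      intro x g
      rw [prodEval, List.length_append, List.length_singleton, Nat.add_sub_cancel]
    simp only [hQ₁, hQ₂, h]
    rw [← splitSum_add]
    refine splitSum_congr fun x y _ => ?_
    rw [cyclicTerm_mul_eval ht hS, mul_add, ← AddMonoidHom.coe_mulLeft, map_splitSum]
  have h1 := key a b c
  have h2 := key b c a
  have h3 := key c a b
  simp only [cyclicOp_mul_eval ht, mul_add, splitSum_add, term_eq]
  linear_combination (norm := abel) h1 + h2 + h3

include ht hS hrel in
theorem cyclicOp_eq_zero (n : ℕ) : cyclicOp σ t S n * (σ ^ (n + 3)) 1 = 0 := by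
  induction n using Nat.strong_induction_on with
  | _ n ih =>
    obtain ⟨u, a, b, c, hu, h⟩ : ∃ u a b c, u.length = n ∧
        (List.range (n + 3)).map (atom ht) = u ++ [a, b, c] := by
      set l := (List.range (n + 3)).map (atom ht)
      have hl : (l.drop n).length = 3 := by simp [l]
      obtain ⟨a, b, c, h⟩ := List.length_eq_three.1 hl
      exact ⟨l.take n, a, b, c, by simp [l], by rw [← h, List.take_append_drop]⟩
    have h1 := splitSum_cyclic ht hS (List.range (n + 3)) hrel u a b c
    -- All terms with a nonempty prefix contain the cyclic operator of lower arity and vanish by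
    -- induction.
    rw [splitSum_eq_of_forall] at h1
    · simp only [List.length_nil, pow_zero, one_mul, List.nil_append] at h1
      rwa [← h, eval_atoms _ ht List.nodup_range, List.length_range, hu] at h1
    · intro x y hxy hx
      have := List.length_pos_of_ne_nil hx
      rw [← unit_mul_eval_of_le _ (n := x.length + (y.length + 3)), pow_shift_add,
        ← mul_assoc ((σ ^ _) _), ← map_mul, ih _ (by omega)]
      · simp
      · simp

end Identities

/-! ### Words of permutations and symmetrization -/

section PermWords

theorem map_adjTransposition {n i : ℕ} (h : 1 ≤ i ∧ i < n) :
    ∃ (p q : List (Fin n)) (a b : Fin n), p.length = i - 1 ∧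
      List.finRange n = p ++ a :: b :: q ∧
      (List.finRange n).map (adjTransposition n i) = p ++ b :: a :: q := by
  have hl : (List.finRange n).length = n := List.length_finRange
  have e1 : (List.finRange n).drop (i - 1) = ⟨i - 1, by omega⟩ :: (List.finRange n).drop i := by
    rw [List.drop_eq_getElem_cons (by omega), List.getElem_finRange]
    simp only [Fin.cast_mk, Nat.sub_add_cancel h.1]
  have e2 : (List.finRange n).drop i = ⟨i, h.2⟩ :: (List.finRange n).drop (i + 1) := by
    rw [List.drop_eq_getElem_cons (by omega), List.getElem_finRange]
    simp only [Fin.cast_mk]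
  rw [e2] at e1
  have e3 := List.take_append_drop (i - 1) (List.finRange n)
  rw [e1] at e3
  have hnd := List.nodup_finRange n
  rw [← e3] at hnd
  refine ⟨(List.finRange n).take (i - 1), (List.finRange n).drop (i + 1), _, _, ?_, e3.symm, ?_⟩
  · rw [List.length_take]; omega
  · have hfix : ∀ l : List (Fin n), ⟨i - 1, by omega⟩ ∉ l → ⟨i, h.2⟩ ∉ l →
        l.map (adjTransposition n i) = l := by
      intro l h1 h2
      refine (List.map_congr_left fun x hx => ?_).trans (List.map_id l)
      rw [adjTransposition, dif_pos h]
      exact Equiv.swap_apply_of_ne_of_ne (fun e => h1 (e ▸ hx)) (fun e => h2 (e ▸ hx))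
    conv_lhs => rw [← e3]
    rw [List.map_append, List.map_cons, List.map_cons, hfix, hfix]
    · simp [adjTransposition, h]
    · have := (List.nodup_cons.1 (List.nodup_append.1 hnd).2.1).1
      simp at this
      exact this.2
    · exact (List.nodup_cons.1 (List.nodup_cons.1 (List.nodup_append.1 hnd).2.1).2).1
    · intro hm
      exact (List.nodup_append.1 hnd).2.2 _ hm _ (by simp) rfl
    · intro hm
      exact (List.nodup_append.1 hnd).2.2 _ hm _ (by simp) rfl

variable {E : Type*} [Ring E] {σ : E →ₙ+* E} {t : E}

/-- Each letter of the word permutes the evaluated list by its transposition. Hence the result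
depends on the word only through the product of transpositions, and no presentation of the symmetric
group is needed. -/
theorem wordOp_mul_map {α : Type*} {Ψ : List α → E}
    (hΨ : ∀ p q a b, Ψ (p ++ b :: a :: q) = gen σ t p.length * Ψ (p ++ a :: b :: q)) {n : ℕ}
    (w : List ℕ) (hw : ∀ i ∈ w, 1 ≤ i ∧ i < n) (f : Fin n → α) :
    wordOp σ t w * Ψ ((List.finRange n).map f) =
      Ψ ((List.finRange n).map (f ∘ (w.map (adjTransposition n)).prod)) := by
  induction w generalizing f with
  | nil => simp [wordOp]
  | cons i w ih =>
    have hi := hw i (by simp)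
    obtain ⟨p, q, a, b, hp, h1, h2⟩ := map_adjTransposition hi
    have h3 := hΨ (p.map f) (q.map f) (f a) (f b)
    have h4 : (List.finRange n).map (f ∘ adjTransposition n i) =
        p.map f ++ f b :: f a :: q.map f := by
      rw [← List.map_map, h2]; simp
    rw [wordOp, mul_assoc, ← hp]
    conv_lhs => rw [h1]
    rw [List.length_map] at h3
    rw [List.map_append, List.map_cons, List.map_cons, ← h3, ← h4,
      ih (fun j hj => hw j (by simp [hj])), List.map_cons, List.prod_cons]
    rfl

/-- For an involutive braiding, the action of a word depends only on its permutation. -/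
theorem wordOp_eq_of_prod_eq (ht : IsShiftBraiding σ t) {n : ℕ} {v w : List ℕ}
    (hv : ∀ i ∈ v, 1 ≤ i ∧ i < n) (hw : ∀ i ∈ w, 1 ≤ i ∧ i < n)
    (h : (v.map (adjTransposition n)).prod = (w.map (adjTransposition n)).prod) :
    wordOp σ t v * (σ ^ n) 1 = wordOp σ t w * (σ ^ n) 1 := by
  have h1 := fun w hw => wordOp_mul_map (Letter.eval_swap (List.range n) ht) (n := n) w hw
    (Letter.atom ht ∘ Fin.val)
  have h2 := Letter.eval_atoms (List.range n) ht List.nodup_range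
  rw [List.length_range, ← List.map_coe_finRange_eq_range, List.map_map] at h2
  rw [← h2, List.map_coe_finRange_eq_range, h1 v hv, h1 w hw, h]

/-- Left multiplication by the transposition permutes the summands. The words `r :: permWord π` and
the chosen word of the product may differ, but they represent the same permutation. -/
theorem sum_wordOp_permWord_mul_gen (ht : IsShiftBraiding σ t) {n r : ℕ} (hr : 1 ≤ r) (hrn : r < n) :
    ∑ π : Equiv.Perm (Fin n), wordOp σ t (permWord π) * gen σ t (r - 1) * (σ ^ n) 1 =
      ∑ π : Equiv.Perm (Fin n), wordOp σ t (permWord π) * (σ ^ n) 1 := by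
  rw [← Equiv.sum_comp (Equiv.mulLeft (adjTransposition n r))
    (fun π => wordOp σ t (permWord π) * (σ ^ n) 1)]
  refine Finset.sum_congr rfl fun π _ => ?_
  refine wordOp_eq_of_prod_eq ht (v := r :: permWord π) ?_ (permWord_mem _) ?_
  · intro i hi
    rcases List.mem_cons.1 hi with rfl | hi
    · exact ⟨hr, hrn⟩
    · exact permWord_mem π i hi
  · rw [List.map_cons, List.prod_cons, permWord_prod, permWord_prod]
    rfl

theorem wordOp_mul_unit (ht : IsShiftBraiding σ t) {n : ℕ} {w : List ℕ}
    (hw : ∀ i ∈ w, 1 ≤ i ∧ i < n) : wordOp σ t w * (σ ^ n) 1 = (σ ^ n) 1 * wordOp σ t w := by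
  induction w with
  | nil => simp [wordOp]
  | cons i w ih =>
    have := hw i (by simp)
    rw [wordOp, mul_assoc, ht.gen_mul_unit (by omega), ← mul_assoc,
      ih fun j hj => hw j (by simp [hj]), mul_assoc]

theorem wordOp_mul_gen (ht : IsShiftBraiding σ t) {n i : ℕ} {w : List ℕ}
    (hw : ∀ i ∈ w, 1 ≤ i ∧ i < n) (hi : n ≤ i) :
    wordOp σ t w * gen σ t i = gen σ t i * wordOp σ t w := by
  induction w with
  | nil => simp [wordOp]
  | cons j w ih =>
    have := hw j (by simp)
    rw [wordOp, mul_assoc, ht.gen_comm (by omega), ← mul_assoc,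
      ih fun j hj => hw j (by simp [hj]), mul_assoc]

theorem wordOp_shift_mul (p : ℕ) {w : List ℕ} (hw : ∀ i ∈ w, 1 ≤ i) {X : E}
    (hX : (σ ^ p) 1 * X = X) : wordOp σ t (shift p w) * X = (σ ^ p) (wordOp σ t w) * X := by
  induction w generalizing X with
  | nil => simpa [wordOp, shift] using hX.symm
  | cons i w ih =>
    have hi := hw i (by simp)
    have h1 : shift p (i :: w) = (p + i) :: shift p w := rfl
    have h2 : gen σ t (p + i - 1) = (σ ^ p) (gen σ t (i - 1)) := by
      rw [Nat.add_sub_assoc hi, gen_add]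
    rw [h1, wordOp, wordOp, map_mul, mul_assoc, mul_assoc, h2,
      ih fun j hj => hw j (by simp [hj])]
    rw [← mul_assoc, ← map_mul, one_mul]

theorem IsShiftOperation.comp_wordOp (ht : IsShiftBraiding σ t) {n : ℕ} {F : E}
    (hF : IsShiftOperation σ t n F) {w : List ℕ} (hw : ∀ i ∈ w, 1 ≤ i ∧ i < n) :
    IsShiftOperation σ t n (F * wordOp σ t w) := by
  induction w with
  | nil => simpa [wordOp] using hF
  | cons i w ih =>
    have := hw i (by simp)
    rw [wordOp, ← mul_assoc]
    exact ht.isShiftOperation_comp_gen (ih fun j hj => hw j (by simp [hj])) (by omega)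

theorem wordOp_seg_one (ht : IsShiftBraiding σ t) (n : ℕ) :
    wordOp σ t (seg 1 (n + 1)) = moveLeft σ t n := by
  induction n with
  | zero => simp [seg, wordOp, moveLeft]
  | succ n ih => rw [seg_succ (by omega), wordOp, ih, ht.moveLeft_succ, Nat.add_sub_cancel]

theorem wordOp_segRev_one (n : ℕ) : wordOp σ t (segRev 1 (n + 1)) = moveRight σ t n := by
  induction n with
  | zero => simp [segRev, wordOp, moveRight]
  | succ n ih =>
    have h : segRev 1 (n + 1 + 1) = segRev 1 (n + 1) ++ [n + 1] := by
      simp [segRev, List.range'_concat, add_comm]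
    rw [h, wordOp_append, ih, moveRight, wordOp, wordOp, one_mul, Nat.add_sub_cancel]

end PermWords

noncomputable section

/-! ### Endomorphisms of the tensor algebra as a shift ring -/

section TensorAlgebraOperators

variable {k : Type*} [Field k] {V : Type*} [AddCommGroup V] [Module k V]

local notation "T" => TensorAlgebra k V

variable (k V) in
/-- The left multiplication `V ⊗ X → T(V)`, `v ⊗ x ↦ v g(x)`. -/
def consMap : V ⊗[k] T →ₗ[k] T :=
  TensorProduct.lift (LinearMap.mul k T ∘ₗ TensorAlgebra.ι k)

@[simp]
theorem consMap_tmul (b : V) (v : T) : consMap k V (b ⊗ₜ v) = TensorAlgebra.ι k b * v := rfl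

variable (k V) in
/-- The auxiliary action of `V` on `k × (V ⊗ T(V))`. -/
def consAction : V →ₗ[k] Module.End k (k × (V ⊗[k] T)) :=
  LinearMap.mk₂ k (fun b p => ((0 : k), b ⊗ₜ[k] (algebraMap k T p.1 + consMap k V p.2)))
    (fun b b' p => by simp [TensorProduct.add_tmul]) (fun c b p => by simp [TensorProduct.smul_tmul'])
    (fun b p p' => by simp [← TensorProduct.tmul_add, add_add_add_comm])
    (fun c b p => by simp [← TensorProduct.tmul_smul, Algebra.smul_def, mul_add])

theorem consAction_apply (b : V) (p : k × (V ⊗[k] T)) :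
    consAction k V b p = ((0 : k), b ⊗ₜ[k] (algebraMap k T p.1 + consMap k V p.2)) := rfl

variable (k V) in
/-- Splitting off the first letter of an element of the tensor algebra. -/
def uncons : T →ₗ[k] V ⊗[k] T :=
  LinearMap.snd k k (V ⊗[k] T) ∘ₗ LinearMap.applyₗ ((1 : k), (0 : V ⊗[k] T)) ∘ₗ
    (TensorAlgebra.lift k (consAction k V)).toLinearMap

/-- The map `(c, s) ↦ c + consMap s` from `k × (V ⊗ T)` to the tensor algebra intertwines the
auxiliary action with left multiplication. Acting on `(1, 0)` therefore splits an element into its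
constant term and its first letter with the rest. -/
theorem lift_consAction (v : T) (p : k × (V ⊗[k] T)) :
    algebraMap k T (TensorAlgebra.lift k (consAction k V) v p).1 +
      consMap k V (TensorAlgebra.lift k (consAction k V) v p).2 =
        v * (algebraMap k T p.1 + consMap k V p.2) := by
  induction v using TensorAlgebra.induction generalizing p with
  | algebraMap r => simp [Algebra.smul_def, mul_add]
  | ι b => simp [consAction_apply]
  | mul x y hx hy => rw [map_mul, Module.End.mul_apply, hx, hy, mul_assoc]
  | add x y hx hy =>
    rw [map_add, LinearMap.add_apply, Prod.fst_add, Prod.snd_add, map_add, map_add,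
      add_add_add_comm, hx, hy, add_mul]

@[simp]
theorem uncons_cons (b : V) (v : T) : uncons k V (TensorAlgebra.ι k b * v) = b ⊗ₜ v := by
  have := lift_consAction v (1, 0)
  simp only [map_one, map_zero, add_zero, mul_one] at this
  simp [uncons, consAction_apply, this]

@[simp]
theorem uncons_consMap (s : V ⊗[k] T) : uncons k V (consMap k V s) = s := by
  induction s using TensorProduct.induction_on with
  | zero => simp
  | tmul b v => simp
  | add x y hx hy => simp [hx, hy]

variable (k V) in
/-- The operation `f ↦ id_V ⊗ f` on endomorphisms of the tensor algebra. -/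
def shiftEnd : Module.End k T →ₙ+* Module.End k T where
  toFun f := consMap k V ∘ₗ LinearMap.lTensor V f ∘ₗ uncons k V
  map_mul' f g := by
    ext1 v
    simp [Module.End.mul_eq_comp, LinearMap.lTensor_comp]
  map_zero' := by simp
  map_add' f g := by simp [LinearMap.lTensor_add, LinearMap.comp_add, LinearMap.add_comp]

local notation "σ" => shiftEnd k V

theorem shiftEnd_apply (f : Module.End k T) (v : T) :
    σ f v = consMap k V (LinearMap.lTensor V f (uncons k V v)) := rfl

@[simp]
theorem shiftEnd_cons (f : Module.End k T) (b : V) (v : T) :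
    σ f (TensorAlgebra.ι k b * v) = TensorAlgebra.ι k b * f v := by
  simp [shiftEnd_apply]

/-- The embedding of a tensor power into the tensor algebra. -/
abbrev incl (k V : Type*) [Field k] [AddCommGroup V] [Module k V] (n : ℕ) :
    (⨂[k]^n V) →ₗ[k] TensorAlgebra k V :=
  TensorPower.toTensorAlgebra

theorem incl_injective (n : ℕ) : Function.Injective (incl k V n) := by
  intro x y h
  have h1 : ∀ z : ⨂[k]^n V, TensorAlgebra.ofDirectSum (DirectSum.of (fun n => ⨂[k]^n V) n z) =
      incl k V n z := fun z => DirectSum.toAddMonoid_of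
    (fun _ => LinearMap.toAddMonoidHom TensorPower.toTensorAlgebra) _ _
  rw [← h1, ← h1] at h
  exact DirectSum.of_injective n (TensorAlgebra.equivDirectSum.symm.injective h)

theorem incl_cast {m n : ℕ} (h : m = n) (x : ⨂[k]^m V) :
    incl k V n (TensorPower.cast k V h x) = incl k V m x := by
  subst h; simp

theorem incl_mulEquiv {m n : ℕ} (x : ⨂[k]^m V) (y : ⨂[k]^n V) :
    incl k V (m + n) (TensorPower.mulEquiv (x ⊗ₜ y)) = incl k V m x * incl k V n y :=
  TensorPower.toTensorAlgebra_gMul x y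

theorem incl_oneEquiv_symm (b : V) : incl k V 1 ((oneEquiv k V).symm b) = TensorAlgebra.ι k b := by
  simp [oneEquiv]

theorem incl_splitFirst_symm (n : ℕ) (b : V) (x : ⨂[k]^n V) :
    incl k V (n + 1) ((splitFirst k V n).symm (b ⊗ₜ x)) = TensorAlgebra.ι k b * incl k V n x := by
  simp only [splitFirst, LinearEquiv.trans_symm, LinearEquiv.trans_apply, TensorPower.cast_symm,
    TensorProduct.congr_symm_tmul, LinearEquiv.symm_symm, incl_cast]
  rw [incl_mulEquiv, incl_oneEquiv_symm]
  rfl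

theorem incl_splitLast_symm (n : ℕ) (x : ⨂[k]^n V) (b : V) :
    incl k V (n + 1) ((splitLast k V n).symm (x ⊗ₜ b)) = incl k V n x * TensorAlgebra.ι k b := by
  simp only [splitLast, LinearEquiv.trans_symm, LinearEquiv.trans_apply,
    TensorProduct.congr_symm_tmul, LinearEquiv.symm_symm]
  rw [incl_mulEquiv, incl_oneEquiv_symm]
  rfl

theorem incl_twoEquiv_symm (a b : V) :
    incl k V 2 ((twoEquiv k V).symm (a ⊗ₜ b)) = TensorAlgebra.ι k a * TensorAlgebra.ι k b := by
  simp only [twoEquiv, LinearEquiv.trans_symm, LinearEquiv.trans_apply,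
    TensorProduct.congr_symm_tmul, LinearEquiv.symm_symm]
  exact (incl_mulEquiv _ _).trans (by rw [incl_oneEquiv_symm, incl_oneEquiv_symm])

variable (k V) in
/-- Splitting off the first `a` letters of an element of the tensor algebra. -/
def splitAt : (a : ℕ) → T →ₗ[k] (⨂[k]^a V) ⊗[k] T
  | 0 => TensorProduct.mk k _ _ (PiTensorProduct.tprod k Fin.elim0)
  | a + 1 => (splitFirst k V a).symm.toLinearMap.rTensor T ∘ₗ
      (TensorProduct.assoc k V (⨂[k]^a V) T).symm.toLinearMap ∘ₗ
        LinearMap.lTensor V (splitAt a) ∘ₗ uncons k V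

theorem splitAt_incl_mul (a : ℕ) (x : ⨂[k]^a V) (v : T) :
    splitAt k V a (incl k V a x * v) = x ⊗ₜ v := by
  induction a with
  | zero =>
    induction x using PiTensorProduct.induction_on with
    | smul_tprod r f =>
      obtain rfl : f = Fin.elim0 := Subsingleton.elim _ _
      simp [splitAt, TensorProduct.smul_tmul]
    | add x y hx hy => rw [map_add, add_mul, map_add, hx, hy, TensorProduct.add_tmul]
  | succ a ih =>
    obtain ⟨s, rfl⟩ := (splitFirst k V a).symm.surjective x
    induction s using TensorProduct.induction_on with
    | zero => simp
    | tmul b x => rw [incl_splitFirst_symm]; simp [splitAt, mul_assoc, ih]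
    | add x y hx hy => rw [map_add, map_add, add_mul, map_add, hx, hy, TensorProduct.add_tmul]

theorem splitAt_pow_shiftEnd (a : ℕ) (g : Module.End k T) (v : T) :
    splitAt k V a ((σ ^ a) g v) = LinearMap.lTensor _ g (splitAt k V a v) := by
  induction a generalizing v with
  | zero => simp [splitAt]
  | succ a ih =>
    rw [pow_shift_succ', shiftEnd_apply]
    simp only [splitAt, LinearMap.comp_apply, uncons_consMap]
    generalize uncons k V v = s
    induction s using TensorProduct.induction_on with
    | zero => simp
    | add x y hx hy => simp only [map_add, hx, hy]
    | tmul b v =>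
      simp only [LinearMap.lTensor_tmul, ih]
      generalize splitAt k V a v = s
      induction s using TensorProduct.induction_on with
      | zero => simp
      | add x y hx hy => simp only [map_add, TensorProduct.tmul_add, hx, hy]
      | tmul x y => simp

theorem pow_shiftEnd_incl_mul (a : ℕ) (g : Module.End k T) (x : ⨂[k]^a V) (v : T) :
    (σ ^ a) g (incl k V a x * v) = incl k V a x * g v := by
  induction a with
  | zero =>
    induction x using PiTensorProduct.induction_on with
    | smul_tprod r f =>
      obtain rfl : f = Fin.elim0 := Subsingleton.elim _ _
      simp
    | add x y hx hy => rw [map_add, add_mul, map_add, hx, hy, add_mul]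
  | succ a ih =>
    obtain ⟨s, rfl⟩ := (splitFirst k V a).symm.surjective x
    induction s using TensorProduct.induction_on with
    | zero => simp
    | tmul b x => rw [incl_splitFirst_symm, mul_assoc, pow_shift_succ', shiftEnd_cons, ih, mul_assoc]
    | add x y hx hy => rw [map_add, map_add, add_mul, map_add, hx, hy, add_mul]

/-- The operator on the tensor algebra that applies `g` to the first `a` letters. -/
def onFirst {a : ℕ} (g : (⨂[k]^a V) →ₗ[k] T) : Module.End k T :=
  TensorProduct.lift (LinearMap.mul k T ∘ₗ g) ∘ₗ splitAt k V a

theorem onFirst_apply {a : ℕ} (g : (⨂[k]^a V) →ₗ[k] T) (v : T) :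
    onFirst g v = TensorProduct.lift (LinearMap.mul k T ∘ₗ g) (splitAt k V a v) := rfl

theorem onFirst_incl_mul {a : ℕ} (g : (⨂[k]^a V) →ₗ[k] T) (x : ⨂[k]^a V) (v : T) :
    onFirst g (incl k V a x * v) = g x * v := by
  rw [onFirst_apply, splitAt_incl_mul]; rfl

theorem onFirst_incl (a : ℕ) : onFirst (incl k V a) = (σ ^ a) 1 := by
  induction a with
  | zero => ext1 v; simp [onFirst, splitAt]
  | succ a ih =>
    rw [pow_shift_succ', ← ih]
    ext1 v
    rw [onFirst_apply, shiftEnd_apply]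
    simp only [splitAt, LinearMap.comp_apply]
    generalize uncons k V v = s
    induction s using TensorProduct.induction_on with
    | zero => simp
    | add x y hx hy => simp only [map_add, hx, hy]
    | tmul b v =>
      simp only [LinearMap.lTensor_tmul, onFirst_apply, consMap_tmul]
      generalize splitAt k V a v = s
      induction s using TensorProduct.induction_on with
      | zero => simp
      | add x y hx hy => simp only [map_add, TensorProduct.tmul_add, hx, hy, mul_add]
      | tmul x y =>
        simp only [LinearEquiv.coe_coe, TensorProduct.assoc_symm_tmul, LinearMap.rTensor_tmul,
          TensorProduct.lift.tmul, LinearMap.comp_apply, LinearMap.mul_apply', incl_splitFirst_symm,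
          mul_assoc]

/-- After multiplication by `(σ ^ n) 1` only the elements with at least `n` letters matter, and
these are sums of products `incl x * v`. -/
theorem end_ext_of_incl (n : ℕ) {f g : Module.End k T}
    (h : ∀ (x : ⨂[k]^n V) (v : T), f (incl k V n x * v) = g (incl k V n x * v)) :
    f * (σ ^ n) 1 = g * (σ ^ n) 1 := by
  ext1 v
  rw [← onFirst_incl, Module.End.mul_apply, Module.End.mul_apply, onFirst_apply]
  generalize splitAt k V n v = s
  induction s using TensorProduct.induction_on with
  | zero => simp
  | add x y hx hy => simp only [map_add, hx, hy]
  | tmul x v => exact h x v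

theorem onFirst_mul_unit {a : ℕ} (g : (⨂[k]^a V) →ₗ[k] T) : onFirst g * (σ ^ a) 1 = onFirst g := by
  ext1 v
  rw [Module.End.mul_apply, onFirst_apply, splitAt_pow_shiftEnd, Module.End.one_eq_id,
    LinearMap.lTensor_id]
  rfl

/-- The operator `f ⊗ id` on the tensor algebra. -/
def tensorOp {a b : ℕ} (f : (⨂[k]^a V) →ₗ[k] (⨂[k]^b V)) : Module.End k T :=
  onFirst (incl k V b ∘ₗ f)

theorem tensorOp_incl_mul {a b : ℕ} (f : (⨂[k]^a V) →ₗ[k] (⨂[k]^b V)) (x : ⨂[k]^a V) (v : T) :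
    tensorOp f (incl k V a x * v) = incl k V b (f x) * v := onFirst_incl_mul _ _ _

theorem tensorOp_incl {a b : ℕ} (f : (⨂[k]^a V) →ₗ[k] (⨂[k]^b V)) (x : ⨂[k]^a V) :
    tensorOp f (incl k V a x) = incl k V b (f x) := by
  simpa using tensorOp_incl_mul f x 1

theorem hasType_tensorOp {a b : ℕ} (f : (⨂[k]^a V) →ₗ[k] (⨂[k]^b V)) :
    HasType σ a b (tensorOp f) := by
  refine ⟨onFirst_mul_unit _, fun g => ?_⟩
  ext1 v
  rw [Module.End.mul_apply, Module.End.mul_apply, tensorOp, onFirst_apply, onFirst_apply,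
    splitAt_pow_shiftEnd]
  generalize splitAt k V a v = s
  induction s using TensorProduct.induction_on with
  | zero => simp
  | add x y hx hy => simp only [map_add, hx, hy]
  | tmul x v => exact (pow_shiftEnd_incl_mul b g (f x) v).symm

theorem eq_tensorOp_of_forall {a b : ℕ} {f : (⨂[k]^a V) →ₗ[k] (⨂[k]^b V)} {X : Module.End k T}
    (hX : X * (σ ^ a) 1 = X) (h : ∀ x v, X (incl k V a x * v) = incl k V b (f x) * v) :
    tensorOp f = X := by
  rw [← hX, ← (hasType_tensorOp f).1]
  exact end_ext_of_incl a fun x v => by rw [tensorOp_incl_mul, h]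

theorem tensorOp_injective {a b : ℕ} :
    Function.Injective (tensorOp (k := k) (V := V) (a := a) (b := b)) := by
  intro f g h
  refine LinearMap.ext fun x => incl_injective b ?_
  rw [← tensorOp_incl, h, tensorOp_incl]

theorem tensorOp_comp {a b c : ℕ} (g : (⨂[k]^b V) →ₗ[k] (⨂[k]^c V))
    (f : (⨂[k]^a V) →ₗ[k] (⨂[k]^b V)) : tensorOp (g ∘ₗ f) = tensorOp g * tensorOp f := by
  refine eq_tensorOp_of_forall ((hasType_tensorOp f).comp (hasType_tensorOp g)).1 fun x v => ?_
  rw [Module.End.mul_apply, tensorOp_incl_mul, tensorOp_incl_mul]; rfl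

theorem tensorOp_id (a : ℕ) : tensorOp (LinearMap.id (M := ⨂[k]^a V)) = (σ ^ a) 1 := onFirst_incl a

theorem exists_incl_eq_mul {p q N : ℕ} (h : N = p + q) {C : T → Prop} (h0 : C 0)
    (hadd : ∀ x y, C x → C y → C (x + y))
    (hmul : ∀ (x : ⨂[k]^p V) (y : ⨂[k]^q V), C (incl k V p x * incl k V q y)) (z : ⨂[k]^N V) :
    C (incl k V N z) := by
  subst h
  obtain ⟨s, rfl⟩ := TensorPower.mulEquiv.surjective z
  induction s using TensorProduct.induction_on with
  | zero => simpa using h0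
  | add x y hx hy => simpa using hadd _ _ hx hy
  | tmul x y => rw [incl_mulEquiv]; exact hmul x y

theorem incl_tmap {a b c d : ℕ} (f : (⨂[k]^a V) →ₗ[k] (⨂[k]^b V))
    (g : (⨂[k]^c V) →ₗ[k] (⨂[k]^d V)) (x : ⨂[k]^a V) (y : ⨂[k]^c V) :
    incl k V (b + d) (tmap f g (TensorPower.mulEquiv (x ⊗ₜ y))) =
      incl k V b (f x) * incl k V d (g y) := by
  simp [tmap, incl_mulEquiv]

theorem tensorOp_tmap_left {a b : ℕ} (p : ℕ) (f : (⨂[k]^a V) →ₗ[k] (⨂[k]^b V)) :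
    tensorOp (tmap (LinearMap.id (M := ⨂[k]^p V)) f) = (σ ^ p) (tensorOp f) := by
  refine eq_tensorOp_of_forall ((hasType_tensorOp f).pow_shift p).1 fun z v => ?_
  obtain ⟨s, rfl⟩ := TensorPower.mulEquiv.surjective z
  induction s using TensorProduct.induction_on with
  | zero => simp
  | add x y hx hy => simp only [map_add, add_mul, hx, hy]
  | tmul x y =>
    rw [incl_tmap, incl_mulEquiv, mul_assoc, pow_shiftEnd_incl_mul, tensorOp_incl_mul,
      LinearMap.id_apply, mul_assoc]

theorem tensorOp_tmap_right {a b : ℕ} (q : ℕ) (f : (⨂[k]^a V) →ₗ[k] (⨂[k]^b V)) :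
    tensorOp (tmap f (LinearMap.id (M := ⨂[k]^q V))) = tensorOp f * (σ ^ (a + q)) 1 := by
  refine eq_tensorOp_of_forall ((hasType_tensorOp f).extend q).1 fun z v => ?_
  have : (σ ^ (a + q)) 1 (incl k V (a + q) z * v) = incl k V (a + q) z * v := by
    rw [pow_shiftEnd_incl_mul]; rfl
  rw [Module.End.mul_apply, this]
  clear this
  obtain ⟨s, rfl⟩ := TensorPower.mulEquiv.surjective z
  induction s using TensorProduct.induction_on with
  | zero => simp
  | add x y hx hy => simp only [map_add, add_mul, hx, hy]
  | tmul x y =>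
    rw [incl_tmap, incl_mulEquiv, mul_assoc, tensorOp_incl_mul, LinearMap.id_apply, mul_assoc]

theorem tensorOp_cast {m n : ℕ} (h : m = n) :
    tensorOp (TensorPower.cast k V h).toLinearMap = (σ ^ m) 1 := by
  subst h; rw [← tensorOp_id]; simp

/-- In the shift ring, identity factors on the left become a power of `σ`, and those on the right
only a unit; the casts between tensor powers disappear. -/
theorem tensorOp_inMiddle {a b N M : ℕ} (p q : ℕ) (f : (⨂[k]^a V) →ₗ[k] (⨂[k]^b V))
    (hN : N = p + a + q) (hM : p + b + q = M) :
    tensorOp (inMiddle p q f hN hM) = (σ ^ p) (tensorOp f) * (σ ^ N) 1 := by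
  rw [inMiddle, tensorOp_comp, tensorOp_comp, tensorOp_cast, tensorOp_cast, tensorOp_tmap_right,
    tensorOp_tmap_left, ← hN]
  have h := ((hasType_tensorOp f).pow_shift p).mul_unit q
  rw [← hN] at h
  rw [mul_assoc ((σ ^ p) _), unit_mul_unit le_rfl, h, ← mul_assoc, unit_mul_unit le_rfl]

end TensorAlgebraOperators

end

theorem IsShiftOperation.zero {E : Type*} [Ring E] {σ : E →ₙ+* E} {t : E} (n : ℕ) :
    IsShiftOperation σ t n 0 := ⟨⟨by simp, by simp⟩, by simp, by simp⟩

theorem IsShiftOperation.sub {E : Type*} [Ring E] {σ : E →ₙ+* E} {t : E} {n : ℕ} {F G : E}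
    (hF : IsShiftOperation σ t n F) (hG : IsShiftOperation σ t n G) :
    IsShiftOperation σ t n (F - G) := by
  rw [sub_eq_add_neg]; exact hF.add hG.neg

theorem IsShiftOperation.sum {E ι : Type*} [Ring E] {σ : E →ₙ+* E} {t : E} {n : ℕ} {s : Finset ι}
    {F : ι → E} (hF : ∀ i ∈ s, IsShiftOperation σ t n (F i)) :
    IsShiftOperation σ t n (∑ i ∈ s, F i) :=
  Finset.sum_induction _ _ (fun _ _ h h' => h.add h') (IsShiftOperation.zero n) hF

noncomputable section

/-! ### The braiding and braided operations inside the tensor algebra -/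

section Braiding

variable {k : Type*} [Field k] {V : Type*} [AddCommGroup V] [Module k V]

local notation "T" => TensorAlgebra k V

local notation "σ" => shiftEnd k V

variable (k V) in
/-- The operator `F ⊗ id` on the tensor algebra for an operation `F`. -/
def opEnd (a : ℕ) : ((⨂[k]^a V) →ₗ[k] V) →ₗ[k] Module.End k T where
  toFun F := tensorOp ((oneEquiv k V).symm.toLinearMap ∘ₗ F)
  map_add' F G := by
    refine eq_tensorOp_of_forall ((hasType_tensorOp _).add (hasType_tensorOp _)).1 fun x v => ?_
    simp [tensorOp_incl_mul, add_mul]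
  map_smul' c F := by
    refine eq_tensorOp_of_forall ?_ fun x v => ?_
    · rw [RingHom.id_apply, smul_mul_assoc, (hasType_tensorOp _).1]
    · simp [tensorOp_incl_mul]

theorem opEnd_incl_mul {a : ℕ} (F : (⨂[k]^a V) →ₗ[k] V) (x : ⨂[k]^a V) (v : T) :
    opEnd k V a F (incl k V a x * v) = TensorAlgebra.ι k (F x) * v := by
  rw [← incl_oneEquiv_symm]; exact tensorOp_incl_mul _ _ _

theorem hasType_opEnd {a : ℕ} (F : (⨂[k]^a V) →ₗ[k] V) : HasType σ a 1 (opEnd k V a F) :=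
  hasType_tensorOp _

theorem opEnd_injective (a : ℕ) : Function.Injective (opEnd k V a) := by
  intro F G h
  have := tensorOp_injective h
  ext1
  refine MultilinearMap.ext fun x => ?_
  simpa using LinearMap.congr_fun this (PiTensorProduct.tprod k x)

theorem opEnd_comp {a b : ℕ} (F : (⨂[k]^b V) →ₗ[k] V) (f : (⨂[k]^a V) →ₗ[k] (⨂[k]^b V)) :
    opEnd k V a (F ∘ₗ f) = opEnd k V b F * tensorOp f :=
  tensorOp_comp ((oneEquiv k V).symm.toLinearMap ∘ₗ F) f

theorem eq_opEnd_of_forall {a : ℕ} {F : (⨂[k]^a V) →ₗ[k] V} {X : Module.End k T}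
    (hX : X * (σ ^ a) 1 = X)
    (h : ∀ x v, X (incl k V a x * v) = TensorAlgebra.ι k (F x) * v) : opEnd k V a F = X :=
  eq_tensorOp_of_forall hX fun x v => by rw [h, ← incl_oneEquiv_symm]; rfl

theorem tensorOp_opInMiddle {a N M : ℕ} (p q : ℕ) (F : (⨂[k]^a V) →ₗ[k] V)
    (hN : N = p + a + q) (hM : p + 1 + q = M) :
    tensorOp (opInMiddle p q F hN hM) = (σ ^ p) (opEnd k V a F) * (σ ^ N) 1 :=
  tensorOp_inMiddle ..

/-- The braiding as an endomorphism of the tensor algebra. -/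
def braidingEnd (τ : V ⊗[k] V →ₗ[k] V ⊗[k] V) : Module.End k T :=
  tensorOp ((twoEquiv k V).symm.toLinearMap ∘ₗ τ ∘ₗ (twoEquiv k V).toLinearMap)

variable (k V) in
/-- The embedding `V ⊗ V → T(V)`. -/
def inclTwo : V ⊗[k] V →ₗ[k] T := incl k V 2 ∘ₗ (twoEquiv k V).symm.toLinearMap

theorem inclTwo_injective : Function.Injective (inclTwo k V) :=
  (incl_injective 2).comp (twoEquiv k V).symm.injective

@[simp]
theorem inclTwo_tmul (a b : V) :
    inclTwo k V (a ⊗ₜ b) = TensorAlgebra.ι k a * TensorAlgebra.ι k b := incl_twoEquiv_symm a b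

theorem incl_two_eq (x : ⨂[k]^2 V) : incl k V 2 x = inclTwo k V (twoEquiv k V x) := by
  simp [inclTwo]

theorem incl_one_eq (x : ⨂[k]^1 V) : incl k V 1 x = TensorAlgebra.ι k (oneEquiv k V x) := by
  rw [← incl_oneEquiv_symm, LinearEquiv.symm_apply_apply]

theorem opEnd_two_inclTwo_mul (f : V ⊗[k] V →ₗ[k] V) (s : V ⊗[k] V) (v : T) :
    opEnd k V 2 (f ∘ₗ (twoEquiv k V).toLinearMap) (inclTwo k V s * v) =
      TensorAlgebra.ι k (f s) * v := by
  rw [inclTwo, LinearMap.comp_apply, LinearEquiv.coe_coe, opEnd_incl_mul]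
  simp

theorem braidingEnd_inclTwo_mul (τ : V ⊗[k] V →ₗ[k] V ⊗[k] V) (s : V ⊗[k] V) (v : T) :
    braidingEnd τ (inclTwo k V s * v) = inclTwo k V (τ s) * v := by
  rw [inclTwo, LinearMap.comp_apply, LinearEquiv.coe_coe, braidingEnd, tensorOp_incl_mul]
  simp

variable (k V) in
/-- The embedding `V ⊗ V ⊗ V → T(V)`. -/
def inclThree : (V ⊗[k] V) ⊗[k] V →ₗ[k] T :=
  LinearMap.mul' k T ∘ₗ TensorProduct.map (inclTwo k V) (TensorAlgebra.ι k)

@[simp]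
theorem inclThree_tmul (s : V ⊗[k] V) (c : V) :
    inclThree k V (s ⊗ₜ c) = inclTwo k V s * TensorAlgebra.ι k c := rfl

theorem inclThree_assoc_symm (a : V) (s : V ⊗[k] V) :
    inclThree k V ((TensorProduct.assoc k V V V).symm (a ⊗ₜ s)) =
      TensorAlgebra.ι k a * inclTwo k V s := by
  induction s using TensorProduct.induction_on with
  | zero => simp
  | tmul b c => simp [mul_assoc]
  | add x y hx hy => simp only [TensorProduct.tmul_add, map_add, hx, hy, mul_add]

theorem exists_incl_three (x : ⨂[k]^3 V) : ∃ u, incl k V 3 x = inclThree k V u := by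
  refine exists_incl_eq_mul (p := 2) (q := 1) rfl (C := fun z => ∃ u, z = inclThree k V u)
    ⟨0, by simp⟩ ?_ ?_ x
  · rintro _ _ ⟨u, rfl⟩ ⟨v, rfl⟩
    exact ⟨u + v, by simp⟩
  · intro x y
    exact ⟨twoEquiv k V x ⊗ₜ oneEquiv k V y, by rw [inclThree_tmul, incl_two_eq, incl_one_eq]⟩

theorem end_ext_of_inclThree {f g : Module.End k T}
    (h : ∀ u v, f (inclThree k V u * v) = g (inclThree k V u * v)) :
    f * (σ ^ 3) 1 = g * (σ ^ 3) 1 := by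
  refine end_ext_of_incl 3 fun x v => ?_
  obtain ⟨u, hu⟩ := exists_incl_three x
  rw [hu, h]

variable (τ : V ⊗[k] V →ₗ[k] V ⊗[k] V)

theorem braidingEnd_inclThree_mul (u : (V ⊗[k] V) ⊗[k] V) (v : T) :
    braidingEnd τ (inclThree k V u * v) = inclThree k V (tau12 τ u) * v := by
  induction u using TensorProduct.induction_on with
  | zero => simp
  | tmul s c => simp [tau12, mul_assoc, braidingEnd_inclTwo_mul]
  | add x y hx hy => simp only [map_add, hx, hy, add_mul]

theorem shiftEnd_inclThree_mul {f : Module.End k T} {θ : V ⊗[k] V →ₗ[k] T}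
    (hf : ∀ s v, f (inclTwo k V s * v) = θ s * v) (u : (V ⊗[k] V) ⊗[k] V) (v : T) :
    σ f (inclThree k V u * v) =
      consMap k V (θ.lTensor V (TensorProduct.assoc k V V V u)) * v := by
  obtain ⟨s, rfl⟩ := (TensorProduct.assoc k V V V).symm.surjective u
  induction s using TensorProduct.induction_on with
  | zero => simp
  | tmul a s => simp [inclThree_assoc_symm, mul_assoc, hf]
  | add x y hx hy => simp only [map_add, hx, hy, add_mul]

theorem shiftEnd_braidingEnd_inclThree_mul (u : (V ⊗[k] V) ⊗[k] V) (v : T) :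
    σ (braidingEnd τ) (inclThree k V u * v) = inclThree k V (tau23 τ u) * v := by
  rw [shiftEnd_inclThree_mul (θ := inclTwo k V ∘ₗ τ) (braidingEnd_inclTwo_mul τ)]
  congr 1
  simp only [tau23, LinearMap.comp_apply, LinearEquiv.coe_coe]
  generalize TensorProduct.assoc k V V V u = s
  induction s using TensorProduct.induction_on with
  | zero => simp
  | tmul a s => simp [inclThree_assoc_symm]
  | add x y hx hy => simp only [map_add, hx, hy]

variable {τ}

theorem isShiftBraiding_braidingEnd (hb : IsBraiding τ) (hi : IsInvolutive τ) :
    IsShiftBraiding σ (braidingEnd τ) := by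
  have ht : HasType σ 2 2 (braidingEnd τ) := hasType_tensorOp _
  have hu := ht.mul_unit 1
  have hs : σ (braidingEnd τ) * (σ ^ 3) 1 = σ (braidingEnd τ) := by
    rw [pow_shift_succ' σ 2, ← map_mul, ht.1]
  refine ⟨ht, ?_, ?_⟩
  · rw [braidingEnd, ← tensorOp_comp, ← tensorOp_id]
    congr 1
    refine LinearMap.ext fun x => ?_
    simp only [LinearMap.comp_apply, LinearEquiv.coe_coe, LinearEquiv.apply_symm_apply]
    rw [← LinearMap.comp_apply τ τ, hi]
    simp
  -- The comparison on three letters gives the braid relation only up to `(σ ^ 3) 1`; both sides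
  -- absorb this unit.
  · have h := end_ext_of_inclThree
      (f := braidingEnd τ * σ (braidingEnd τ) * braidingEnd τ)
      (g := σ (braidingEnd τ) * braidingEnd τ * σ (braidingEnd τ)) fun u v => by
        simp only [Module.End.mul_apply, braidingEnd_inclThree_mul,
          shiftEnd_braidingEnd_inclThree_mul]
        congr 2
        exact LinearMap.congr_fun hb u
    have hu' : braidingEnd τ * σ (braidingEnd τ) * braidingEnd τ * (σ ^ 3) 1 =
        braidingEnd τ * σ (braidingEnd τ) * braidingEnd τ := by
      rw [mul_assoc _ (braidingEnd τ), hu, ← mul_assoc, mul_assoc (braidingEnd τ), hs]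
    rwa [hu', mul_assoc (σ (braidingEnd τ) * braidingEnd τ), hs] at h

theorem tensorOp_tauAt {n i : ℕ} (h : 1 ≤ i ∧ i < n) :
    tensorOp (tauAt τ n i) = gen σ (braidingEnd τ) (i - 1) * (σ ^ n) 1 := by
  rw [tauAt, dif_pos h, tensorOp_inMiddle]
  rfl

theorem tensorOp_act (ht : IsShiftBraiding σ (braidingEnd τ)) {n : ℕ} {w : List ℕ}
    (hw : ∀ i ∈ w, 1 ≤ i ∧ i < n) :
    tensorOp (act τ n w) = wordOp σ (braidingEnd τ) w * (σ ^ n) 1 := by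
  induction w with
  | nil => rw [act, tensorOp_id, wordOp, one_mul]
  | cons i w ih =>
    have hi := hw i (by simp)
    rw [act, tensorOp_comp, ih fun j hj => hw j (by simp [hj]), tensorOp_tauAt hi, wordOp,
      ht.gen_mul_unit (by omega), mul_assoc, ← mul_assoc ((σ ^ n) 1), unit_mul_unit le_rfl,
      ← ht.gen_mul_unit (by omega), mul_assoc]

theorem opEnd_incl_succ {m : ℕ} (F : (⨂[k]^m V) →ₗ[k] V) (x : ⨂[k]^(m + 1) V) :
    opEnd k V m F (incl k V (m + 1) x) = inclTwo k V (F.rTensor V (splitLast k V m x)) := by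
  obtain ⟨s, rfl⟩ := (splitLast k V m).symm.surjective x
  rw [LinearEquiv.apply_symm_apply]
  induction s using TensorProduct.induction_on with
  | zero => simp
  | tmul y b => rw [incl_splitLast_symm, opEnd_incl_mul]; simp
  | add x y hx hy => simp only [map_add, hx, hy]

theorem shiftEnd_opEnd_incl_succ {m : ℕ} (F : (⨂[k]^m V) →ₗ[k] V) (x : ⨂[k]^(m + 1) V) :
    σ (opEnd k V m F) (incl k V (m + 1) x) = inclTwo k V (F.lTensor V (splitFirst k V m x)) := by
  obtain ⟨s, rfl⟩ := (splitFirst k V m).symm.surjective x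
  rw [LinearEquiv.apply_symm_apply]
  induction s using TensorProduct.induction_on with
  | zero => simp
  | tmul b y =>
    have := opEnd_incl_mul F y 1
    rw [mul_one, mul_one] at this
    rw [incl_splitFirst_symm, shiftEnd_cons, this]
    simp
  | add x y hx hy => simp only [map_add, hx, hy]

theorem mem_seg {i m l : ℕ} (h : i ∈ seg m l) : m ≤ i ∧ i < l := by
  simp only [seg, List.mem_reverse, List.mem_range'_1] at h
  omega

/-- Evaluating the two operator axioms on elements of degree `m + 1` gives the tensor identities,
because `V ⊗ V` embeds in the tensor algebra. -/
theorem isBraidedOperation_of_isShiftOperation (ht : IsShiftBraiding σ (braidingEnd τ)) {m : ℕ}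
    {F : (⨂[k]^m V) →ₗ[k] V} (hF : IsShiftOperation σ (braidingEnd τ) m (opEnd k V m F)) :
    IsBraidedOperation τ m F := by
  have hbr : ∀ s, inclTwo k V (τ s) = braidingEnd τ (inclTwo k V s) := fun s => by
    simpa using (braidingEnd_inclTwo_mul τ s 1).symm
  have hact : ∀ w : List ℕ, (∀ i ∈ w, 1 ≤ i ∧ i < m + 1) → ∀ x,
      incl k V (m + 1) (act τ (m + 1) w x) =
      wordOp σ (braidingEnd τ) w (incl k V (m + 1) x) := by
    intro w hw x
    have h1 : (σ ^ (m + 1)) 1 (incl k V (m + 1) x) = incl k V (m + 1) x := by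
      simpa using pow_shiftEnd_incl_mul (m + 1) 1 x 1
    rw [← tensorOp_incl, tensorOp_act ht hw, Module.End.mul_apply, h1]
  constructor
  · refine LinearMap.ext fun x => inclTwo_injective ?_
    simp only [LinearMap.comp_apply, LinearEquiv.coe_coe]
    rw [hbr, ← opEnd_incl_succ, ← shiftEnd_opEnd_incl_succ, hact _ (fun i hi => mem_seg hi),
      wordOp_seg_one ht]
    exact LinearMap.congr_fun hF.moveLeft _
  · refine LinearMap.ext fun x => inclTwo_injective ?_
    simp only [LinearMap.comp_apply, LinearEquiv.coe_coe]
    rw [hbr, ← shiftEnd_opEnd_incl_succ, ← opEnd_incl_succ, hact, wordOp_segRev_one]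
    · exact LinearMap.congr_fun hF.moveRight _
    · intro i hi
      simp only [segRev, List.mem_range'_1] at hi
      omega

theorem shiftEnd_smul (c : k) (f : Module.End k (TensorAlgebra k V)) : σ (c • f) = c • σ f := by
  ext1 v
  simp [shiftEnd_apply, LinearMap.lTensor_smul]

theorem IsShiftOperation.smul {t : Module.End k (TensorAlgebra k V)} {n : ℕ}
    {F : Module.End k (TensorAlgebra k V)} (c : k) (hF : IsShiftOperation σ t n F) :
    IsShiftOperation σ t n (c • F) := by
  refine ⟨⟨?_, fun g => ?_⟩, ?_, ?_⟩
  · rw [smul_mul_assoc, hF.hasType.1]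
  · rw [smul_mul_assoc, hF.hasType.2, mul_smul_comm]
  · rw [shiftEnd_smul, mul_smul_comm, hF.moveLeft, smul_mul_assoc]
  · rw [shiftEnd_smul, mul_smul_comm, hF.moveRight, smul_mul_assoc]

theorem consMap_lTensor (f : V ⊗[k] V →ₗ[k] V) (s : V ⊗[k] (V ⊗[k] V)) :
    consMap k V ((TensorAlgebra.ι k ∘ₗ f).lTensor V s) = inclTwo k V (f.lTensor V s) := by
  induction s using TensorProduct.induction_on with
  | zero => simp
  | tmul b s => simp
  | add x y hx hy => simp only [map_add, hx, hy]

theorem opEnd_comp_act (ht : IsShiftBraiding σ (braidingEnd τ)) {n : ℕ} {w : List ℕ}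
    (hw : ∀ i ∈ w, 1 ≤ i ∧ i < n) (F : (⨂[k]^n V) →ₗ[k] V) :
    opEnd k V n (F ∘ₗ act τ n w) = opEnd k V n F * wordOp σ (braidingEnd τ) w := by
  rw [opEnd_comp, tensorOp_act ht hw, wordOp_mul_unit ht hw, ← mul_assoc, (hasType_opEnd F).1]

theorem opEnd_comp_tauAt (ht : IsShiftBraiding σ (braidingEnd τ)) {n i : ℕ} (hi : 1 ≤ i ∧ i < n)
    (F : (⨂[k]^n V) →ₗ[k] V) :
    opEnd k V n (F ∘ₗ tauAt τ n i) = opEnd k V n F * gen σ (braidingEnd τ) (i - 1) := by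
  rw [opEnd_comp, tensorOp_tauAt hi, ht.gen_mul_unit (by omega), ← mul_assoc, (hasType_opEnd F).1]

end Braiding

end

/-! ### Invariance of double symmetrizations -/

section SymmetricSums

variable {E : Type*} [Ring E] {σ : E →ₙ+* E} {t : E}

theorem mem_shift {p n i : ℕ} {w : List ℕ} (hw : ∀ i ∈ w, 1 ≤ i ∧ i < n) (hi : i ∈ shift p w) :
    p + 1 ≤ i ∧ i < p + n := by
  obtain ⟨j, hj, rfl⟩ := List.mem_map.1 hi
  have := hw j hj
  omega

/-- The double sum factors into symmetrizers of the two blocks. For `r < m` the generator is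
absorbed by the first; for `r > m` it commutes past the first and is absorbed by the second. -/
theorem sum_wordOp_mul_gen (ht : IsShiftBraiding σ t) {m n r : ℕ} (hr : 1 ≤ r) (hrn : r < m + n)
    (hrm : r ≠ m) :
    (∑ π : Equiv.Perm (Fin m), ∑ ρ : Equiv.Perm (Fin n),
        wordOp σ t (permWord π ++ shift m (permWord ρ))) * gen σ t (r - 1) * (σ ^ (m + n)) 1 =
      (∑ π : Equiv.Perm (Fin m), ∑ ρ : Equiv.Perm (Fin n),
        wordOp σ t (permWord π ++ shift m (permWord ρ))) * (σ ^ (m + n)) 1 := by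
  have hI : (σ ^ (m + n)) (1 : E) = (σ ^ m) 1 * (σ ^ (m + n)) 1 :=
    (unit_mul_unit (Nat.le_add_right m n)).symm
  have hsum : (∑ π : Equiv.Perm (Fin m), ∑ ρ : Equiv.Perm (Fin n),
      wordOp σ t (permWord π ++ shift m (permWord ρ))) =
      (∑ ρ : Equiv.Perm (Fin n), wordOp σ t (shift m (permWord ρ))) *
        ∑ π : Equiv.Perm (Fin m), wordOp σ t (permWord π) := by
    rw [Finset.sum_mul_sum, Finset.sum_comm]
    simp only [wordOp_append]
  rw [hsum]
  rcases Nat.lt_or_ge r m with h | h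
  · have h1 := sum_wordOp_permWord_mul_gen ht hr h
    rw [← Finset.sum_mul, ← Finset.sum_mul, ← Finset.sum_mul] at h1
    rw [hI]
    simp only [mul_assoc] at h1 ⊢
    rw [← mul_assoc (gen σ t _) ((σ ^ m) 1), ← mul_assoc _ (gen σ t _ * _), h1, mul_assoc]
  · obtain ⟨q, rfl⟩ := Nat.exists_eq_add_of_le h
    have h1 := sum_wordOp_permWord_mul_gen ht (r := q) (n := n) (by omega) (by omega)
    have hB : (∑ π : Equiv.Perm (Fin m), wordOp σ t (permWord π)) * gen σ t (m + q - 1) =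
        gen σ t (m + q - 1) * ∑ π : Equiv.Perm (Fin m), wordOp σ t (permWord π) := by
      rw [Finset.sum_mul, Finset.mul_sum]
      exact Finset.sum_congr rfl fun π _ => wordOp_mul_gen ht (permWord_mem π) (by omega)
    have hBI : (∑ π : Equiv.Perm (Fin m), wordOp σ t (permWord π)) * (σ ^ (m + n)) 1 =
        (σ ^ (m + n)) 1 * ∑ π : Equiv.Perm (Fin m), wordOp σ t (permWord π) := by
      rw [Finset.sum_mul, Finset.mul_sum]
      refine Finset.sum_congr rfl fun π _ => wordOp_mul_unit ht fun i hi => ?_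
      have := permWord_mem π i hi
      omega
    have hA : (∑ ρ : Equiv.Perm (Fin n), wordOp σ t (shift m (permWord ρ))) *
        (gen σ t (m + q - 1) * (σ ^ (m + n)) 1) =
        (∑ ρ : Equiv.Perm (Fin n), wordOp σ t (shift m (permWord ρ))) * (σ ^ (m + n)) 1 := by
      have e1 : gen σ t (m + q - 1) * (σ ^ (m + n)) 1 = (σ ^ m) (gen σ t (q - 1) * (σ ^ n) 1) := by
        rw [map_mul, ← gen_add, ← pow_shift_add, Nat.add_sub_assoc (by omega)]
      have e2 : ∀ Y : E, (∑ ρ : Equiv.Perm (Fin n), wordOp σ t (shift m (permWord ρ))) *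
          (σ ^ m) Y = (σ ^ m) (∑ ρ : Equiv.Perm (Fin n), wordOp σ t (permWord ρ) * Y) := by
        intro Y
        rw [Finset.sum_mul, map_sum]
        refine Finset.sum_congr rfl fun ρ _ => ?_
        rw [wordOp_shift_mul m (fun i hi => (permWord_mem ρ i hi).1) (unit_mul_pow_shift m Y),
          map_mul]
      rw [e1, e2, pow_shift_add σ m n, e2, ← h1]
      simp only [mul_assoc]
    rw [mul_assoc _ _ (gen σ t _), hB, ← mul_assoc, mul_assoc, hBI, ← mul_assoc,
      mul_assoc _ (gen σ t _), hA, mul_assoc, ← hBI, ← mul_assoc]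

theorem mul_eq_neg_of_eq {S P g u : E} (hS : S = -P + P * g) (hg : g * g = u) (hP : P * u = P) :
    S * g = -S := by
  rw [hS, add_mul, mul_assoc, hg, hP]
  simp [add_comm]

theorem sub_mul_add_eq_zero {S P g a w : E} (hS : S = -P + P * g) (hc : w * g = g * w) :
    a * P * w - a * P * w * g + a * S * w = 0 := by
  rw [hS, mul_assoc _ w, hc]
  noncomm_ring

theorem mul_unit_add_eq {X u g h : E} (hg : g * u = u * g) (hh : h * u = u * h) :
    X * u + X * u * g + X * u * h = X * (1 + g + h) * u := by
  simp only [mul_add, add_mul, mul_one, mul_assoc, hg, hh]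

theorem smul_mul_eq_self {R : Type*} [SMul R E] [IsScalarTower R E E] {X Q A g u : E} (c : R)
    (hX : X = c • (Q * A)) (hu : X * u = X) (hg : g * u = u * g) (hA : A * g * u = A * u) :
    X * g = X := by
  rw [← hu, mul_assoc, ← hg, ← mul_assoc, hX, smul_mul_assoc, smul_mul_assoc, smul_mul_assoc,
    mul_assoc, mul_assoc, ← mul_assoc A, hA, mul_assoc]

end SymmetricSums

noncomputable section

/-! ### The multiplication and the Shestakov–Umirbaev operations as operators -/

section Multiplication

variable {k : Type*} [Field k] {B : Type*} [NonUnitalNonAssocRing B] [Module k B]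
  [IsScalarTower k B B] [SMulCommClass k B B]

local notation "σ" => shiftEnd k B

variable (k B) in
/-- The multiplication as an endomorphism of the tensor algebra. -/
def mulEnd : Module.End k (TensorAlgebra k B) :=
  opEnd k B 2 (LinearMap.mul' k B ∘ₗ (twoEquiv k B).toLinearMap)

local notation "μ" => mulEnd k B

theorem hasType_mulEnd : HasType σ 2 1 μ := hasType_opEnd _

theorem mulEnd_inclTwo_mul (s : B ⊗[k] B) (v : TensorAlgebra k B) :
    μ (inclTwo k B s * v) = TensorAlgebra.ι k (LinearMap.mul' k B s) * v :=
  opEnd_two_inclTwo_mul _ s v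

theorem mulEnd_inclThree_mul (u : (B ⊗[k] B) ⊗[k] B) (v : TensorAlgebra k B) :
    μ (inclThree k B u * v) = inclTwo k B ((LinearMap.mul' k B).rTensor B u) * v := by
  induction u using TensorProduct.induction_on with
  | zero => simp
  | tmul s c => simp [mul_assoc, mulEnd_inclTwo_mul]
  | add x y hx hy => simp only [map_add, hx, hy, add_mul]

variable {τ : B ⊗[k] B →ₗ[k] B ⊗[k] B}

theorem braidingEnd_mul_mulEnd (hB : IsBraidedAlgebra τ) (ht : IsShiftBraiding σ (braidingEnd τ)) :
    braidingEnd τ * μ = σ μ * braidingEnd τ * σ (braidingEnd τ) := by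
  have h := end_ext_of_inclThree (f := braidingEnd τ * μ)
    (g := σ μ * braidingEnd τ * σ (braidingEnd τ)) fun u v => by
      simp only [Module.End.mul_apply, mulEnd_inclThree_mul, braidingEnd_inclTwo_mul,
        shiftEnd_braidingEnd_inclThree_mul, braidingEnd_inclThree_mul]
      rw [shiftEnd_inclThree_mul (θ := TensorAlgebra.ι k ∘ₗ LinearMap.mul' k B)
        mulEnd_inclTwo_mul, consMap_lTensor]
      congr 2
      exact LinearMap.congr_fun hB.mul_left u
  have h1 : σ (braidingEnd τ) * (σ ^ 3) 1 = σ (braidingEnd τ) := by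
    rw [pow_shift_succ' σ 2, ← map_mul, ht.hasType.1]
  have h2 : μ * (σ ^ 3) 1 = (σ ^ 2) 1 * μ := hasType_mulEnd.mul_unit 1
  rwa [mul_assoc, h2, ← mul_assoc, ht.hasType.1, mul_assoc _ (σ (braidingEnd τ)), h1] at h

theorem opEnd_opMul {a b N : ℕ} (hN : N = a + b) (F : (⨂[k]^a B) →ₗ[k] B)
    (G : (⨂[k]^b B) →ₗ[k] B) :
    opEnd k B N (opMul hN F G) = μ * opEnd k B a F * (σ ^ a) (opEnd k B b G) := by
  subst hN
  refine eq_opEnd_of_forall ?_ fun z v => ?_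
  · rw [pow_shift_add, mul_assoc, ← map_mul, (hasType_opEnd G).1]
  · obtain ⟨s, rfl⟩ := TensorPower.mulEquiv.surjective z
    induction s using TensorProduct.induction_on with
    | zero => simp
    | add x y hx hy => simp only [map_add, add_mul, hx, hy]
    | tmul x y =>
      have h := mulEnd_inclTwo_mul (F x ⊗ₜ[k] G y) v
      rw [inclTwo_tmul, mul_assoc] at h
      rw [incl_mulEquiv, mul_assoc (incl k B a x), Module.End.mul_apply, Module.End.mul_apply,
        pow_shiftEnd_incl_mul, opEnd_incl_mul, opEnd_incl_mul, h]
      simp [opMul]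

omit [IsScalarTower k B B] [SMulCommClass k B B] in
theorem opEnd_idOp : opEnd k B 1 (idOp k B) = σ 1 := by
  rw [← pow_shift_one σ]
  refine eq_opEnd_of_forall (hasType_unit 1).1 fun x v => ?_
  rw [pow_shiftEnd_incl_mul, incl_one_eq]
  rfl

/-- The unit is needed only for `n = 0`, where the power of the multiplication is `1` but the
product of one argument is `σ 1`. -/
theorem mulEnd_pow_mul_unit (n : ℕ) :
    μ ^ n * (σ ^ (n + 1)) 1 = opEnd k B (n + 1) (rightNormed k B (n + 1)) := by
  induction n with
  | zero => rw [pow_zero, one_mul, rightNormed, opEnd_idOp, pow_shift_one]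
  | succ n ih =>
    rw [rightNormed, opEnd_opMul, ← ih, opEnd_idOp, ← pow_shift_succ, pow_succ', mul_assoc, mul_assoc,
      mul_assoc, unit_mul_unit (by omega)]

theorem mulEnd_pow_succ_mul_unit (n : ℕ) : μ ^ (n + 1) * (σ ^ (n + 2)) 1 = μ ^ (n + 1) := by
  induction n with
  | zero => rw [zero_add, pow_one]; exact hasType_mulEnd.1
  | succ n ih =>
    have h := hasType_mulEnd (k := k) (B := B).mul_unit (n + 1)
    rw [show 2 + (n + 1) = n + 1 + 2 by omega, show 1 + (n + 1) = n + 2 by omega] at h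
    rw [pow_succ, mul_assoc, h, ← mul_assoc, ih]

omit [IsScalarTower k B B] [SMulCommClass k B B] in
theorem opEnd_comp_opInMiddle_comp_act (ht : IsShiftBraiding σ (braidingEnd τ)) {a N M p q : ℕ}
    {w : List ℕ} (hw : ∀ i ∈ w, 1 ≤ i ∧ i < N) (F : (⨂[k]^M B) →ₗ[k] B) (G : (⨂[k]^a B) →ₗ[k] B)
    (hN : N = p + a + q) (hM : p + 1 + q = M) :
    opEnd k B N (F ∘ₗ opInMiddle p q G hN hM ∘ₗ act τ N w) =
      opEnd k B M F * (σ ^ p) (opEnd k B a G) * wordOp σ (braidingEnd τ) w * (σ ^ N) 1 := by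
  rw [opEnd_comp, tensorOp_comp, tensorOp_opInMiddle, tensorOp_act ht hw, wordOp_mul_unit ht hw,
    mul_assoc, ← mul_assoc ((σ ^ N) 1), unit_mul_unit le_rfl, mul_assoc, mul_assoc,
    wordOp_mul_unit ht hw]

theorem mem_shuffleWord {n r i : ℕ} {π : Equiv.Perm (Fin n)} (hi : i ∈ shuffleWord r π) :
    1 ≤ i ∧ i < n := by
  simp only [shuffleWord, List.mem_flatMap] at hi
  obtain ⟨j, _, hj⟩ := hi
  have := mem_seg hj
  have := (π j).2
  omega

theorem mem_nu {r l n i : ℕ} (hi : i ∈ nu r l n) (hl : 1 ≤ l) : 1 ≤ i ∧ i < n := by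
  simp only [nu, List.mem_flatMap, List.mem_range] at hi
  obtain ⟨j, _, hj⟩ := hi
  have := mem_seg hj
  omega

theorem mem_word_opP {m n r s i : ℕ} {π : Equiv.Perm (Fin m)} {ρ : Equiv.Perm (Fin n)} (hs : s < n)
    (hi : i ∈ shuffleWord r π ++ shift m (shuffleWord s ρ) ++ nu m (r + 1) (m + s)) :
    1 ≤ i ∧ i < m + n + 1 := by
  rcases List.mem_append.1 hi with hi | hi
  · rcases List.mem_append.1 hi with hi | hi
    · have := mem_shuffleWord hi
      omega
    · have := mem_shift (fun i hi => mem_shuffleWord hi) hi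
      omega
  · have := mem_nu hi (by omega)
    omega

theorem mem_permWord_append {m n i : ℕ} (π : Equiv.Perm (Fin m)) (ρ : Equiv.Perm (Fin n))
    (hi : i ∈ permWord π ++ shift m (permWord ρ)) : 1 ≤ i ∧ i < m + n := by
  rcases List.mem_append.1 hi with hi | hi
  · have := permWord_mem π i hi
    omega
  · have := mem_shift (permWord_mem ρ) hi
    omega

theorem opEnd_opP (ht : IsShiftBraiding σ (braidingEnd τ)) (m n : ℕ) :
    opEnd k B (m + n + 1) (opP τ m n) = opEnd k B (m + n + 1) (assocOp k B m n) -
      ∑ r : Fin m, ∑ s : Fin n, if 0 < (r : ℕ) + (s : ℕ) then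
        ∑ π ∈ shuffles m r, ∑ ρ ∈ shuffles n s,
          μ * opEnd k B (r + s) (prefactor k B r s) *
            (σ ^ ((r : ℕ) + (s : ℕ))) (opEnd k B (m - r + (n - s) + 1) (opP τ (m - r) (n - s))) *
              wordOp σ (braidingEnd τ) (shuffleWord (r : ℕ) π ++ shift m (shuffleWord (s : ℕ) ρ) ++
                nu m ((r : ℕ) + 1) (m + (s : ℕ)))
      else 0 := by
  rw [opP, map_sub, map_sum]
  congr 1
  refine Finset.sum_congr rfl fun r _ => ?_
  rw [map_sum]
  refine Finset.sum_congr rfl fun s _ => ?_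
  split_ifs with h
  · simp only [map_sum]
    refine Finset.sum_congr rfl fun π _ => Finset.sum_congr rfl fun ρ _ => ?_
    rw [opEnd_comp_act ht fun i hi => mem_word_opP s.2 hi, opEnd_opMul]
  · exact map_zero _

theorem mulEnd_comp_braiding :
    opEnd k B 2 (LinearMap.mul' k B ∘ₗ τ ∘ₗ (twoEquiv k B).toLinearMap) = μ * braidingEnd τ := by
  rw [mulEnd, braidingEnd, ← opEnd_comp]
  refine congrArg _ (LinearMap.ext fun x => ?_)
  simp

variable (τ) in
/-- The operators `m` and `P_{n,1}` for `n ≥ 1`. -/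
def associatorEnd : ℕ → Module.End k (TensorAlgebra k B)
  | 0 => μ
  | n + 1 => opEnd k B (n + 1 + 1 + 1) (opP τ (n + 1) 1)

theorem associatorEnd_of_pos {n : ℕ} (hn : 1 ≤ n) :
    associatorEnd τ n = opEnd k B (n + 1 + 1) (opP τ n 1) := by
  cases n with
  | zero => omega
  | succ n => rfl

theorem opEnd_opS (ht : IsShiftBraiding σ (braidingEnd τ)) (n : ℕ) :
    opEnd k B (n + 2) (opS τ n) =
      -associatorEnd τ n + associatorEnd τ n * gen σ (braidingEnd τ) n := by
  cases n with
  | zero =>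
    rw [opS, braidedCommutator, LinearMap.sub_comp, map_neg, map_sub, LinearMap.comp_assoc,
      mulEnd_comp_braiding, associatorEnd, gen_zero, neg_sub, neg_add_eq_sub]
    rfl
  | succ n =>
    rw [opS, map_add, map_neg, opEnd_comp_tauAt ht (by omega)]
    rfl

theorem opEnd_opS_mul_gen (ht : IsShiftBraiding σ (braidingEnd τ)) (n : ℕ) :
    opEnd k B (n + 2) (opS τ n) * gen σ (braidingEnd τ) n = -opEnd k B (n + 2) (opS τ n) := by
  have h : associatorEnd τ n * (σ ^ (n + 2)) 1 = associatorEnd τ n := by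
    cases n <;> exact (hasType_opEnd _).1
  exact mul_eq_neg_of_eq (opEnd_opS ht n) (ht.gen_sq n) h

theorem shuffles_one_zero : shuffles 1 0 = {1} := by
  ext π
  simp [shuffles, Subsingleton.elim π 1]

theorem opEnd_assocOp_one (n : ℕ) : opEnd k B (n + 1 + 1 + 1) (assocOp k B (n + 1) 1) =
    μ ^ (n + 2) - μ ^ (n + 1) * (σ ^ (n + 1)) μ := by
  rw [assocOp, map_sub]
  congr 1
  · rw [← mulEnd_pow_succ_mul_unit, mulEnd_pow_mul_unit]
    rfl
  · have h : opEnd k B 2 (opMul (a := 1) (b := 1) rfl (rightNormed k B 1) (idOp k B)) = μ := by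
      have := mulEnd_pow_mul_unit (k := k) (B := B) 1
      rw [mulEnd_pow_succ_mul_unit, pow_one] at this
      exact this.symm
    rw [opEnd_opMul, h, ← mulEnd_pow_mul_unit, ← mul_assoc, ← pow_succ', mul_assoc,
      unit_mul_pow_shift]

theorem associatorEnd_succ (ht : IsShiftBraiding σ (braidingEnd τ)) (n : ℕ) :
    associatorEnd τ (n + 1) = μ ^ (n + 2) - μ ^ (n + 1) * (σ ^ (n + 1)) μ -
      ∑ r ∈ Finset.range n, ∑ π ∈ shuffles (n + 1) (r + 1),
        μ ^ (r + 1) * (σ ^ (r + 1)) (associatorEnd τ (n + 1 - (r + 1))) *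
          wordOp σ (braidingEnd τ) (shuffleWord (r + 1) π) := by
  rw [associatorEnd, opEnd_opP ht (n + 1) 1, opEnd_assocOp_one, Finset.sum_range]
  congr 1
  rw [Fin.sum_univ_succ]
  -- For `n = 1` in `P_{m,n}` the only value of `s` is `0`, so the condition `r + s > 0` removes
  -- exactly the term `r = 0`.
  simp only [Finset.univ_unique, Fin.default_eq_zero, Finset.sum_singleton]
  rw [if_neg (by simp), zero_add]
  refine Finset.sum_congr rfl fun r _ => ?_
  rw [if_pos (by simp)]
  refine Finset.sum_congr rfl fun π _ => ?_
  have e : shuffles 1 ((0 : Fin 1) : ℕ) = {1} := shuffles_one_zero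
  rw [e, Finset.sum_singleton, associatorEnd_of_pos (by omega)]
  change μ * opEnd k B (r + 1) (rightNormed k B (r + 1)) *
    (σ ^ ((r : ℕ) + 1)) (opEnd k B (n + 1 - (r + 1) + 1 + 1) (opP τ (n + 1 - (r + 1)) 1)) *
      wordOp σ (braidingEnd τ) (shuffleWord ((r : ℕ) + 1) π ++ [] ++ nu (n + 1) (r + 2) (n + 1)) = _
  -- With `s = 0` no argument of the second block has to be moved.
  have h : nu (n + 1) (r + 2) (n + 1) = [] := by simp [nu]
  rw [h, List.append_nil, List.append_nil, ← mulEnd_pow_mul_unit, ← mul_assoc μ, ← pow_succ',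
    mul_assoc (μ ^ _), unit_mul_pow_shift]

/-- This is the recursion for `P_{n,1}` solved for the product `(u y) z`. The term `r = 0` is
`P_{n,1}` itself, and the term `r = n` is `u (y z)` thanks to the convention `P_{0,1} = m`. -/
theorem sum_associatorEnd (ht : IsShiftBraiding σ (braidingEnd τ)) (n : ℕ) :
    ∑ r ∈ Finset.range (n + 1), ∑ π ∈ shuffles n r,
      μ ^ r * (σ ^ r) (associatorEnd τ (n - r)) *
        wordOp σ (braidingEnd τ) (shuffleWord r π) = μ ^ (n + 1) := by
  have h0 (n : ℕ) : ∑ π ∈ shuffles n 0, μ ^ 0 * (σ ^ 0) (associatorEnd τ (n - 0)) *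
        wordOp σ (braidingEnd τ) (shuffleWord 0 π) = associatorEnd τ n := by
    rw [sum_shuffles (Nat.zero_le n) fun w => μ ^ 0 * (σ ^ 0) (associatorEnd τ (n - 0)) *
      wordOp σ (braidingEnd τ) w]
    simp [extractWord, wordOp]
  have h1 (n : ℕ) : ∑ π ∈ shuffles n n, μ ^ n * (σ ^ n) (associatorEnd τ (n - n)) *
        wordOp σ (braidingEnd τ) (shuffleWord n π) = μ ^ n * (σ ^ n) μ := by
    rw [sum_shuffles le_rfl fun w => μ ^ n * (σ ^ n) (associatorEnd τ (n - n)) *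
      wordOp σ (braidingEnd τ) w]
    have h2 : (Finset.range n).powersetCard n = {Finset.range n} := by
      simpa using Finset.powersetCard_self (Finset.range n)
    have h3 : extractWord 0 ((Finset.range n).sort (· ≤ ·)) = [] := by
      have := extractWord_map_range' id 0 n
      rw [List.map_id] at this
      rw [Finset.sort_range, List.range_eq_range', this]
      simp [seg_self]
    rw [h2, Finset.sum_singleton, h3, wordOp, mul_one, Nat.sub_self]
    rfl
  rcases n with _ | n
  · rw [Finset.sum_range_one, h0]
    simp [associatorEnd]
  · rw [Finset.sum_range_succ, Finset.sum_range_succ', h0, h1, associatorEnd_succ ht]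
    abel

/-- Subtract from the expansion of `(u y) z` its image under the exchange of `y` and `z`. The
shuffle words act on the first `n` letters only and commute with this exchange, so the difference of
each pair of summands is minus the bracket term. -/
theorem bracketRelation_opS (ht : IsShiftBraiding σ (braidingEnd τ)) :
    BracketRelation σ (braidingEnd τ) μ fun n => opEnd k B (n + 2) (opS τ n) := by
  intro n
  rw [← sum_associatorEnd ht n, Finset.sum_mul, ← Finset.sum_sub_distrib, ← Finset.sum_add_distrib]
  refine Finset.sum_eq_zero fun r hr => ?_
  rw [Finset.sum_mul, ← Finset.sum_sub_distrib, ← Finset.sum_add_distrib]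
  refine Finset.sum_eq_zero fun π hπ => ?_
  have hr : n = r + (n - r) := by have := Finset.mem_range.1 hr; omega
  have hg : gen σ (braidingEnd τ) n = (σ ^ r) (gen σ (braidingEnd τ) (n - r)) := by
    rw [← gen_add, ← hr]
  refine sub_mul_add_eq_zero ?_ (wordOp_mul_gen ht (fun i hi => mem_shuffleWord hi) le_rfl)
  beta_reduce
  rw [opEnd_opS ht, map_add, map_neg, map_mul, ← hg]

/-! ### Braidedness of the operations -/

section ShiftOperations

variable (hB : IsBraidedAlgebra τ) (ht : IsShiftBraiding (shiftEnd k B) (braidingEnd τ))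
include hB ht

theorem isShiftOperation_opMul {a b N : ℕ} (hN : N = a + b) {F : (⨂[k]^a B) →ₗ[k] B}
    {G : (⨂[k]^b B) →ₗ[k] B} (ha : 1 ≤ a)
    (hF : IsShiftOperation σ (braidingEnd τ) a (opEnd k B a F))
    (hG : IsShiftOperation σ (braidingEnd τ) b (opEnd k B b G)) :
    IsShiftOperation σ (braidingEnd τ) N (opEnd k B N (opMul hN F G)) := by
  rw [opEnd_opMul]
  subst hN
  exact ht.isShiftOperation_mul hasType_mulEnd (braidingEnd_mul_mulEnd hB ht) ha hF hG

omit hB [IsScalarTower k B B] [SMulCommClass k B B] in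
theorem isShiftOperation_idOp : IsShiftOperation σ (braidingEnd τ) 1 (opEnd k B 1 (idOp k B)) := by
  rw [opEnd_idOp]
  exact ht.isShiftOperation_one

theorem isShiftOperation_rightNormed (n : ℕ) :
    IsShiftOperation σ (braidingEnd τ) n (opEnd k B n (rightNormed k B n)) := by
  induction n with
  | zero => rw [rightNormed, map_zero]; exact .zero 0
  | succ n ih =>
    cases n with
    | zero => exact isShiftOperation_idOp ht
    | succ n =>
      exact isShiftOperation_opMul hB ht rfl (by omega) ih (isShiftOperation_idOp ht)

theorem isShiftOperation_prefactor (r s : ℕ) :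
    IsShiftOperation σ (braidingEnd τ) (r + s) (opEnd k B (r + s) (prefactor k B r s)) := by
  rcases r with _ | r
  -- The arity is generalized from `0 + s` to eliminate the cast. For `s = 0` the dummy value is
  -- zero, which is braided for trivial reasons.
  · have h (n : ℕ) (h : n = s) : IsShiftOperation σ (braidingEnd τ) n
        (opEnd k B n (rightNormed k B s ∘ₗ (TensorPower.cast k B h).toLinearMap)) := by
      subst h
      simpa using isShiftOperation_rightNormed hB ht n
    exact h _ _
  · rcases s with _ | s
    · exact isShiftOperation_rightNormed hB ht _
    · exact isShiftOperation_opMul hB ht rfl (by omega) (isShiftOperation_rightNormed hB ht _)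
        (isShiftOperation_rightNormed hB ht _)

theorem isShiftOperation_opP {m n : ℕ} (hm : 1 ≤ m) (hn : 1 ≤ n) :
    IsShiftOperation σ (braidingEnd τ) (m + n + 1) (opEnd k B (m + n + 1) (opP τ m n)) := by
  obtain ⟨N, hN⟩ : ∃ N, m + n = N := ⟨_, rfl⟩
  induction N using Nat.strong_induction_on generalizing m n with
  | _ N ih =>
  have hR := isShiftOperation_rightNormed hB ht
  rw [opP, map_sub]
  refine .sub ?_ ?_
  · rw [assocOp, map_sub]
    exact .sub (isShiftOperation_opMul hB ht rfl (by omega)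
        (isShiftOperation_opMul hB ht rfl hm (hR m) (hR n)) (isShiftOperation_idOp ht))
      (isShiftOperation_opMul hB ht _ hm (hR m)
        (isShiftOperation_opMul hB ht rfl hn (hR n) (isShiftOperation_idOp ht)))
  · rw [map_sum]
    refine .sum fun r _ => ?_
    rw [map_sum]
    refine .sum fun s _ => ?_
    have := r.2
    have := s.2
    split_ifs with h
    · rw [map_sum]
      refine .sum fun π _ => ?_
      rw [map_sum]
      refine .sum fun ρ _ => ?_
      rw [opEnd_comp_act ht fun i hi => mem_word_opP s.2 hi]
      refine .comp_wordOp ht (isShiftOperation_opMul hB ht _ (by omega)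
        (isShiftOperation_prefactor hB ht _ _) ?_) fun i hi => mem_word_opP s.2 hi
      exact ih _ (by omega) (by omega) (by omega) rfl
    · rw [map_zero]; exact .zero _

theorem isShiftOperation_opS (n : ℕ) :
    IsShiftOperation σ (braidingEnd τ) (n + 2) (opEnd k B (n + 2) (opS τ n)) := by
  have h : IsShiftOperation σ (braidingEnd τ) (n + 2) (associatorEnd τ n) := by
    cases n with
    | zero =>
      exact ht.isShiftOperation (by omega) hasType_mulEnd (by
        rw [associatorEnd, braidingEnd_mul_mulEnd hB ht, moveLeft, moveLeft, moveLeft,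
          ht.mul_shift_one, mul_assoc])
    | succ n => exact isShiftOperation_opP hB ht (by omega) le_rfl
  rw [opEnd_opS ht]
  exact h.neg.add (ht.isShiftOperation_comp_gen h le_rfl)

theorem isShiftOperation_opPhi {m n : ℕ} (hm : 1 ≤ m) (hn : 2 ≤ n) :
    IsShiftOperation σ (braidingEnd τ) (m + n) (opEnd k B (m + n) (opPhi τ m n)) := by
  obtain ⟨n, rfl⟩ := Nat.exists_eq_add_of_le' (show 1 ≤ n by omega)
  rw [opPhi, map_smul, map_sum]
  refine .smul _ (.sum fun π _ => ?_)
  rw [map_sum]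
  refine .sum fun ρ _ => ?_
  have hw := fun i hi => mem_permWord_append (i := i) π ρ hi
  rw [opEnd_comp_act ht hw]
  exact .comp_wordOp ht (isShiftOperation_opP hB ht hm (by omega)) hw

end ShiftOperations

/-! ### Transfer of the identities to multilinear operations -/

section SabininIdentities

theorem opS_exchange (hB : IsBraidedAlgebra τ) (hτ : IsInvolutive τ) (m r : ℕ) (hr : r ≤ m) :
    opS τ (m + 2) - opS τ (m + 2) ∘ₗ tauAt τ (m + 2 + 2) (r + 1) +
      ∑ j : Fin (r + 1), ∑ π ∈ shuffles r j,
        opS τ (m - r + (j : ℕ) + 1) ∘ₗ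
          opInMiddle (j : ℕ) (m - r + 2) (opS τ (r - (j : ℕ))) (by omega) (by omega) ∘ₗ
            act τ (m + 2 + 2) (shuffleWord (j : ℕ) π) = 0 := by
  have ht := isShiftBraiding_braidingEnd hB.braiding hτ
  refine opEnd_injective (m + 2 + 2) ?_
  have h := exchangeOp_eq_zero ht (isShiftOperation_opS hB ht) (bracketRelation_opS ht) m r hr
  rw [map_zero, ← h, exchangeOp, add_mul, sub_mul, map_add, map_sub, map_sum,
    opEnd_comp_tauAt ht (by omega), mul_assoc, ht.gen_mul_unit (by omega), ← mul_assoc,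
    (hasType_opEnd (opS τ (m + 2))).1, Finset.sum_range, Finset.sum_mul]
  congr 1
  refine Finset.sum_congr rfl fun j _ => ?_
  rw [Finset.sum_mul, map_sum]
  refine Finset.sum_congr rfl fun π _ => ?_
  have hw : ∀ i ∈ shuffleWord (j : ℕ) π, 1 ≤ i ∧ i < m + 2 + 2 := fun i hi => by
    have := mem_shuffleWord hi
    omega
  rw [opEnd_comp_opInMiddle_comp_act ht hw]

theorem opS_cyclic (hB : IsBraidedAlgebra τ) (hτ : IsInvolutive τ) (m : ℕ) :
    (opS τ (m + 1) +
      ∑ j : Fin (m + 1), ∑ π ∈ shuffles m j,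
        opS τ (j : ℕ) ∘ₗ
          opInMiddle (j : ℕ) 1 (opS τ (m - (j : ℕ))) (by omega) (by omega) ∘ₗ
            act τ (m + 1 + 2) (shuffleWord (j : ℕ) π)) ∘ₗ
      (LinearMap.id + act τ (m + 1 + 2) [m + 1, m + 2] + act τ (m + 1 + 2) [m + 2, m + 1]) = 0 := by
  have ht := isShiftBraiding_braidingEnd hB.braiding hτ
  refine opEnd_injective (m + 1 + 2) ?_
  have h := cyclicOp_eq_zero ht (isShiftOperation_opS hB ht) (bracketRelation_opS ht) m
  have hX : opEnd k B (m + 1 + 2) (opS τ (m + 1) + ∑ j : Fin (m + 1), ∑ π ∈ shuffles m j,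
      opS τ (j : ℕ) ∘ₗ opInMiddle (j : ℕ) 1 (opS τ (m - (j : ℕ))) (by omega) (by omega) ∘ₗ
        act τ (m + 1 + 2) (shuffleWord (j : ℕ) π)) =
      cyclicTerm (shiftEnd k B) (braidingEnd τ) (fun n => opEnd k B (n + 2) (opS τ n)) m *
        (shiftEnd k B ^ (m + 3)) 1 := by
    rw [cyclicTerm, add_mul, map_add, map_sum, (hasType_opEnd (opS τ (m + 1))).1,
      Finset.sum_range, Finset.sum_mul]
    congr 1
    refine Finset.sum_congr rfl fun j _ => ?_
    rw [Finset.sum_mul, map_sum]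
    refine Finset.sum_congr rfl fun π _ => ?_
    have hw : ∀ i ∈ shuffleWord (j : ℕ) π, 1 ≤ i ∧ i < m + 1 + 2 := fun i hi => by
      have := mem_shuffleWord hi
      omega
    rw [opEnd_comp_opInMiddle_comp_act ht hw]
  have hw₁ : ∀ i ∈ [m + 1, m + 2], 1 ≤ i ∧ i < m + 1 + 2 := by simp
  have hw₂ : ∀ i ∈ [m + 2, m + 1], 1 ≤ i ∧ i < m + 1 + 2 := by simp
  have h₁ := wordOp_mul_unit ht hw₁
  have h₂ := wordOp_mul_unit ht hw₂
  rw [map_zero, ← h, LinearMap.comp_add, LinearMap.comp_add, map_add, map_add,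
    opEnd_comp_act ht hw₁, opEnd_comp_act ht hw₂, LinearMap.comp_id, hX, mul_unit_add_eq h₁ h₂,
    cyclicOp]
  simp [wordOp]

theorem opEnd_opPhi (ht : IsShiftBraiding σ (braidingEnd τ)) (m n : ℕ) :
    opEnd k B (m + (n + 1)) (opPhi τ m (n + 1)) =
      ((m.factorial : k)⁻¹ * ((n + 1).factorial : k)⁻¹) •
        (opEnd k B (m + (n + 1)) (opP τ m n) *
          ∑ π : Equiv.Perm (Fin m), ∑ ρ : Equiv.Perm (Fin (n + 1)),
            wordOp σ (braidingEnd τ) (permWord π ++ shift m (permWord ρ))) := by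
  rw [opPhi, map_smul, map_sum, Finset.mul_sum]
  refine congrArg _ (Finset.sum_congr rfl fun π _ => ?_)
  rw [map_sum, Finset.mul_sum]
  refine Finset.sum_congr rfl fun ρ _ => ?_
  exact opEnd_comp_act ht (fun i hi => mem_permWord_append π ρ hi) _

theorem opPhi_sub_comp_tauAt (ht : IsShiftBraiding σ (braidingEnd τ)) {m n r : ℕ} (hn : 2 ≤ n)
    (hr : 1 ≤ r) (hrn : r < m + n) (hrm : r ≠ m) :
    opPhi τ m n - opPhi τ m n ∘ₗ tauAt τ (m + n) r = 0 := by
  refine opEnd_injective (m + n) ?_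
  obtain ⟨n, rfl⟩ := Nat.exists_eq_add_of_le' (show 1 ≤ n by omega)
  have h := sum_wordOp_mul_gen ht hr hrn hrm
  have hX := opEnd_opPhi ht m n
  rw [map_sub, map_zero, opEnd_comp_tauAt ht ⟨hr, hrn⟩, sub_eq_zero]
  exact (smul_mul_eq_self _ hX (hasType_opEnd _).1 (ht.gen_mul_unit (by omega)) h).symm

end SabininIdentities

end Multiplication

end

section MainTheorem

variable {k : Type*} [Field k] {B : Type*} [NonUnitalNonAssocRing B] [Module k B]
  [IsScalarTower k B B] [SMulCommClass k B B] {τ : B ⊗[k] B →ₗ[k] B ⊗[k] B}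

theorem isSabininAlgebra_opS_opPhi (hB : IsBraidedAlgebra τ) (hτ : IsInvolutive τ) :
    IsSabininAlgebra τ (opS τ) (opPhi τ) := by
  have ht := isShiftBraiding_braidingEnd hB.braiding hτ
  refine ⟨hB.braiding, hτ,
    fun m => isBraidedOperation_of_isShiftOperation ht (isShiftOperation_opS hB ht m),
    fun m n hm hn => isBraidedOperation_of_isShiftOperation ht
      (isShiftOperation_opPhi hB ht hm hn), fun m => ?_, opS_exchange hB hτ, opS_cyclic hB hτ,
    fun m n _ hn r hr hrn hrm => opPhi_sub_comp_tauAt ht hn hr hrn hrm⟩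
  refine opEnd_injective (m + 2) ?_
  rw [map_add, map_zero, opEnd_comp_tauAt ht (by omega), Nat.add_sub_cancel, opEnd_opS_mul_gen ht,
    add_neg_cancel]

end MainTheorem

end BraidedSabinin

theorem theorem7p1 {k : Type*} [Field k] [CharZero k]
    {B : Type*} [NonUnitalNonAssocRing B] [Module k B]
    [IsScalarTower k B B] [SMulCommClass k B B]
    (τ : TensorProduct k B B →ₗ[k] TensorProduct k B B)
    (hB : BraidedSabinin.IsBraidedAlgebra τ)
    (hτ : BraidedSabinin.IsInvolutive τ) :
    BraidedSabinin.IsSabininAlgebra τ (BraidedSabinin.opS τ) (BraidedSabinin.opPhi τ) :=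
  BraidedSabinin.isSabininAlgebra_opS_opPhi hB hτ
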